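/- **Setting.** Let $d\in\{2,3\}$ and let $\Omega\subset\mathbb R^d$ be a bounded domain with $\partial\Omega=\partial\Omega_D\sqcup\partial\Omega_N$ (measurable parts, $|\partial\Omega_D|>0$). It contains $N_\Gamma\ge 2$ fractures $\gamma_k\subset\Omega$, which are relatively open, bounded, connected planar sets of dimension $d-1$. Any two closures $\bar\gamma_j,\bar\gamma_k$ ($j\ne k$) meet exactly in one common set $\mathcal I_\cap$ (a point if $d=2$, a segment if $d=3$), which lies in the relative boundary of every $\gamma_k$. Put $\Gamma=\bigcup_k\gamma_k$. Let $\nu$ be the (symmetric positive definite) bulk permeability, $\nu^\tau_{\gamma_k}$ the (symmetric positive definite) tangential and $\nu^n_{\gamma_k}$ the normal fracture permeability, bounded above and away from $0$, $\ell_k\in C^1(\gamma_k)$ the aperture, bounded above and away from $0$, $\xi>\frac12$, $\eta=\ell/\nu^n$, $\beta=\frac1{2\eta}$, $\alpha=\frac{2}{\eta(2\xi-1)}$. The data are $f\in L^2(\Omega)$, $f_\Gamma^k\in L^2(\gamma_k)$, $g_D\in L^2(\partial\Omega_D)$, $g_\Gamma^k\in L^2(\partial\gamma_k\cap\partial\Omega_D)$.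 **Mesh.** $\mathcal T_h$ is a finite mesh of $\Omega$ by disjoint open connected polytopes $E$ with diameters $h_E$, aligned with $\Gamma$ and with the partition of $\partial\Omega$. Its faces are segments ($d=2$) or triangles ($d=3$); hanging nodes are allowed. Every face is an interior face off the network ($\mathcal F^I$), a fracture face ($\Gamma_h$), a Dirichlet face ($\mathcal F^D$) or a Neumann face. The fracture faces $F$, with diameters $h_F$, form meshes of the $\gamma_k$. The edges of these meshes (points if $d=2$, segments if $d=3$) are interior edges ($\mathcal E^I$), edges in $\partial\Omega_D$ ($\mathcal E^D$), edges in $\partial\Omega_N$, edges in $\mathcal I_\cap$ ($\mathcal E^\cap$, each being an edge of exactly one face $F^k$ of each $\gamma_k$), or immersed tips. $\nu$ and $\ell\nu^\tau$ are constant on each mesh element. A mesh in dimension $m$ is *polytopic-regular with constant $C$* if each element $E$ contains pairwise non-overlapping $m$-simplices $S_F$, one for each face $F$ of $E$, such that $\bar F$ is a facet of $S_F$, $\bar F=\partial E\cap \bar S_F$ and $h_E\le C\,m|S_F|/|F|$. The spaces $Q_h^b$, $Q_h^\Gamma=\prod_kQ_h^{\gamma_k}$ consist of the functions that are polynomials of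 total degree $\le k_E$ on each $E\in\mathcal T_h$, respectively $\le k_F$ on each $F\in\Gamma_h$, with all $k_E,k_F\ge1$. **Jumps and averages.** With outward normals $n^\pm$, on interior faces or edges and on $\Gamma_h$ put $[\![q]\!]=q^+n^++q^-n^-$, $\{v\}=\frac12(v^++v^-)$, and on boundary ones $[\![q]\!]=qn$, $\{v\}=v$. At $\mathcal I_\cap$ put $[\![b]\!]_\cap=(b_i-b_k)_{i<k}$ and $\{\mathbf a\}_\cap=\frac1{N_\Gamma}(\mathbf a_i\cdot\tau_i-\mathbf a_k\cdot\tau_k)_{i<k}$, where $\tau_k$ is the outward unit normal of $\gamma_k$ in its plane. **Penalties.** Put $\pi_E=|\nu_E^{1/2}|_2^2(k_E+1)(k_E+d)/h_E$ and $\pi_F=|(\ell\nu^\tau)_F^{1/2}|_2^2(k_F+1)(k_F+d-1)/h_F$. Then $\sigma=\sigma_0\max(\pi_{E^+},\pi_{E^-})$ on $\mathcal F^I$ and $\sigma=\sigma_0\pi_E$ on $\mathcal F^D$; $\sigma^\Gamma=\sigma_{0,\Gamma}\max(\pi_{F^+},\pi_{F^-})$ on $\mathcal E^I$, $\sigma^\Gamma=\sigma_{0,\Gamma}\pi_F$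 on $\mathcal E^D$, and $\sigma^\cap=\sigma_{0,\Gamma}\max_k\pi_{F^k}$ on $\mathcal E^\cap$. **Discrete problem.** Find $(p_h,p_{\Gamma,h})\in Q_h^b\times Q_h^\Gamma$ such that $\mathcal A_h((p_h,p_{\Gamma,h}),(q,q_\Gamma))=\mathcal L_h(q,q_\Gamma)$ for all $(q,q_\Gamma)\in Q_h^b\times Q_h^\Gamma$, where (with elementwise gradients, tangential on $\Gamma_h$, and integrals over points read as evaluations) $\mathcal A_h=\mathcal A_b(p,q)+\mathcal A_\Gamma(p_\Gamma,q_\Gamma)+\mathcal C$, $$\mathcal A_b(p,q)=\int_{\mathcal T_h}\nu\nabla p\cdot\nabla q-\int_{\mathcal F^I\cup\mathcal F^D}\big(\{\nu\nabla p\}\cdot[\![q]\!]+\{\nu\nabla q\}\cdot[\![p]\!]-\sigma[\![p]\!]\cdot[\![q]\!]\big),$$ $$\mathcal A_\Gamma(p_\Gamma,q_\Gamma)=\int_{\Gamma_h}\ell\nu^\tau\nabla p_\Gamma\cdot\nabla q_\Gamma-\int_{\mathcal E^I\cup\mathcal E^D}\big(\{\ell\nu^\tau\nabla p_\Gamma\}\cdot[\![q_\Gamma]\!]+\{\ell\nu^\tau\nabla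 q_\Gamma\}\cdot[\![p_\Gamma]\!]-\sigma^\Gamma[\![p_\Gamma]\!]\cdot[\![q_\Gamma]\!]\big)$$ $$\qquad-\int_{\mathcal E^\cap}\big(\{\ell\nu^\tau\nabla p_\Gamma\}_\cap\cdot[\![q_\Gamma]\!]_\cap+\{\ell\nu^\tau\nabla q_\Gamma\}_\cap\cdot[\![p_\Gamma]\!]_\cap-\sigma^\cap[\![p_\Gamma]\!]_\cap\cdot[\![q_\Gamma]\!]_\cap\big),$$ $$\mathcal C=\int_{\Gamma_h}\beta[\![p]\!]\cdot[\![q]\!]+\int_{\Gamma_h}\alpha(\{p\}-p_\Gamma)(\{q\}-q_\Gamma),$$ $$\mathcal L_h(q,q_\Gamma)=\int_{\mathcal T_h}fq-\int_{\mathcal F^D}(\nu\nabla q\cdot n-\sigma q)g_D+\int_{\Gamma_h}\ell f_\Gamma q_\Gamma-\int_{\mathcal E^D}(\ell\nu^\tau\nabla q_\Gamma\cdot\tau-\sigma^\Gamma q_\Gamma)g_\Gamma .$$ The energy norm is $$|||(q,q_\Gamma)|||^2=\|\nu^{1/2}\nabla q\|^2_{\mathcal T_h}+\|\sigma^{1/2}[\![q]\!]\|^2_{\mathcal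 F^I\cup\mathcal F^D}+\|(\ell\nu^\tau)^{1/2}\nabla q_\Gamma\|^2_{\Gamma_h}+\|(\sigma^\Gamma)^{1/2}[\![q_\Gamma]\!]\|^2_{\mathcal E^I\cup\mathcal E^D}$$ $$\qquad+\|(\sigma^\cap)^{1/2}[\![q_\Gamma]\!]_\cap\|^2_{\mathcal E^\cap}+\|\beta^{1/2}[\![q]\!]\|^2_{\Gamma_h}+\|\alpha^{1/2}(\{q\}-q_\Gamma)\|^2_{\Gamma_h}.$$ **Proposition.** For every $C$ there are $\sigma_{\min},c,M>0$, depending only on $d$ and $C$, such that for every medium and every discretization as above whose bulk and fracture meshes are polytopic-regular with constant $C$, and for all $\sigma_0,\sigma_{0,\Gamma}\ge\sigma_{\min}$, the discrete problem is well-posed. More precisely, with $u=(p,p_\Gamma)$ and $v=(q,q_\Gamma)$ ranging over $Q_h^b\times Q_h^\Gamma$: 1. $|\mathcal A_h(u,v)|\le M\,|||u|||\,|||v|||$ and $\mathcal A_h(u,u)\ge c\,|||u|||^2$ for all $u,v$, and $|||u|||=0$ only for $u=0$; 2. for all data there is exactly one solution; 3. there is a constant $K$, independent of the data (it may depend on the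 medium, the discretization and $\sigma_0,\sigma_{0,\Gamma}$), such that $|\mathcal L_h(v)|\le K\,G\,|||v|||$ for all $v$, and the solution $u_h=(p_h,p_{\Gamma,h})$ satisfies $|||u_h|||\le \frac Kc\,G$, where $G=\|f\|_{L^2(\Omega)}+\sum_k\|f^k_\Gamma\|_{L^2(\gamma_k)}+\|g_D\|_{L^2(\partial\Omega_D)}+\sum_k\|g^k_\Gamma\|_{L^2(\partial\gamma_k\cap\partial\Omega_D)}$. -/

import Mathlib

open MeasureTheory Filter Topology

noncomputable section

namespace PolyDG

/-- Euclidean space `ℝ^m`. -/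
abbrev Pt (m : ℕ) : Type := EuclideanSpace ℝ (Fin m)

/-- The relatively open simplex spanned by the vertices of `s`: all convex combinations with
strictly positive weights. For a simplex with one vertex this is the vertex itself. -/
def openCell {m j : ℕ} (s : Affine.Simplex ℝ (Pt m) j) : Set (Pt m) :=
  s.setInterior (Set.Ioi 0)

/-! ### Polytopic meshes -/

/-- A polytopic mesh of an open set `Ω ⊆ ℝ^(m+1)`. The elements are open polytopes. The mesh
skeleton is subdivided into faces, which are relatively open `m`-dimensional simplices (points,
segments, triangles for `m = 0, 1, 2`); hanging nodes and any number of faces per element are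
allowed. A face lies between two different elements `plus` and `minus`, or (when `minus` is `none`)
on the boundary of `Ω`. `normal F` is the unit normal of `F` that points out of `plus F`. -/
structure PolyMesh (m : ℕ) (Ω : Set (Pt (m + 1))) where
  numElem : ℕ
  elem : Fin numElem → Set (Pt (m + 1))
  elem_open : ∀ i, IsOpen (elem i)
  elem_connected : ∀ i, IsConnected (elem i)
  elem_subset : ∀ i, elem i ⊆ Ω
  elem_disjoint : ∀ i j, i ≠ j → Disjoint (elem i) (elem j)
  closure_elem : (⋃ i, closure (elem i)) = closure Ω
  numFace : ℕ
  face : Fin numFace → Affine.Simplex ℝ (Pt (m + 1)) m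
  plus : Fin numFace → Fin numElem
  minus : Fin numFace → Option (Fin numElem)
  normal : Fin numFace → Pt (m + 1)
  face_disjoint : ∀ F G, F ≠ G → Disjoint (openCell (face F)) (openCell (face G))
  normal_unit : ∀ F, ‖normal F‖ = 1
  normal_orthogonal : ∀ F a b, inner ℝ (normal F) ((face F).points a - (face F).points b) = 0
  plus_side : ∀ F, ∀ x ∈ openCell (face F), ∀ᶠ t : ℝ in 𝓝[>] 0, x - t • normal F ∈ elem (plus F)
  minus_side : ∀ F i, minus F = some i → i ≠ plus F ∧
    ∀ x ∈ openCell (face F), ∀ᶠ t : ℝ in 𝓝[>] 0, x + t • normal F ∈ elem i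
  interior_face : ∀ F i, minus F = some i → openCell (face F) ⊆ Ω
  boundary_face : ∀ F, minus F = none → openCell (face F) ⊆ frontier Ω
  frontier_elem : ∀ i, frontier (elem i) =
    ⋃ F ∈ {F | plus F = i ∨ minus F = some i}, (face F).closedInterior

namespace PolyMesh

variable {m : ℕ} {Ω : Set (Pt (m + 1))} (T : PolyMesh m Ω)

/-- `F` is one of the faces of the element `i`. -/
def Adj (i : Fin T.numElem) (F : Fin T.numFace) : Prop :=
  T.plus F = i ∨ T.minus F = some i

/-- Polytopic regularity with constant `C`: every element `E` contains non-overlapping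
full-dimensional simplices `S F`, one for each face `F` of `E`, such that `F` is a facet of `S F`,
the closed simplex meets the boundary of `E` exactly in the closed face, and
`h_E ≤ C * d * |S F| / |F|`, where `d = m + 1` is the dimension. -/
def PolytopicRegular (C : ℝ) : Prop :=
  ∀ i, ∃ S : Fin T.numFace → Affine.Simplex ℝ (Pt (m + 1)) (m + 1),
    (∀ F, T.Adj i F →
      openCell (S F) ⊆ T.elem i ∧
      Set.range (T.face F).points ⊆ Set.range (S F).points ∧
      frontier (T.elem i) ∩ (S F).closedInterior = (T.face F).closedInterior ∧
      Metric.diam (T.elem i) ≤ C * (((m + 1 : ℕ) : ℝ) * volume.real (openCell (S F)) /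
        (μHE[m] : Measure (Pt (m + 1))).real (openCell (T.face F)))) ∧
    (∀ F G, T.Adj i F → T.Adj i G → F ≠ G → Disjoint (openCell (S F)) (openCell (S G)))

/-- Average on a face of a piecewise defined function (its trace on a boundary face). -/
def avg {V : Type} [AddCommGroup V] [Module ℝ V] (w : Fin T.numElem → Pt (m + 1) → V)
    (F : Fin T.numFace) (x : Pt (m + 1)) : V :=
  match T.minus F with
  | none => w (T.plus F) x
  | some j => (1 / 2 : ℝ) • (w (T.plus F) x + w j x)

/-- Jump on a face of a piecewise defined scalar function: `q⁺ n⁺ + q⁻ n⁻` on an interior face and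
`q n` on a boundary face. -/
def jump (w : Fin T.numElem → Pt (m + 1) → ℝ) (F : Fin T.numFace) (x : Pt (m + 1)) : Pt (m + 1) :=
  match T.minus F with
  | none => w (T.plus F) x • T.normal F
  | some j => w (T.plus F) x • T.normal F + w j x • (-T.normal F)

/-- The broken polynomial space: on each element `i` a polynomial of total degree at most `k i`
(a polynomial and its restriction to a nonempty open set determine each other). -/
abbrev BrokenPoly (k : Fin T.numElem → ℕ) : Type :=
  (i : Fin T.numElem) → MvPolynomial.restrictTotalDegree (Fin (m + 1)) ℝ (k i)

variable {T} in
/-- Values of a broken polynomial. -/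
def val {k : Fin T.numElem → ℕ} (q : T.BrokenPoly k) (i : Fin T.numElem) (x : Pt (m + 1)) : ℝ :=
  MvPolynomial.eval (fun a => x a) (q i : MvPolynomial (Fin (m + 1)) ℝ)

variable {T} in
/-- Elementwise gradient of a broken polynomial. -/
def grad {k : Fin T.numElem → ℕ} (q : T.BrokenPoly k) (i : Fin T.numElem) (x : Pt (m + 1)) :
    Pt (m + 1) :=
  WithLp.toLp 2 fun b =>
    MvPolynomial.eval (fun a => x a) (MvPolynomial.pderiv b (q i : MvPolynomial (Fin (m + 1)) ℝ))

/-- Elementwise constant diffusion tensor. -/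
abbrev Tensor : Type := Fin T.numElem → Matrix (Fin (m + 1)) (Fin (m + 1)) ℝ

variable {T} in
/-- The flux `κ ∇q`. -/
def flux (κ : T.Tensor) {k : Fin T.numElem → ℕ} (q : T.BrokenPoly k) (i : Fin T.numElem)
    (x : Pt (m + 1)) : Pt (m + 1) :=
  Matrix.toEuclideanCLM (𝕜 := ℝ) (κ i) (grad q i x)

/-- The elementwise quantity `κ̄ (k + 1) (k + d) / h`, where `d = m + 1` is the dimension, `h` the
diameter of the element and `κ̄ = |√κ|₂² = |κ|₂` (spectral norm; `κ` is symmetric positive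
definite). -/
def elemPenalty (κ : T.Tensor) (k : Fin T.numElem → ℕ) (i : Fin T.numElem) : ℝ :=
  ‖Matrix.toEuclideanCLM (𝕜 := ℝ) (κ i)‖ * ((k i : ℝ) + 1) * ((k i : ℝ) + ((m + 1 : ℕ) : ℝ)) /
    Metric.diam (T.elem i)

/-- The penalization parameter on interior and Dirichlet faces, with penalty constant `σ₀`. -/
def penalty (κ : T.Tensor) (k : Fin T.numElem → ℕ) (σ₀ : ℝ) (F : Fin T.numFace) : ℝ :=
  σ₀ * match T.minus F with
    | none => T.elemPenalty κ k (T.plus F)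
    | some j => max (T.elemPenalty κ k (T.plus F)) (T.elemPenalty κ k j)

open Classical in
/-- The symmetric interior penalty form on the mesh `T`; `S` is the set of those faces on which
jumps are penalized. -/
def sip (κ : T.Tensor) (k : Fin T.numElem → ℕ) (σ₀ : ℝ) (S : Set (Fin T.numFace))
    (p q : T.BrokenPoly k) : ℝ :=
  (∑ i, ∫ x in T.elem i, inner ℝ (flux κ p i x) (grad q i x))
  - (∑ F with F ∈ S, ∫ x in openCell (T.face F),
      inner ℝ (T.avg (flux κ p) F x) (T.jump (val q) F x) ∂μHE[m])
  - (∑ F with F ∈ S, ∫ x in openCell (T.face F),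
      inner ℝ (T.avg (flux κ q) F x) (T.jump (val p) F x) ∂μHE[m])
  + (∑ F with F ∈ S, ∫ x in openCell (T.face F),
      T.penalty κ k σ₀ F * inner ℝ (T.jump (val p) F x) (T.jump (val q) F x) ∂μHE[m])

open Classical in
/-- Square of the broken energy seminorm
`‖κ^(1/2) ∇q‖² + ∑_{F ∈ S} ‖σ_F^(1/2) ⟦q⟧‖²_F`. -/
def dgSq (κ : T.Tensor) (k : Fin T.numElem → ℕ) (σ₀ : ℝ) (S : Set (Fin T.numFace))
    (q : T.BrokenPoly k) : ℝ :=
  (∑ i, ∫ x in T.elem i, inner ℝ (flux κ q i x) (grad q i x))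
  + ∑ F with F ∈ S, ∫ x in openCell (T.face F),
      T.penalty κ k σ₀ F * ‖T.jump (val q) F x‖ ^ 2 ∂μHE[m]

open Classical in
/-- The Dirichlet boundary contribution `∫_{S} (κ ∇q · n - σ q) g` over a set `S` of boundary
faces. -/
def dirichletTerm (κ : T.Tensor) (k : Fin T.numElem → ℕ) (σ₀ : ℝ) (S : Set (Fin T.numFace))
    (g : Pt (m + 1) → ℝ) (q : T.BrokenPoly k) : ℝ :=
  ∑ F with F ∈ S, ∫ x in openCell (T.face F),
    (inner ℝ (flux κ q (T.plus F) x) (T.normal F) - T.penalty κ k σ₀ F * val q (T.plus F) x) * g x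
      ∂μHE[m]

end PolyMesh

/-! ### The fractured porous medium -/

/-- A porous medium in dimension `d = n + 2` with a network of at least two planar fractures.
The fracture `γ_k = chart k '' U k` is described in Cartesian coordinates of its plane; all
fractures meet in the set `line '' V` (one point if `d = 2`, one segment if `d = 3`), which lies on
the boundary of each of them. `inPlane k` describes this set in the coordinates of `γ_k`. -/
structure Medium (n : ℕ) where
  Ω : Set (Pt (n + 2))
  Ω_open : IsOpen Ω
  Ω_connected : IsConnected Ω
  Ω_bounded : Bornology.IsBounded Ω
  /-- The part of the boundary that carries Dirichlet conditions. -/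
  bdryD : Set (Pt (n + 2))
  /-- The part of the boundary that carries Neumann conditions. -/
  bdryN : Set (Pt (n + 2))
  bdryD_meas : MeasurableSet bdryD
  bdryN_meas : MeasurableSet bdryN
  bdry_disjoint : Disjoint bdryD bdryN
  bdry_union : bdryD ∪ bdryN = frontier Ω
  bdryD_pos : 0 < (μHE[n + 1] : Measure (Pt (n + 2))) bdryD
  /-- Number of fractures. -/
  N : ℕ
  two_le_N : 2 ≤ N
  chart : Fin N → Pt (n + 1) →ᵃⁱ[ℝ] Pt (n + 2)
  U : Fin N → Set (Pt (n + 1))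
  U_open : ∀ k, IsOpen (U k)
  U_connected : ∀ k, IsConnected (U k)
  U_bounded : ∀ k, Bornology.IsBounded (U k)
  fracture_subset : ∀ k, chart k '' U k ⊆ Ω
  V : Set (Pt n)
  V_convex : Convex ℝ V
  V_compact : IsCompact V
  V_interior : (interior V).Nonempty
  line : Pt n →ᵃⁱ[ℝ] Pt (n + 2)
  inPlane : Fin N → Pt n →ᵃⁱ[ℝ] Pt (n + 1)
  inPlane_spec : ∀ k z, chart k (inPlane k z) = line z
  inPlane_frontier : ∀ k, inPlane k '' V ⊆ frontier (U k)
  inter_eq : ∀ j k, j ≠ k →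
    closure (chart j '' U j) ∩ closure (chart k '' U k) = line '' V
  /-- Bulk permeability. -/
  ν : Pt (n + 2) → Matrix (Fin (n + 2)) (Fin (n + 2)) ℝ
  ν_posDef : ∀ x ∈ Ω, (ν x).PosDef
  /-- Fracture aperture. -/
  ℓ : Fin N → Pt (n + 1) → ℝ
  ℓ_smooth : ∀ k, ContDiffOn ℝ 1 (ℓ k) (U k)
  ℓ_bounds : ∃ a b : ℝ, 0 < a ∧ ∀ k, ∀ y ∈ U k, a < ℓ k y ∧ ℓ k y ≤ b
  /-- Tangential fracture permeability. -/
  νt : (k : Fin N) → Pt (n + 1) → Matrix (Fin (n + 1)) (Fin (n + 1)) ℝ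
  νt_posDef : ∀ k, ∀ y ∈ U k, (νt k y).PosDef
  /-- Normal fracture permeability. -/
  νn : Fin N → Pt (n + 1) → ℝ
  νn_meas : ∀ k, Measurable (νn k)
  νn_bounds : ∃ a b : ℝ, 0 < a ∧ ∀ k, ∀ y ∈ U k, a ≤ νn k y ∧ νn k y ≤ b
  /-- Closure parameter. -/
  ξ : ℝ
  ξ_gt : 1 / 2 < ξ

namespace Medium

variable {n : ℕ} (P : Medium n)

/-- The intersection point (or line) of the network. -/
def interSet : Set (Pt (n + 2)) := P.line '' P.V

def η (k : Fin P.N) (y : Pt (n + 1)) : ℝ := P.ℓ k y / P.νn k y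

def β (k : Fin P.N) (y : Pt (n + 1)) : ℝ := 1 / (2 * P.η k y)

def α (k : Fin P.N) (y : Pt (n + 1)) : ℝ := 2 / (P.η k y * (2 * P.ξ - 1))

/-- The Dirichlet part `∂γ_k ∩ ∂Ω_D` of the boundary of the fracture `γ_k`, in its coordinates. -/
def fracBdryD (k : Fin P.N) : Set (Pt (n + 1)) :=
  frontier (P.U k) ∩ P.chart k ⁻¹' P.bdryD

/-- Source terms and Dirichlet data. -/
structure Data where
  f : Pt (n + 2) → ℝ
  fΓ : Fin P.N → Pt (n + 1) → ℝ
  gD : Pt (n + 2) → ℝ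
  gΓ : Fin P.N → Pt (n + 1) → ℝ
  f_mem : MemLp f 2 (volume.restrict P.Ω)
  fΓ_mem : ∀ k, MemLp (fΓ k) 2 (volume.restrict (P.U k))
  gD_mem : MemLp gD 2 ((μHE[n + 1] : Measure (Pt (n + 2))).restrict P.bdryD)
  gΓ_mem : ∀ k, MemLp (gΓ k) 2 ((μHE[n] : Measure (Pt (n + 1))).restrict (P.fracBdryD k))

variable {P} in
/-- The sum of the `L²` norms of the data. -/
def Data.size (G : P.Data) : ℝ :=
  (eLpNorm G.f 2 (volume.restrict P.Ω)).toReal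
  + (∑ k, (eLpNorm (G.fΓ k) 2 (volume.restrict (P.U k))).toReal)
  + (eLpNorm G.gD 2 ((μHE[n + 1] : Measure (Pt (n + 2))).restrict P.bdryD)).toReal
  + ∑ k, (eLpNorm (G.gΓ k) 2
      ((μHE[n] : Measure (Pt (n + 1))).restrict (P.fracBdryD k))).toReal

end Medium

/-! ### The discretization -/

/-- A polytopic discretization of the medium: a bulk mesh aligned with the fracture network, the
meshes that it induces on the fractures (their elements are the bulk faces lying on the fractures),
the intersection edges (shared by one fracture face from each fracture), and polynomial degrees.
The tensors `ν` and `ℓ νt` are constant on elements. -/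
structure Discretization {n : ℕ} (P : Medium n) where
  bulk : PolyMesh (n + 1) P.Ω
  frac : (k : Fin P.N) → PolyMesh n (P.U k)
  /-- The bulk face that carries a fracture element. -/
  bulkFace : (k : Fin P.N) → Fin (frac k).numElem → Fin bulk.numFace
  bulkFace_spec : ∀ k j, openCell (bulk.face (bulkFace k j)) = P.chart k '' (frac k).elem j
  /-- Boundary faces match the partition of the boundary. -/
  bdry_match : ∀ F, bulk.minus F = none →
    openCell (bulk.face F) ⊆ P.bdryD ∨ openCell (bulk.face F) ⊆ P.bdryN
  /-- Boundary edges of a fracture match the partition of its boundary. -/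
  edge_match : ∀ k e, (frac k).minus e = none →
    P.chart k '' openCell ((frac k).face e) ⊆ P.bdryD ∨
    P.chart k '' openCell ((frac k).face e) ⊆ P.bdryN ∨
    P.chart k '' openCell ((frac k).face e) ⊆ P.interSet ∨
    P.chart k '' openCell ((frac k).face e) ⊆ P.Ω \ P.interSet
  /-- Number of intersection edges. -/
  numInter : ℕ
  /-- The intersection edges, in the coordinates of the intersection line. -/
  interEdge : Fin numInter → Set (Pt n)
  /-- The intersection edge `c` as an edge of the mesh of the fracture `k`. -/
  edgeOf : (k : Fin P.N) → Fin numInter → Fin (frac k).numFace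
  edgeOf_injective : ∀ k, Function.Injective (edgeOf k)
  edgeOf_range : ∀ k, Set.range (edgeOf k) = {e | (frac k).minus e = none ∧
    P.chart k '' openCell ((frac k).face e) ⊆ P.interSet}
  edgeOf_spec : ∀ k c, openCell ((frac k).face (edgeOf k c)) = P.inPlane k '' interEdge c
  /-- Elementwise values of the bulk permeability. -/
  bulkTensor : bulk.Tensor
  bulkTensor_spec : ∀ i, ∀ x ∈ bulk.elem i, P.ν x = bulkTensor i
  /-- Elementwise values of aperture times tangential permeability. -/
  fracTensor : (k : Fin P.N) → (frac k).Tensor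
  fracTensor_spec : ∀ k j, ∀ y ∈ (frac k).elem j, P.ℓ k y • P.νt k y = fracTensor k j
  bulkDeg : Fin bulk.numElem → ℕ
  one_le_bulkDeg : ∀ i, 1 ≤ bulkDeg i
  fracDeg : (k : Fin P.N) → Fin (frac k).numElem → ℕ
  one_le_fracDeg : ∀ k j, 1 ≤ fracDeg k j

namespace Discretization

open PolyMesh

variable {n : ℕ} {P : Medium n} (D : Discretization P)

/-- The bulk mesh and the fracture meshes are polytopic-regular with constant `C`. -/
def PolytopicRegular (C : ℝ) : Prop :=
  D.bulk.PolytopicRegular C ∧ ∀ k, (D.frac k).PolytopicRegular C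

/-- The discrete bulk space. -/
abbrev BulkSpace : Type := D.bulk.BrokenPoly D.bulkDeg

/-- The discrete fracture space (a product over the fractures). -/
abbrev FracSpace : Type := (k : Fin P.N) → (D.frac k).BrokenPoly (D.fracDeg k)

/-- The discrete space of pairs (bulk pressure, fracture pressures). -/
abbrev Space : Type := D.BulkSpace × D.FracSpace

/-- The bulk faces lying on the fracture network. -/
def fracFaces : Set (Fin D.bulk.numFace) := {F | ∃ k j, D.bulkFace k j = F}

/-- The Dirichlet boundary faces. -/
def facesD : Set (Fin D.bulk.numFace) :=
  {F | D.bulk.minus F = none ∧ openCell (D.bulk.face F) ⊆ P.bdryD}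

/-- The interior faces not on the network. -/
def facesI : Set (Fin D.bulk.numFace) := {F | D.bulk.minus F ≠ none ∧ F ∉ D.fracFaces}

/-- The Dirichlet boundary edges of the fracture `k`. -/
def edgesD (k : Fin P.N) : Set (Fin (D.frac k).numFace) :=
  {e | (D.frac k).minus e = none ∧ P.chart k '' openCell ((D.frac k).face e) ⊆ P.bdryD}

/-- The interior edges of the fracture `k`. -/
def edgesI (k : Fin P.N) : Set (Fin (D.frac k).numFace) := {e | (D.frac k).minus e ≠ none}

/-- Bulk bilinear form. -/
def bulkForm (σ₀ : ℝ) (p q : D.BulkSpace) : ℝ :=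
  D.bulk.sip D.bulkTensor D.bulkDeg σ₀ (D.facesI ∪ D.facesD) p q

/-! Jump and average at the intersection, indexed by the pairs of fractures. -/

/-- Pairs of fracture indices with the first one smaller. -/
abbrev Pairs (N : ℕ) : Type := {s : Fin N × Fin N // s.1 < s.2}

/-- Jump of a scalar `b` at the intersection. -/
def interJump {N : ℕ} (b : Fin N → ℝ) (s : Pairs N) : ℝ := b s.1.1 - b s.1.2

/-- Average of a vector field at the intersection in terms of its outward components
`a k = 𝐚_k · τ_k`. -/
def interAvg {N : ℕ} (a : Fin N → ℝ) (s : Pairs N) : ℝ := (1 / (N : ℝ)) * (a s.1.1 - a s.1.2)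

/-- Traces of a discrete fracture function on the intersection edge `c`, one for each fracture. -/
def interVal (q : D.FracSpace) (c : Fin D.numInter) (z : Pt n) (k : Fin P.N) : ℝ :=
  val (q k) ((D.frac k).plus (D.edgeOf k c)) (P.inPlane k z)

/-- The outward fluxes `ℓ_k νt_k ∇q_k · τ_k` on the intersection edge `c`, one for each fracture,
where `τ_k` is the unit vector in the plane of `γ_k` normal to its boundary, pointing out of
`γ_k`. -/
def interFlux (q : D.FracSpace) (c : Fin D.numInter) (z : Pt n) (k : Fin P.N) : ℝ :=
  inner ℝ (flux (D.fracTensor k) (q k) ((D.frac k).plus (D.edgeOf k c)) (P.inPlane k z))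
    ((D.frac k).normal (D.edgeOf k c))

/-- The penalization parameter on an intersection edge: `σ₀Γ` times the maximum over the fracture
elements sharing the edge. -/
def interPenalty (σ₀Γ : ℝ) (c : Fin D.numInter) : ℝ :=
  σ₀Γ * ⨆ k : Fin P.N, (D.frac k).elemPenalty (D.fracTensor k) (D.fracDeg k)
    ((D.frac k).plus (D.edgeOf k c))

/-- Network bilinear form. -/
def fracForm (σ₀Γ : ℝ) (p q : D.FracSpace) : ℝ :=
  (∑ k, (D.frac k).sip (D.fracTensor k) (D.fracDeg k) σ₀Γ (D.edgesI k ∪ D.edgesD k) (p k) (q k))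
  - (∑ c, ∫ z in D.interEdge c,
      interAvg (D.interFlux p c z) ⬝ᵥ interJump (D.interVal q c z))
  - (∑ c, ∫ z in D.interEdge c,
      interAvg (D.interFlux q c z) ⬝ᵥ interJump (D.interVal p c z))
  + (∑ c, ∫ z in D.interEdge c,
      D.interPenalty σ₀Γ c * (interJump (D.interVal p c z) ⬝ᵥ interJump (D.interVal q c z)))

/-- Coupling bilinear form. Integrals over a fracture are computed in its Cartesian coordinates. -/
def couplingForm (u v : D.Space) : ℝ :=
  (∑ k, ∑ j, ∫ y in (D.frac k).elem j, P.β k y *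
      inner ℝ (D.bulk.jump (val u.1) (D.bulkFace k j) (P.chart k y))
        (D.bulk.jump (val v.1) (D.bulkFace k j) (P.chart k y)))
  + ∑ k, ∑ j, ∫ y in (D.frac k).elem j, P.α k y *
      ((D.bulk.avg (val u.1) (D.bulkFace k j) (P.chart k y) - val (u.2 k) j y) *
        (D.bulk.avg (val v.1) (D.bulkFace k j) (P.chart k y) - val (v.2 k) j y))

/-- The bilinear form of the discrete coupled problem. -/
def form (σ₀ σ₀Γ : ℝ) (u v : D.Space) : ℝ :=
  D.bulkForm σ₀ u.1 v.1 + D.fracForm σ₀Γ u.2 v.2 + D.couplingForm u v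

/-- The linear functional of the discrete coupled problem. -/
def load (σ₀ σ₀Γ : ℝ) (G : P.Data) (v : D.Space) : ℝ :=
  ((∑ i, ∫ x in D.bulk.elem i, G.f x * val v.1 i x)
    - D.bulk.dirichletTerm D.bulkTensor D.bulkDeg σ₀ D.facesD G.gD v.1)
  + ((∑ k, ∑ j, ∫ y in (D.frac k).elem j, P.ℓ k y * G.fΓ k y * val (v.2 k) j y)
    - ∑ k, (D.frac k).dirichletTerm (D.fracTensor k) (D.fracDeg k) σ₀Γ (D.edgesD k) (G.gΓ k)
        (v.2 k))

/-- `u` solves the discrete coupled problem with data `G`. -/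
def IsSolution (σ₀ σ₀Γ : ℝ) (G : P.Data) (u : D.Space) : Prop :=
  ∀ v : D.Space, D.form σ₀ σ₀Γ u v = D.load σ₀ σ₀Γ G v

/-- Square of the broken energy norm on the network. -/
def fracSq (σ₀Γ : ℝ) (q : D.FracSpace) : ℝ :=
  (∑ k, (D.frac k).dgSq (D.fracTensor k) (D.fracDeg k) σ₀Γ (D.edgesI k ∪ D.edgesD k) (q k))
  + ∑ c, ∫ z in D.interEdge c,
      D.interPenalty σ₀Γ c * ∑ s, interJump (D.interVal q c z) s ^ 2

/-- Square of the coupling seminorm. -/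
def couplingSq (u : D.Space) : ℝ :=
  (∑ k, ∑ j, ∫ y in (D.frac k).elem j,
      P.β k y * ‖D.bulk.jump (val u.1) (D.bulkFace k j) (P.chart k y)‖ ^ 2)
  + ∑ k, ∑ j, ∫ y in (D.frac k).elem j,
      P.α k y * (D.bulk.avg (val u.1) (D.bulkFace k j) (P.chart k y) - val (u.2 k) j y) ^ 2

/-- The energy norm on the discrete space. -/
def energyNorm (σ₀ σ₀Γ : ℝ) (u : D.Space) : ℝ :=
  Real.sqrt (D.bulk.dgSq D.bulkTensor D.bulkDeg σ₀ (D.facesI ∪ D.facesD) u.1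
    + D.fracSq σ₀Γ u.2 + D.couplingSq u)

end Discretization

end PolyDG

end

/-! The discrete form is a controlled perturbation of an inner product. Let E be the symmetric form
`energyForm`, whose diagonal is the squared energy norm, and let X be `consistencyForm`, the sum of
all terms "average flux times jump". By `form_eq`, A(u,v) = E(u,v) - X(u,v) - X(v,u). Once both
penalty constants are at least 16C and positive, |X(u,v)| ≤ (E(u,u) + E(v,v))/4 and |X(u,u)| ≤
E(u,u)/4. The second bound gives coercivity with constant 1/2. The first is homogenized to |X(u,v)|
≤ √E(u,u) √E(v,v) / 2 and, with Cauchy–Schwarz for E, gives continuity with constant 2.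

The analytic core is the trace inequality `trace_inequality`: for a polynomial q of degree at most k
and a d-simplex S with facet F, d|S| ‖q‖²_F ≤ (k+1)(k+d)|F| ‖q‖²_S. A simplex is a cone over its
facet, so integration along rays from the apex reduces this to the one-dimensional bound p(1)² ≤
(k+1)(k+m+1) ∫₀¹ s^m p(s)² ds with m = d-1, proved with the reproducing polynomial of evaluation at
1 (`exists_hilbert_coeff`, `sq_eval_one_le`). Polytopic regularity then turns d|S|/|F| into the
element diameter. As the simplices of one element do not overlap, their energies add up to at most
the energy of that element (`exists_flux_bound`), so the number of faces never enters a constant. At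
the intersection of the network, the factor 1/N in the average makes the estimate uniform in the
number of fractures (`sum_interAvg_sq_le`).

Definiteness of the norm is a topological matter. Zero energy makes the bulk pressure elementwise
constant, without jumps across any interior face and zero on a Dirichlet face. On a connected domain
it is then constant (`eq_of_forall_minus`), because a generic segment avoids the codimension-two
part of the mesh skeleton. The coupling term finally makes the fracture pressures vanish.

Existence and uniqueness follow by linear algebra in finite dimension. For the load bound, the
coordinate functionals of a basis are represented by the form itself, so continuity of the form
bounds them in the energy norm; coercivity then yields stability. -/

noncomputable section

namespace PolyDG

/-! ### Sharp one-dimensional inverse inequality at an endpoint -/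

open Polynomial in
/-- The polynomial representing evaluation at `1` among the polynomials of degree at most `k`, in
`L²((0, 1), s ^ m ds)`: its coefficients `c i` solve a Hilbert type system. -/
theorem exists_hilbert_coeff (k m : ℕ) : ∃ c : ℕ → ℝ,
    (∀ j ∈ Finset.range (k + 1), ∑ i ∈ Finset.range (k + 1), c i / ((j : ℝ) + i + m + 1) = 1) ∧
    ∑ i ∈ Finset.range (k + 1), c i = ((k : ℝ) + 1) * (k + m + 1) := by
  classical
  set s := Finset.range (k + 1) with hs
  let v : ℕ → ℝ := fun i => -((i : ℝ) + m + 1)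
  have hv : Set.InjOn v s := by
    intro a _ b _ hab
    have : (a : ℝ) = b := by simp only [v] at hab; linarith
    exact_mod_cast this
  -- Both nodal polynomials are monic of degree k+1, so their difference has degree at most k and
  -- equals its own Lagrange interpolant at the nodes v i = -(i+m+1). At x = j the second product
  -- vanishes.
  set f : ℝ[X] := Lagrange.nodal s v - Lagrange.nodal s (fun j : ℕ => (j : ℝ)) with hf
  have hdeg : f.degree < s.card := by
    rw [← Lagrange.degree_nodal (s := s) (v := v)]
    refine degree_sub_lt_left ?_ Lagrange.nodal_ne_zero ?_
    · rw [Lagrange.degree_nodal, Lagrange.degree_nodal]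
    · rw [Lagrange.nodal_monic.leadingCoeff, Lagrange.nodal_monic.leadingCoeff]
  refine ⟨fun i => Lagrange.nodalWeight s v i * f.eval (v i), ?_, ?_⟩
  · intro j hj
    have hne : ∀ i ∈ s, (j : ℝ) ≠ v i := by
      intro i _ h
      have h1 : (0 : ℝ) ≤ j := j.cast_nonneg
      have h2 : (0 : ℝ) ≤ i := i.cast_nonneg
      have h3 : (0 : ℝ) ≤ m := m.cast_nonneg
      simp only [v] at h
      linarith
    -- First barycentric form: f(j) = nodal(j) · Σ wᵢ f(vᵢ)/(j - vᵢ). Since f(j) = nodal(j) ≠ 0, the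
    -- sum is 1, and j - vᵢ = j+i+m+1 is the Hilbert denominator.
    have h1 := Lagrange.eval_interpolate_not_at_node (fun i => f.eval (v i)) hne
    rw [← Lagrange.eq_interpolate hv hdeg] at h1
    have h2 : f.eval (j : ℝ) = eval (j : ℝ) (Lagrange.nodal s v) := by
      rw [hf, eval_sub, Lagrange.eval_nodal_at_node (v := fun j : ℕ => (j : ℝ)) hj, sub_zero]
    have h3 : eval (j : ℝ) (Lagrange.nodal s v) ≠ 0 := Lagrange.eval_nodal_not_at_node hne
    rw [h2] at h1
    have h4 := mul_left_cancel₀ h3 ((mul_one _).trans h1)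
    refine Eq.trans (Finset.sum_congr rfl fun i _ => ?_) h4.symm
    have h5 : (j : ℝ) - v i = j + i + m + 1 := by simp only [v]; ring
    rw [h5]
    ring
  · have h1 := Lagrange.coeff_eq_sum hv hdeg
    -- The sum of the cᵢ is the coefficient of X^k in f. By Vieta it is the difference of the two
    -- node sums with sign, Σ(i+m+1) + Σ j, which equals (k+1)(k+m+1).
    have h2 : ∑ i ∈ s, Lagrange.nodalWeight s v i * f.eval (v i) = f.coeff (s.card - 1) := by
      rw [h1]
      refine Finset.sum_congr rfl fun i _ => ?_
      rw [Lagrange.nodalWeight, Finset.prod_inv_distrib]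
      ring
    have hpos : 0 < s.card := by simp [hs]
    rw [h2, hf, coeff_sub, Lagrange.nodal_eq, Lagrange.nodal_eq,
      prod_X_sub_C_coeff_card_pred _ _ hpos, prod_X_sub_C_coeff_card_pred _ _ hpos]
    simp only [v, hs, Finset.sum_neg_distrib, neg_neg]
    have h3 : ∀ n : ℕ, ∑ i ∈ Finset.range (n + 1), (i : ℝ) = n * (n + 1) / 2 := by
      intro n
      induction n with
      | zero => simp
      | succ n ih => rw [Finset.sum_range_succ, ih]; push_cast; ring
    rw [Finset.sum_add_distrib, Finset.sum_add_distrib, h3]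
    simp only [Finset.sum_const, Finset.card_range, nsmul_eq_mul]
    push_cast
    ring

open Polynomial in
/-- Weighted inverse inequality at an endpoint, with the sharp dependence on the degree. -/
theorem sq_eval_one_le (k m : ℕ) (p : ℝ[X]) (hp : p.natDegree ≤ k) :
    p.eval 1 ^ 2 ≤ ((k : ℝ) + 1) * (k + m + 1) * ∫ s in (0 : ℝ)..1, s ^ m * p.eval s ^ 2 := by
  obtain ⟨c, hc, hcs⟩ := exists_hilbert_coeff k m
  let r : ℝ[X] := ∑ i ∈ Finset.range (k + 1), C (c i) * X ^ i
  have hr : ∀ x, r.eval x = ∑ i ∈ Finset.range (k + 1), c i * x ^ i := by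
    intro x; simp [r, eval_finsetSum]
  have hrdeg : r.natDegree ≤ k := by
    refine natDegree_sum_le_of_forall_le _ _ fun i hi => ?_
    exact (natDegree_C_mul_X_pow_le _ _).trans (Nat.lt_succ_iff.mp (Finset.mem_range.mp hi))
  have hint : ∀ q : ℝ[X], IntervalIntegrable (fun s => s ^ m * q.eval s) volume 0 1 :=
    fun q => (by fun_prop : Continuous fun s : ℝ => s ^ m * q.eval s).intervalIntegrable _ _
  -- It suffices to test monomials: ∫ s^(j+i+m) = 1/(j+i+m+1), so the Hilbert system says exactly
  -- that r reproduces the value at 1.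
  have hrep : ∀ q : ℝ[X], q.natDegree ≤ k →
      ∫ s in (0 : ℝ)..1, s ^ m * (q.eval s * r.eval s) = q.eval 1 := by
    intro q hq
    have h1 : ∀ s : ℝ, s ^ m * (q.eval s * r.eval s) =
        ∑ j ∈ Finset.range (k + 1), ∑ i ∈ Finset.range (k + 1),
          q.coeff j * c i * s ^ (j + i + m) := by
      intro s
      rw [hr, eval_eq_sum_range' (Nat.lt_succ_of_le hq), Finset.sum_mul_sum, Finset.mul_sum]
      refine Finset.sum_congr rfl fun j _ => ?_
      rw [Finset.mul_sum]
      refine Finset.sum_congr rfl fun i _ => ?_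
      ring
    simp_rw [h1]
    rw [intervalIntegral.integral_finsetSum fun j _ =>
      (by fun_prop : Continuous _).intervalIntegrable _ _]
    rw [eval_eq_sum_range' (Nat.lt_succ_of_le hq)]
    refine Finset.sum_congr rfl fun j hj => ?_
    rw [intervalIntegral.integral_finsetSum fun j _ =>
      (by fun_prop : Continuous _).intervalIntegrable _ _]
    rw [one_pow]
    refine Eq.trans ?_ (congrArg (q.coeff j * ·) (hc j hj))
    rw [Finset.mul_sum]
    refine Finset.sum_congr rfl fun i _ => ?_
    rw [intervalIntegral.integral_const_mul, integral_pow]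
    simp only [one_pow, ne_eq, Nat.add_eq_zero_iff, one_ne_zero, and_false, not_false_eq_true,
      zero_pow, sub_zero]
    push_cast
    ring
  have hA : r.eval 1 = ((k : ℝ) + 1) * (k + m + 1) := by rw [hr, ← hcs]; simp
  have hA0 : 0 < r.eval 1 := by rw [hA]; positivity
  -- Cauchy–Schwarz for p and r by hand. Expanding with the reproducing property, also applied to r
  -- itself, leaves r(1) · (r(1)‖p‖² - p(1)²) ≥ 0, and r(1) is the asserted constant.
  have hnn : 0 ≤ ∫ s in (0 : ℝ)..1, s ^ m * (r.eval 1 * p.eval s - p.eval 1 * r.eval s) ^ 2 :=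
    intervalIntegral.integral_nonneg zero_le_one fun s hs =>
      mul_nonneg (pow_nonneg hs.1 _) (sq_nonneg _)
  have hexp : ∀ s : ℝ, s ^ m * (r.eval 1 * p.eval s - p.eval 1 * r.eval s) ^ 2 =
      r.eval 1 ^ 2 * (s ^ m * p.eval s ^ 2) - 2 * r.eval 1 * p.eval 1 *
        (s ^ m * (p.eval s * r.eval s)) + p.eval 1 ^ 2 * (s ^ m * (r.eval s * r.eval s)) := by
    intro s; ring
  simp_rw [hexp] at hnn
  rw [intervalIntegral.integral_add
      ((by fun_prop : Continuous _).intervalIntegrable _ _)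
      ((by fun_prop : Continuous _).intervalIntegrable _ _),
    intervalIntegral.integral_sub ((by fun_prop : Continuous _).intervalIntegrable _ _)
      ((by fun_prop : Continuous _).intervalIntegrable _ _),
    intervalIntegral.integral_const_mul, intervalIntegral.integral_const_mul,
    intervalIntegral.integral_const_mul, hrep p hp, hrep r hrdeg] at hnn
  rw [← hA]
  refine le_of_mul_le_mul_left ?_ hA0
  linarith

/-! ### Open simplices and their Hausdorff measure -/

/-- A simplex of dimension `m` is the isometric image of a full-dimensional simplex of `ℝ^m`. -/
theorem exists_isometric_model {m n : ℕ} (F : Affine.Simplex ℝ (Pt n) m) :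
    ∃ (ι : Pt m →ᵃⁱ[ℝ] Pt n) (G : Affine.Simplex ℝ (Pt m) m),
      G.map ι.toAffineMap ι.injective = F := by
  set D := vectorSpan ℝ (Set.range F.points) with hD
  have hfin : Module.finrank ℝ D = m := F.independent.finrank_vectorSpan (by simp)
  let L : Pt m ≃ₗᵢ[ℝ] D := ((stdOrthonormalBasis ℝ D).reindex (finCongr hfin)).repr.symm
  let ι : Pt m →ᵃⁱ[ℝ] Pt n :=
    (AffineIsometryEquiv.vaddConst ℝ (F.points 0)).toAffineIsometry.comp
      (D.subtypeₗᵢ.comp L.toLinearIsometry).toAffineIsometry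
  have hι : ∀ z, ι z = (L z : Pt n) + F.points 0 := fun z => rfl
  have hmem : ∀ i, F.points i - F.points 0 ∈ D := fun i =>
    vsub_mem_vectorSpan ℝ (Set.mem_range_self i) (Set.mem_range_self 0)
  let g : Fin (m + 1) → Pt m := fun i => L.symm ⟨F.points i - F.points 0, hmem i⟩
  have hg : ∀ i, ι (g i) = F.points i := by
    intro i
    rw [hι, LinearIsometryEquiv.apply_symm_apply, sub_add_cancel]
  have hcomp : ι.toAffineMap ∘ g = F.points := funext hg
  refine ⟨ι, ⟨g, AffineIndependent.of_comp ι.toAffineMap (hcomp ▸ F.independent)⟩, ?_⟩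
  ext1 i
  exact hg i

section FullDimensional

variable {m : ℕ} (G : Affine.Simplex ℝ (Pt m) m)

theorem openCell_eq_interior : openCell G = interior G.closedInterior := by
  let b : AffineBasis (Fin (m + 1)) ℝ (Pt m) :=
    ⟨G.points, G.independent, G.span_eq_top (by simp)⟩
  rw [← Affine.Simplex.convexHull_eq_closedInterior]
  refine Eq.trans ?_ b.interior_convexHull.symm
  ext x
  constructor
  · rintro ⟨w, hw, hpos, rfl⟩ i
    have := b.coord_apply_combination_of_mem (Finset.mem_univ i) hw
    exact lt_of_lt_of_eq (hpos i) this.symm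
  · intro hx
    exact ⟨fun i => b.coord i x, b.sum_coord_apply_eq_one x, hx,
      b.affineCombination_coord_eq_self x⟩

theorem isOpen_openCell : IsOpen (openCell G) := openCell_eq_interior G ▸ isOpen_interior

end FullDimensional

theorem openCell_nonempty {n m : ℕ} (F : Affine.Simplex ℝ (Pt n) m) : (openCell F).Nonempty := by
  refine ⟨Finset.univ.affineCombination ℝ F.points fun _ => ((m : ℝ) + 1)⁻¹, _, ?_, ?_, rfl⟩
  · simp only [Finset.sum_const, Finset.card_univ, Fintype.card_fin, nsmul_eq_mul]
    push_cast
    exact mul_inv_cancel₀ (by positivity)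
  · intro i
    exact Set.mem_Ioi.mpr (by positivity)

theorem openCell_subset_closedInterior {n m : ℕ} (F : Affine.Simplex ℝ (Pt n) m) :
    openCell F ⊆ F.closedInterior := by
  rintro x ⟨w, hw, hpos, rfl⟩
  refine ⟨w, hw, fun i => ⟨(hpos i).le, ?_⟩, rfl⟩
  rw [← hw]
  exact Finset.single_le_sum (fun j _ => (hpos j).le) (Finset.mem_univ i)

theorem isCompact_closedInterior {n m : ℕ} (F : Affine.Simplex ℝ (Pt n) m) :
    IsCompact F.closedInterior := by
  rw [← Affine.Simplex.convexHull_eq_closedInterior F]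
  exact (Set.finite_range F.points).isCompact_convexHull (𝕜 := ℝ)

theorem isBounded_openCell {n m : ℕ} (F : Affine.Simplex ℝ (Pt n) m) :
    Bornology.IsBounded (openCell F) :=
  (isCompact_closedInterior F).isBounded.subset (openCell_subset_closedInterior F)

theorem measurableSet_openCell {n m : ℕ} (F : Affine.Simplex ℝ (Pt n) m) :
    MeasurableSet (openCell F) := by
  obtain ⟨ι, G, rfl⟩ := exists_isometric_model F
  rw [openCell, Affine.Simplex.setInterior_map]
  exact (ι.isometry.isClosedEmbedding.measurableEmbedding.measurableSet_image).mpr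
    (isOpen_openCell G).measurableSet

theorem hausdorff_image {m n : ℕ} (ι : Pt m →ᵃⁱ[ℝ] Pt n) (W : Set (Pt m)) :
    (μHE[m] : Measure (Pt n)) (ι '' W) = volume W := by
  rw [ι.isometry.euclideanHausdorffMeasure_image,
    EuclideanSpace.euclideanHausdorffMeasure_eq_volume]

theorem hausdorff_restrict_image {m n : ℕ} (ι : Pt m →ᵃⁱ[ℝ] Pt n) (W : Set (Pt m)) :
    (μHE[m] : Measure (Pt n)).restrict (ι '' W) = (volume.restrict W).map ι := by
  have hemb := ι.isometry.isClosedEmbedding.measurableEmbedding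
  have h1 : (μHE[m] : Measure (Pt n)).restrict (ι '' W) =
      ((volume : Measure (Pt m)).map ι).restrict (ι '' W) := by
    rw [← EuclideanSpace.euclideanHausdorffMeasure_eq_volume,
      ι.isometry.map_euclideanHausdorffMeasure,
      Measure.restrict_restrict_of_subset (Set.image_subset_range _ _)]
  rw [h1, hemb.restrict_map, Set.preimage_image_eq _ ι.injective]

theorem setIntegral_hausdorff_image {m n : ℕ} (ι : Pt m →ᵃⁱ[ℝ] Pt n) (W : Set (Pt m))
    {E : Type*} [NormedAddCommGroup E] [NormedSpace ℝ E] (g : Pt n → E) :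
    ∫ x in ι '' W, g x ∂μHE[m] = ∫ z in W, g (ι z) := by
  rw [hausdorff_restrict_image,
    ι.isometry.isClosedEmbedding.measurableEmbedding.integral_map]

theorem hausdorff_openCell_lt_top {n m : ℕ} (F : Affine.Simplex ℝ (Pt n) m) :
    (μHE[m] : Measure (Pt n)) (openCell F) < ⊤ := by
  obtain ⟨ι, G, rfl⟩ := exists_isometric_model F
  rw [openCell, Affine.Simplex.setInterior_map]
  exact (hausdorff_image ι _).trans_lt (isBounded_openCell G).measure_lt_top

theorem hausdorff_openCell_pos {n m : ℕ} (F : Affine.Simplex ℝ (Pt n) m) :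
    0 < (μHE[m] : Measure (Pt n)) (openCell F) := by
  obtain ⟨ι, G, rfl⟩ := exists_isometric_model F
  rw [openCell, Affine.Simplex.setInterior_map]
  exact ((isOpen_openCell G).measure_pos volume (openCell_nonempty G)).trans_eq
    (hausdorff_image ι _).symm

/-- In the coordinates of its own plane a closed simplex is convex, and the frontier of a convex set
is Lebesgue-null. This later ensures that a boundary part of positive measure cannot hide in the
relative boundaries of the faces. -/
theorem hausdorff_closedInterior_diff {n m : ℕ} (F : Affine.Simplex ℝ (Pt n) m) :
    (μHE[m] : Measure (Pt n)) (F.closedInterior \ openCell F) = 0 := by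
  obtain ⟨ι, G, rfl⟩ := exists_isometric_model F
  rw [openCell, Affine.Simplex.setInterior_map, Affine.Simplex.closedInterior,
    Affine.Simplex.setInterior_map]
  change μHE[m] ((ι '' _) \ (ι '' _)) = 0
  rw [← Set.image_sdiff ι.injective, hausdorff_image]
  have h1 : Convex ℝ (G.setInterior (Set.Icc 0 1)) := by
    change Convex ℝ G.closedInterior
    rw [← Affine.Simplex.convexHull_eq_closedInterior]
    exact convex_convexHull ℝ _
  refine measure_mono_null ?_ (h1.addHaar_frontier volume)
  change G.closedInterior \ openCell G ⊆ frontier G.closedInterior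
  rw [openCell_eq_interior]
  exact Set.sdiff_subset_sdiff_left subset_closure

/-- A continuous function is integrable on a bounded measurable set of finite measure. -/
theorem integrableOn_of_continuous {X E : Type*} [PseudoMetricSpace X] [ProperSpace X]
    [MeasurableSpace X] [OpensMeasurableSpace X] [NormedAddCommGroup E]
    [SecondCountableTopologyEither X E]
    {μ : Measure X} {s : Set X} (hs : MeasurableSet s) (hb : Bornology.IsBounded s)
    (hμ : μ s < ⊤) {g : X → E} (hg : Continuous g) : IntegrableOn g s μ := by
  obtain ⟨C, hC⟩ := hb.isCompact_closure.exists_bound_of_continuousOn hg.continuousOn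
  exact Measure.integrableOn_of_bounded (M := C) hμ.ne hg.aestronglyMeasurable
    ((ae_restrict_iff' hs).mpr (ae_of_all _ fun x hx => hC x (subset_closure hx)))

theorem integrableOn_openCell {n m : ℕ} (F : Affine.Simplex ℝ (Pt n) m) {E : Type*}
    [NormedAddCommGroup E] [SecondCountableTopologyEither (Pt n) E] {g : Pt n → E}
    (hg : Continuous g) : IntegrableOn g (openCell F) μHE[m] :=
  integrableOn_of_continuous (measurableSet_openCell F) (isBounded_openCell F)
    (hausdorff_openCell_lt_top F) hg

/-! ### Integration over cones and the trace inequality on a simplex -/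

open scoped Pointwise in
/-- Integration over a truncated cone `{(s, s z) | z ∈ W, 0 < s < 1}`. -/
theorem setIntegral_cone {m : ℕ} {W : Set (Pt m)} (hW : MeasurableSet W)
    (hb : Bornology.IsBounded W) {f : ℝ × Pt m → ℝ} (hf : Continuous f) :
    ∫ p in (fun p : Pt m × ℝ => (p.2, p.2 • p.1)) '' (W ×ˢ Set.Ioo 0 1), f p =
      ∫ z in W, ∫ s in (0 : ℝ)..1, s ^ m * f (s, s • z) := by
  set K : Set (ℝ × Pt m) := (fun p : Pt m × ℝ => (p.2, p.2 • p.1)) '' (W ×ˢ Set.Ioo 0 1) with hK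
  -- The slice of the cone at height s is the dilated base s • W; scaling it back to W in Fubini's
  -- theorem produces the weight s^m.
  have hmem : ∀ s w, (s, w) ∈ K ↔ s ∈ Set.Ioo (0 : ℝ) 1 ∧ w ∈ s • W := by
    intro s w
    constructor
    · rintro ⟨⟨z, t⟩, ⟨hz, ht⟩, h⟩
      obtain ⟨rfl, rfl⟩ := Prod.mk.inj h
      exact ⟨ht, Set.smul_mem_smul_set hz⟩
    · rintro ⟨hs, z, hz, rfl⟩
      exact ⟨(z, s), ⟨hz, hs⟩, rfl⟩
  have hKm : MeasurableSet K := by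
    have h1 : K = {p | p.1 ∈ Set.Ioo (0 : ℝ) 1 ∧ p.1⁻¹ • p.2 ∈ W} := by
      ext ⟨s, w⟩
      rw [hmem]
      refine and_congr_right fun hs => ?_
      rw [Set.mem_smul_set_iff_inv_smul_mem₀ hs.1.ne']
    rw [h1]
    exact (measurable_fst measurableSet_Ioo).inter
      ((measurable_fst.inv.smul measurable_snd) hW)
  obtain ⟨R, hR⟩ := hb.subset_closedBall (0 : Pt m)
  have hKb : Bornology.IsBounded K := by
    refine ((Metric.isBounded_Icc (0 : ℝ) 1).prod
      (Metric.isBounded_closedBall (x := (0 : Pt m)) (r := R))).subset ?_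
    rintro ⟨s, w⟩ hsw
    obtain ⟨hs, z, hz, rfl⟩ := (hmem _ _).mp hsw
    refine ⟨⟨hs.1.le, hs.2.le⟩, ?_⟩
    have hz' := mem_closedBall_zero_iff.mp (hR hz)
    rw [mem_closedBall_zero_iff, norm_smul, Real.norm_of_nonneg hs.1.le]
    exact (mul_le_of_le_one_left (norm_nonneg _) hs.2.le).trans hz'
  have hKi : IntegrableOn f K := integrableOn_of_continuous hKm hKb hKb.measure_lt_top hf
  rw [← integral_indicator hKm, Measure.volume_eq_prod,
    integral_prod _ (by rw [← Measure.volume_eq_prod]; exact hKi.integrable_indicator hKm)]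
  have hinner : ∀ s : ℝ, ∫ w, K.indicator f (s, w) =
      (Set.Ioo (0 : ℝ) 1).indicator (fun s => ∫ z in W, s ^ m * f (s, s • z)) s := by
    intro s
    by_cases hs : s ∈ Set.Ioo (0 : ℝ) 1
    · rw [Set.indicator_of_mem hs]
      have h1 : ∀ w, K.indicator f (s, w) = (s • W).indicator (fun w => f (s, w)) w := by
        intro w
        by_cases hw : w ∈ s • W
        · rw [Set.indicator_of_mem hw, Set.indicator_of_mem ((hmem _ _).mpr ⟨hs, hw⟩)]
        · rw [Set.indicator_of_notMem hw,
            Set.indicator_of_notMem fun h => hw ((hmem _ _).mp h).2]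
      simp_rw [h1]
      rw [integral_indicator (hW.const_smul₀ s), integral_const_mul,
        Measure.setIntegral_comp_smul_of_pos volume (fun w => f (s, w)) W hs.1,
        finrank_euclideanSpace_fin, smul_eq_mul, mul_inv_cancel_left₀ (pow_pos hs.1 m).ne']
    · rw [Set.indicator_of_notMem hs]
      have h1 : ∀ w, K.indicator f (s, w) = 0 := fun w =>
        Set.indicator_of_notMem (fun h => hs ((hmem _ _).mp h).1) _
      simp [h1]
  simp_rw [hinner]
  rw [integral_indicator measurableSet_Ioo]
  have hswap : Integrable (Function.uncurry fun (s : ℝ) (z : Pt m) => s ^ m * f (s, s • z))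
      ((volume.restrict (Set.Ioo (0 : ℝ) 1)).prod (volume.restrict W)) := by
    rw [Measure.prod_restrict, ← Measure.volume_eq_prod]
    have hB : Bornology.IsBounded (Set.Ioo (0 : ℝ) 1 ×ˢ W) := (Metric.isBounded_Ioo _ _).prod hb
    exact integrableOn_of_continuous (measurableSet_Ioo.prod hW) hB hB.measure_lt_top
      (by fun_prop)
  rw [integral_integral_swap hswap]
  refine integral_congr_ae (ae_of_all _ fun z => ?_)
  change ∫ s in Set.Ioo (0 : ℝ) 1, _ = ∫ s in (0 : ℝ)..1, _
  rw [intervalIntegral.integral_of_le zero_le_one, integral_Ioc_eq_integral_Ioo]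

/-- Integration over the open cone with apex `a` and base `ι '' W`, in polar coordinates with
respect to the apex. -/
theorem exists_setIntegral_cone {m : ℕ} (ι : Pt m →ᵃⁱ[ℝ] Pt (m + 1)) {a : Pt (m + 1)}
    (ha : a ∉ Set.range ι) {W : Set (Pt m)} (hW : MeasurableSet W) (hb : Bornology.IsBounded W) :
    ∃ c : ℝ, 0 < c ∧ ∀ g : Pt (m + 1) → ℝ, Continuous g →
      ∫ x in (fun p : Pt (m + 1) × ℝ => AffineMap.lineMap a p.1 p.2) '' ((ι '' W) ×ˢ Set.Ioo 0 1),
        g x = c * ∫ z in W, ∫ s in (0 : ℝ)..1, s ^ m * g (AffineMap.lineMap a (ι z) s) := by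
  -- After translating the apex to the origin, the cone is the image of the truncated standard cone
  -- under T. T is injective precisely because the apex lies off the hyperplane of the base.
  let T : ℝ × Pt m →ₗ[ℝ] Pt (m + 1) :=
    (LinearMap.toSpanSingleton ℝ _ (ι 0 - a)).coprod ι.linearIsometry.toLinearMap
  have hT : ∀ s w, T (s, w) = s • (ι 0 - a) + ι.linearIsometry w := fun s w => by
    simp [T]
  have hι : ∀ w, ι w = ι.linearIsometry w + ι 0 := fun w => by
    simpa using ι.map_vadd 0 w
  have hTinj : Function.Injective T := by
    rw [← LinearMap.ker_eq_bot, LinearMap.ker_eq_bot']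
    rintro ⟨s, w⟩ h
    rw [hT] at h
    have hs : s = 0 := by
      by_contra hs
      refine ha ⟨s⁻¹ • w, ?_⟩
      have h2 : s⁻¹ • (s • (ι 0 - a) + ι.linearIsometry w) = 0 := by rw [h, smul_zero]
      rw [smul_add, inv_smul_smul₀ hs] at h2
      rw [hι, map_smul]
      rw [← sub_eq_zero, ← h2]
      abel
    subst hs
    rw [zero_smul, zero_add] at h
    rw [(map_eq_zero_iff _ ι.linearIsometry.injective).mp h]
    rfl
  let e : (ℝ × Pt m) ≃L[ℝ] Pt (m + 1) :=
    (LinearMap.linearEquivOfInjective T hTinj (by simp [add_comm])).toContinuousLinearEquiv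
  have he : ∀ s w, e (s, w) = s • (ι 0 - a) + ι.linearIsometry w := hT
  have hemb : MeasurableEmbedding e := e.toHomeomorph.measurableEmbedding
  set ρ : Measure (Pt (m + 1)) := (volume : Measure (ℝ × Pt m)).map e with hρ
  have hprod : (volume : Measure (ℝ × Pt m)).IsAddHaarMeasure :=
    Measure.prod.instIsAddHaarMeasure volume volume
  have hρH : ρ.IsAddHaarMeasure := e.isAddHaarMeasure_map volume
  -- By uniqueness of Haar measure the Jacobian is some positive constant. Its value is not needed:
  -- in the trace inequality it appears on both sides.
  set c := Measure.addHaarScalarFactor (volume : Measure (Pt (m + 1))) ρ with hc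
  have hvol : (volume : Measure (Pt (m + 1))) = c • ρ := Measure.isAddLeftInvariant_eq_smul _ _
  have hcpos : 0 < c := Measure.addHaarScalarFactor_pos_of_isAddHaarMeasure _ _
  refine ⟨c, hcpos, fun g hg => ?_⟩
  have hpt : ∀ z (s : ℝ), AffineMap.lineMap a (ι z) s = a + e (s, s • z) := by
    intro z s
    rw [he, AffineMap.lineMap_apply_module, map_smul, hι z]
    module
  have hset : (fun p : Pt (m + 1) × ℝ => AffineMap.lineMap a p.1 p.2) ''
      ((ι '' W) ×ˢ Set.Ioo 0 1) = (fun y => a + y) '' (e ''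
        ((fun p : Pt m × ℝ => (p.2, p.2 • p.1)) '' (W ×ˢ Set.Ioo 0 1))) := by
    ext x
    constructor
    · rintro ⟨⟨_, s⟩, ⟨⟨z, hz, rfl⟩, hs⟩, rfl⟩
      exact ⟨_, ⟨_, ⟨(z, s), ⟨hz, hs⟩, rfl⟩, rfl⟩, (hpt z s).symm⟩
    · rintro ⟨_, ⟨_, ⟨⟨z, s⟩, ⟨hz, hs⟩, rfl⟩, rfl⟩, rfl⟩
      exact ⟨(ι z, s), ⟨⟨z, hz, rfl⟩, hs⟩, hpt z s⟩
  rw [hset, (measurePreserving_add_left volume a).setIntegral_image_emb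
    (measurableEmbedding_addLeft a), hvol, Measure.restrict_smul, integral_smul_nnreal_measure,
    hρ, hemb.setIntegral_map, Set.preimage_image_eq _ e.injective,
    setIntegral_cone hW hb (f := fun p => g (a + e p)) (by fun_prop), NNReal.smul_def, smul_eq_mul]
  congr 1
  refine integral_congr_ae (ae_of_all _ fun z => ?_)
  refine intervalIntegral.integral_congr fun s _ => ?_
  rw [hpt]

/-- A simplex is the cone over any of its facets. -/
theorem exists_openCell_eq_cone {m : ℕ} (S : Affine.Simplex ℝ (Pt (m + 1)) (m + 1))
    (F : Affine.Simplex ℝ (Pt (m + 1)) m) (hFS : Set.range F.points ⊆ Set.range S.points) :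
    ∃ a, a ∉ affineSpan ℝ (Set.range F.points) ∧
      openCell S = (fun p : Pt (m + 1) × ℝ => AffineMap.lineMap a p.1 p.2) ''
        (openCell F ×ˢ Set.Ioo 0 1) := by
  choose φ hφ using fun j => hFS (Set.mem_range_self j)
  have hφi : Function.Injective φ := by
    intro i j hij
    apply F.independent.injective
    rw [← hφ, ← hφ, hij]
  obtain ⟨i₀, hi₀⟩ : ∃ i₀, i₀ ∉ Set.range φ := by
    by_contra! h
    have := Fintype.card_le_of_surjective φ h
    simp at this
  have hbij : Function.Bijective (Fin.cons i₀ φ : Fin (m + 2) → Fin (m + 2)) :=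
    Finite.injective_iff_bijective.mp (Fin.cons_injective_iff.mpr ⟨hi₀, hφi⟩)
  let e := Equiv.ofBijective _ hbij
  have hspan : S.points i₀ ∉ affineSpan ℝ (Set.range F.points) := by
    have h1 : Set.range F.points = S.points '' Set.range φ := by
      rw [← Set.range_comp]
      exact congrArg Set.range (funext fun j => (hφ j).symm)
    rw [h1, S.independent.mem_affineSpan_iff]
    exact hi₀
  refine ⟨S.points i₀, hspan, ?_⟩
  have hre : openCell S = openCell (S.reindex e.symm) :=
    (Affine.Simplex.setInterior_reindex _ _ _).symm
  have h0 : (S.reindex e.symm).points 0 = S.points i₀ := rfl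
  have hs : ∀ j : Fin (m + 1), (S.reindex e.symm).points j.succ = F.points j := fun j => by
    rw [← hφ j]; rfl
  rw [hre]
  have hcomb : ∀ w : Fin (m + 2) → ℝ, ∑ i, w i = 1 →
      Finset.univ.affineCombination ℝ (S.reindex e.symm).points w =
        w 0 • S.points i₀ + ∑ j : Fin (m + 1), w j.succ • F.points j := by
    intro w hw
    rw [Finset.affineCombination_eq_linear_combination _ _ _ hw, Fin.sum_univ_succ, h0]
    simp_rw [hs]
  have hline : ∀ (y : Pt (m + 1)) (s : ℝ),
      AffineMap.lineMap (S.points i₀) y s = (1 - s) • S.points i₀ + s • y := fun y s =>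
    AffineMap.lineMap_apply_module _ _ _
  ext x
  constructor
  · rintro ⟨w, hw, hpos, rfl⟩
    rw [hcomb w hw]
    rw [Fin.sum_univ_succ] at hw
    have hsum : 0 < ∑ j : Fin (m + 1), w j.succ :=
      Finset.sum_pos (fun j _ => hpos _) Finset.univ_nonempty
    have hw0 : 0 < w 0 := hpos 0
    set s := ∑ j : Fin (m + 1), w j.succ with hsdef
    have hw' : ∑ j : Fin (m + 1), s⁻¹ * w j.succ = 1 := by
      rw [← Finset.mul_sum, ← hsdef, inv_mul_cancel₀ hsum.ne']
    refine ⟨(Finset.univ.affineCombination ℝ F.points fun j => s⁻¹ * w j.succ, s),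
      ⟨⟨_, hw', fun j => mul_pos (inv_pos.mpr hsum) (hpos _), rfl⟩, hsum, by
        change s < 1
        linarith⟩, ?_⟩
    change AffineMap.lineMap _ _ s = _
    rw [hline, Finset.affineCombination_eq_linear_combination _ _ _ hw', Finset.smul_sum]
    congr 1
    · congr 1; linarith
    · refine Finset.sum_congr rfl fun j _ => ?_
      rw [smul_smul, mul_inv_cancel_left₀ hsum.ne']
  · rintro ⟨⟨_, s⟩, ⟨⟨w, hw, hpos, rfl⟩, hs01⟩, rfl⟩
    have hw' : ∑ i, (Fin.cons (1 - s) (fun j => s * w j) : Fin (m + 2) → ℝ) i = 1 := by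
      rw [Fin.sum_univ_succ]
      simp only [Fin.cons_zero, Fin.cons_succ, ← Finset.mul_sum, hw]
      ring
    refine ⟨_, hw', ?_, ?_⟩
    · intro i
      refine Fin.cases ?_ (fun j => ?_) i
      · exact sub_pos.mpr hs01.2
      · exact mul_pos hs01.1 (hpos j)
    · rw [hcomb _ hw']
      change _ = AffineMap.lineMap _ _ s
      rw [hline, Finset.affineCombination_eq_linear_combination _ _ _ hw, Finset.smul_sum]
      simp only [Fin.cons_zero, Fin.cons_succ, smul_smul]

/-- The restriction of a polynomial to a line is a polynomial of at most the same degree. -/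
theorem exists_polynomial_lineMap {n k : ℕ} (q : MvPolynomial (Fin n) ℝ) (hq : q.totalDegree ≤ k)
    (a y : Pt n) : ∃ p : Polynomial ℝ, p.natDegree ≤ k ∧
      ∀ s : ℝ, p.eval s = MvPolynomial.eval (fun i => AffineMap.lineMap a y s i) q := by
  let l : Fin n → Polynomial ℝ := fun i => Polynomial.C (a i) + Polynomial.C (y i - a i) * .X
  refine ⟨MvPolynomial.aeval l q, ?_, fun s => ?_⟩
  · have := MvPolynomial.aeval_natDegree_le (n := 1) q hq l fun i => by
      refine (Polynomial.natDegree_add_le _ _).trans (max_le ?_ ?_)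
      · simp
      · exact (Polynomial.natDegree_C_mul_le _ _).trans Polynomial.natDegree_X_le
    simpa using this
  · rw [← Polynomial.coe_evalRingHom, MvPolynomial.aeval_def, MvPolynomial.hom_eval₂,
      MvPolynomial.eval, MvPolynomial.coe_eval₂Hom]
    congr 1
    · ext; simp
    · funext i
      simp [l, AffineMap.lineMap_apply_module]
      ring

theorem continuous_eval {n : ℕ} (q : MvPolynomial (Fin n) ℝ) :
    Continuous fun x : Pt n => MvPolynomial.eval (fun i => x i) q :=
  (MvPolynomial.continuous_eval q).comp (by fun_prop)

/-- The Warburton–Hesthaven trace inequality on a simplex. -/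
theorem trace_inequality {m k : ℕ} (S : Affine.Simplex ℝ (Pt (m + 1)) (m + 1))
    (F : Affine.Simplex ℝ (Pt (m + 1)) m) (hFS : Set.range F.points ⊆ Set.range S.points)
    (q : MvPolynomial (Fin (m + 1)) ℝ) (hq : q.totalDegree ≤ k) :
    (((m + 1 : ℕ) : ℝ) * volume.real (openCell S)) *
        ∫ x in openCell F, MvPolynomial.eval (fun i => x i) q ^ 2 ∂μHE[m] ≤
      ((k : ℝ) + 1) * (k + ((m + 1 : ℕ) : ℝ)) *
        (μHE[m] : Measure (Pt (m + 1))).real (openCell F) *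
        ∫ x in openCell S, MvPolynomial.eval (fun i => x i) q ^ 2 := by
  obtain ⟨a, ha, hS⟩ := exists_openCell_eq_cone S F hFS
  obtain ⟨ι, G, rfl⟩ := exists_isometric_model F
  have hF : openCell (G.map ι.toAffineMap ι.injective) = ι '' openCell G :=
    Affine.Simplex.setInterior_map _ _ _
  have haι : a ∉ Set.range ι := by
    rintro ⟨z, rfl⟩
    apply ha
    have h1 : Set.range (G.map ι.toAffineMap ι.injective).points =
      ι.toAffineMap '' Set.range G.points := by
        rw [← Set.range_comp]; rfl
    rw [h1, ← AffineSubspace.map_span, G.span_eq_top (by simp)]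
    exact ⟨z, trivial, rfl⟩
  have hWm := (isOpen_openCell G).measurableSet
  have hWb := isBounded_openCell G
  obtain ⟨c, hc, hint⟩ := exists_setIntegral_cone ι haι hWm hWb
  rw [hF] at hS
  -- The cone formula with integrand 1: ∫₀¹ s^m ds = 1/(m+1), which is where the factor d in
  -- d|S|/|F| comes from.
  have hvol : volume.real (openCell S) = c * (volume.real (openCell G) / ((m + 1 : ℕ) : ℝ)) := by
    have h1 := hint (fun _ => 1) continuous_const
    rw [← hS] at h1
    simp only [mul_one, integral_pow, one_pow, integral_const, smul_eq_mul, MeasurableSet.univ,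
      measureReal_restrict_apply, Set.univ_inter, ne_eq, Nat.add_eq_zero_iff, one_ne_zero,
      and_false, not_false_eq_true, zero_pow, sub_zero] at h1
    rw [h1]
    push_cast
    ring
  have hq2 : Continuous fun x : Pt (m + 1) => MvPolynomial.eval (fun i => x i) q ^ 2 :=
    (continuous_eval q).pow 2
  rw [hS, hint _ hq2, hF, setIntegral_hausdorff_image, ← hS, hvol,
    measureReal_def (s := ι '' openCell G), hausdorff_image, ← measureReal_def]
  -- Along the ray from the apex through a point of the facet, q is a univariate polynomial of
  -- degree at most k whose value at 1 is the trace. The endpoint inequality is applied ray by ray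
  -- and then integrated over the facet.
  have hmain : ∫ z in openCell G, MvPolynomial.eval (fun i => ι z i) q ^ 2 ≤
      ∫ z in openCell G, ((k : ℝ) + 1) * (k + ((m + 1 : ℕ) : ℝ)) * ∫ s in (0 : ℝ)..1,
        s ^ m * MvPolynomial.eval (fun i => AffineMap.lineMap a (ι z) s i) q ^ 2 := by
    refine integral_mono_of_nonneg (ae_of_all _ fun z => sq_nonneg _) ?_ (ae_of_all _ fun z => ?_)
    · refine integrableOn_of_continuous hWm hWb hWb.measure_lt_top ?_
      refine continuous_const.mul
        (intervalIntegral.continuous_parametric_intervalIntegral_of_continuous' ?_ _ _)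
      have h1 : Continuous fun p : Pt m × ℝ => (AffineMap.lineMap a (ι p.1) p.2 : Pt (m + 1)) := by
        have := ι.continuous
        simp only [AffineMap.lineMap_apply_module]
        fun_prop
      exact (continuous_snd.pow m).mul (hq2.comp h1)
    · obtain ⟨p, hp, hpe⟩ := exists_polynomial_lineMap q hq a (ι z)
      have h1 := sq_eval_one_le k m p hp
      simp_rw [hpe] at h1
      simp only [AffineMap.lineMap_apply_one] at h1
      push_cast
      rw [← add_assoc]
      exact h1
  rw [integral_const_mul] at hmain
  have hm : (0 : ℝ) < ((m + 1 : ℕ) : ℝ) := by positivity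
  have h1 : ((m + 1 : ℕ) : ℝ) * (c * (volume.real (openCell G) / ((m + 1 : ℕ) : ℝ))) =
      c * volume.real (openCell G) := by field_simp
  rw [h1]
  have h2 := mul_le_mul_of_nonneg_left hmain
    (mul_nonneg hc.le (measureReal_nonneg (μ := volume) (s := openCell G)))
  refine h2.trans_eq ?_
  ring

/-! ### Positive definite tensors -/

section Tensor

variable {m : ℕ} {A : Matrix (Fin m) (Fin m) ℝ}

theorem inner_tensor_comm (hA : A.PosDef) (x y : Pt m) :
    inner ℝ (Matrix.toEuclideanCLM (𝕜 := ℝ) A x) y =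
      inner ℝ (Matrix.toEuclideanCLM (𝕜 := ℝ) A y) x := by
  have hT : A.transpose = A := by
    have := hA.isHermitian.eq
    rwa [Matrix.conjTranspose_eq_transpose_of_trivial] at this
  rw [real_inner_comm, Matrix.inner_toEuclideanCLM, real_inner_comm, Matrix.inner_toEuclideanCLM,
    Matrix.dotProduct_mulVec, ← Matrix.mulVec_transpose, hT, dotProduct_comm]

theorem inner_tensor_pos (hA : A.PosDef) {x : Pt m} (hx : x ≠ 0) :
    0 < inner ℝ (Matrix.toEuclideanCLM (𝕜 := ℝ) A x) x := by
  rw [real_inner_comm, Matrix.inner_toEuclideanCLM]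
  have h := hA.dotProduct_mulVec_pos (x := x.ofLp) (by simpa using hx)
  simpa using h

theorem inner_tensor_nonneg (hA : A.PosDef) (x : Pt m) :
    0 ≤ inner ℝ (Matrix.toEuclideanCLM (𝕜 := ℝ) A x) x := by
  rcases eq_or_ne x 0 with rfl | hx
  · simp
  · exact (inner_tensor_pos hA hx).le

theorem norm_tensor_pos (hA : A.PosDef) (hm : 0 < m) :
    0 < ‖Matrix.toEuclideanCLM (𝕜 := ℝ) A‖ := by
  rw [norm_pos_iff]
  intro h
  have h1 := inner_tensor_pos hA (x := EuclideanSpace.single ⟨0, hm⟩ 1) (by simp)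
  rw [h] at h1
  simp at h1

/-- The estimate |Ax|² = |√A √A x|² ≤ |√A|² |√A x|², obtained without square roots: the quadratic
form of A is nonnegative at Ax - ‖A‖x, and ⟨A(Ax), Ax⟩ ≤ ‖A‖ |Ax|². -/
theorem norm_sq_tensor_le (hA : A.PosDef) (x : Pt m) :
    ‖Matrix.toEuclideanCLM (𝕜 := ℝ) A x‖ ^ 2 ≤
      ‖Matrix.toEuclideanCLM (𝕜 := ℝ) A‖ * inner ℝ (Matrix.toEuclideanCLM (𝕜 := ℝ) A x) x := by
  set K := Matrix.toEuclideanCLM (𝕜 := ℝ) A with hK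
  rcases eq_or_ne (K x) 0 with h0 | h0
  · rw [h0]; simp
  have hn : 0 < ‖K‖ := by
    rw [norm_pos_iff]
    rintro h
    exact h0 (by rw [h]; rfl)
  -- the form is nonnegative at `K x - ‖K‖ x`
  have h1 := inner_tensor_nonneg hA (K x - ‖K‖ • x)
  rw [← hK, map_sub, map_smul, inner_sub_left, inner_sub_right, inner_sub_right, inner_smul_left,
    inner_smul_right, inner_smul_left, inner_smul_right] at h1
  have h2 : inner ℝ (K (K x)) x = ‖K x‖ ^ 2 := by
    rw [inner_tensor_comm hA, real_inner_self_eq_norm_sq]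
  have h3 : inner ℝ (K x) (K x) = ‖K x‖ ^ 2 := real_inner_self_eq_norm_sq _
  have h4 : inner ℝ (K (K x)) (K x) ≤ ‖K‖ * ‖K x‖ ^ 2 := by
    refine (real_inner_le_norm _ _).trans ?_
    rw [sq, ← mul_assoc]
    exact mul_le_mul_of_nonneg_right (K.le_opNorm _) (norm_nonneg _)
  simp only [conj_trivial] at h1
  rw [h2, h3] at h1
  have h5 : ‖K‖ * ‖K x‖ ^ 2 ≤ ‖K‖ * (‖K‖ * inner ℝ (K x) x) := by nlinarith
  exact le_of_mul_le_mul_left h5 hn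

end Tensor

/-! ### Bilinear forms as functions of two variables -/

/-- A real function of two vectors that is linear in each of them. -/
structure IsBilin {V : Type*} [AddCommGroup V] [Module ℝ V] (f : V → V → ℝ) : Prop where
  add_left : ∀ u u' v, f (u + u') v = f u v + f u' v
  smul_left : ∀ (c : ℝ) u v, f (c • u) v = c * f u v
  add_right : ∀ u v v', f u (v + v') = f u v + f u v'
  smul_right : ∀ (c : ℝ) u v, f u (c • v) = c * f u v

namespace IsBilin

variable {V W : Type*} [AddCommGroup V] [Module ℝ V] [AddCommGroup W] [Module ℝ W]
  {f g : V → V → ℝ}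

/-- The bundled bilinear map. -/
def toLin (hf : IsBilin f) : V →ₗ[ℝ] V →ₗ[ℝ] ℝ :=
  LinearMap.mk₂ ℝ f hf.add_left hf.smul_left hf.add_right hf.smul_right

@[simp] theorem toLin_apply (hf : IsBilin f) (u v : V) : hf.toLin u v = f u v := rfl

theorem add (hf : IsBilin f) (hg : IsBilin g) : IsBilin fun u v => f u v + g u v where
  add_left u u' v := by rw [hf.add_left, hg.add_left]; ring
  smul_left c u v := by rw [hf.smul_left, hg.smul_left]; ring
  add_right u v v' := by rw [hf.add_right, hg.add_right]; ring
  smul_right c u v := by rw [hf.smul_right, hg.smul_right]; ring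

theorem const_mul (a : ℝ) (hf : IsBilin f) : IsBilin fun u v => a * f u v where
  add_left u u' v := by rw [hf.add_left]; ring
  smul_left c u v := by rw [hf.smul_left]; ring
  add_right u v v' := by rw [hf.add_right]; ring
  smul_right c u v := by rw [hf.smul_right]; ring

theorem sub (hf : IsBilin f) (hg : IsBilin g) : IsBilin fun u v => f u v - g u v where
  add_left u u' v := by rw [hf.add_left, hg.add_left]; ring
  smul_left c u v := by rw [hf.smul_left, hg.smul_left]; ring
  add_right u v v' := by rw [hf.add_right, hg.add_right]; ring
  smul_right c u v := by rw [hf.smul_right, hg.smul_right]; ring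

theorem flip (hf : IsBilin f) : IsBilin fun u v => f v u where
  add_left _ _ _ := hf.add_right _ _ _
  smul_left _ _ _ := hf.smul_right _ _ _
  add_right _ _ _ := hf.add_left _ _ _
  smul_right _ _ _ := hf.smul_left _ _ _

theorem sum {ι : Type*} (s : Finset ι) {f : ι → V → V → ℝ} (hf : ∀ i, IsBilin (f i)) :
    IsBilin fun u v => ∑ i ∈ s, f i u v where
  add_left u u' v := by
    rw [← Finset.sum_add_distrib]; exact Finset.sum_congr rfl fun i _ => (hf i).add_left _ _ _
  smul_left c u v := by
    rw [Finset.mul_sum]; exact Finset.sum_congr rfl fun i _ => (hf i).smul_left _ _ _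
  add_right u u' v := by
    rw [← Finset.sum_add_distrib]; exact Finset.sum_congr rfl fun i _ => (hf i).add_right _ _ _
  smul_right c u v := by
    rw [Finset.mul_sum]; exact Finset.sum_congr rfl fun i _ => (hf i).smul_right _ _ _

theorem comp (hf : IsBilin f) {L L' : W → V} (hL : IsLinearMap ℝ L) (hL' : IsLinearMap ℝ L') :
    IsBilin fun u v => f (L u) (L' v) where
  add_left u u' v := by rw [hL.map_add, hf.add_left]
  smul_left c u v := by rw [hL.map_smul, hf.smul_left]
  add_right u u' v := by rw [hL'.map_add, hf.add_right]
  smul_right c u v := by rw [hL'.map_smul, hf.smul_right]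

theorem inner {H : Type*} [NormedAddCommGroup H] [InnerProductSpace ℝ H] {L L' : W → H}
    (hL : IsLinearMap ℝ L) (hL' : IsLinearMap ℝ L') :
    IsBilin fun u v => inner ℝ (L u) (L' v) where
  add_left u u' v := by rw [hL.map_add, inner_add_left]
  smul_left c u v := by rw [hL.map_smul, real_inner_smul_left]
  add_right u u' v := by rw [hL'.map_add, inner_add_right]
  smul_right c u v := by rw [hL'.map_smul, real_inner_smul_right]

theorem mul {L L' : W → ℝ} (hL : IsLinearMap ℝ L) (hL' : IsLinearMap ℝ L') :
    IsBilin fun u v => L u * L' v where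
  add_left u u' v := by rw [hL.map_add]; ring
  smul_left c u v := by rw [hL.map_smul, smul_eq_mul]; ring
  add_right u u' v := by rw [hL'.map_add]; ring
  smul_right c u v := by rw [hL'.map_smul, smul_eq_mul]; ring

theorem integral {X : Type*} [MeasurableSpace X] {μ : Measure X} {f : V → V → X → ℝ}
    (hf : ∀ x, IsBilin fun u v => f u v x) (hi : ∀ u v, Integrable (f u v) μ) :
    IsBilin fun u v => ∫ x, f u v x ∂μ where
  add_left u u' v := by
    rw [← integral_add (hi _ _) (hi _ _)]
    exact integral_congr_ae (ae_of_all _ fun x => (hf x).add_left _ _ _)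
  smul_left c u v := by
    rw [← integral_const_mul]
    exact integral_congr_ae (ae_of_all _ fun x => (hf x).smul_left _ _ _)
  add_right u v v' := by
    rw [← integral_add (hi _ _) (hi _ _)]
    exact integral_congr_ae (ae_of_all _ fun x => (hf x).add_right _ _ _)
  smul_right c u v := by
    rw [← integral_const_mul]
    exact integral_congr_ae (ae_of_all _ fun x => (hf x).smul_right _ _ _)

/-- Cauchy–Schwarz for a symmetric positive semidefinite form. -/
theorem abs_le_sqrt_mul_sqrt (hf : IsBilin f) (hs : ∀ u v, f u v = f v u)
    (hp : ∀ u, 0 ≤ f u u) (u v : V) : |f u v| ≤ √(f u u) * √(f v v) := by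
  have h := LinearMap.BilinForm.apply_mul_apply_le_of_forall_zero_le hf.toLin hp u v
  simp only [toLin_apply] at h
  rw [hs v u, ← sq] at h
  rw [← Real.sqrt_mul (hp u)]
  exact Real.abs_le_sqrt h

end IsBilin

/-! ### Broken polynomials -/

theorem totalDegree_pderiv_le {n : ℕ} (b : Fin n) (q : MvPolynomial (Fin n) ℝ) :
    (MvPolynomial.pderiv b q).totalDegree ≤ q.totalDegree := by
  refine Finset.sup_le fun s hs => ?_
  have h1 : s + Finsupp.single b 1 ∈ q.support := by
    rw [MvPolynomial.mem_support_iff] at hs ⊢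
    intro h
    rw [MvPolynomial.coeff_pderiv, h, zero_mul] at hs
    exact hs rfl
  refine le_trans ?_ (MvPolynomial.le_totalDegree h1)
  rw [Finsupp.sum_add_index' (fun _ => rfl) (fun _ _ _ => rfl)]
  exact Nat.le_add_right _ _

namespace PolyMesh

variable {m : ℕ} {Ω : Set (Pt (m + 1))} {T : PolyMesh m Ω} {k : Fin T.numElem → ℕ}

theorem isLinearMap_val (i : Fin T.numElem) (x : Pt (m + 1)) :
    IsLinearMap ℝ fun q : T.BrokenPoly k => val q i x where
  map_add p q := by simp [val]
  map_smul c q := by simp [val, MvPolynomial.smul_eval]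

theorem isLinearMap_grad (i : Fin T.numElem) (x : Pt (m + 1)) :
    IsLinearMap ℝ fun q : T.BrokenPoly k => grad q i x where
  map_add p q := by ext b; simp [grad]
  map_smul c q := by ext b; simp [grad, MvPolynomial.smul_eval]

theorem isLinearMap_flux (κ : T.Tensor) (i : Fin T.numElem) (x : Pt (m + 1)) :
    IsLinearMap ℝ fun q : T.BrokenPoly k => flux κ q i x where
  map_add p q := by simp only [flux, (isLinearMap_grad i x).map_add, map_add]
  map_smul c q := by simp only [flux, (isLinearMap_grad i x).map_smul, map_smul]

theorem isLinearMap_avg {V W : Type} [AddCommGroup V] [Module ℝ V] [AddCommGroup W] [Module ℝ W]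
    {w : V → Fin T.numElem → Pt (m + 1) → W}
    (hw : ∀ i x, IsLinearMap ℝ fun u => w u i x) (F : Fin T.numFace) (x : Pt (m + 1)) :
    IsLinearMap ℝ fun u => T.avg (w u) F x where
  map_add p q := by
    rcases h : T.minus F with _ | j <;> simp only [avg, h, (hw _ _).map_add]
    module
  map_smul c q := by
    rcases h : T.minus F with _ | j <;> simp only [avg, h, (hw _ _).map_smul]
    module

theorem isLinearMap_jump {V : Type} [AddCommGroup V] [Module ℝ V]
    {w : V → Fin T.numElem → Pt (m + 1) → ℝ}
    (hw : ∀ i x, IsLinearMap ℝ fun u => w u i x) (F : Fin T.numFace) (x : Pt (m + 1)) :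
    IsLinearMap ℝ fun u => T.jump (w u) F x where
  map_add p q := by
    rcases h : T.minus F with _ | j <;> simp only [jump, h, (hw _ _).map_add] <;> module
  map_smul c q := by
    rcases h : T.minus F with _ | j <;> simp only [jump, h, (hw _ _).map_smul, smul_eq_mul] <;>
      module

@[fun_prop]
theorem continuous_val (q : T.BrokenPoly k) (i : Fin T.numElem) : Continuous (val q i) :=
  continuous_eval _

@[fun_prop]
theorem continuous_grad (q : T.BrokenPoly k) (i : Fin T.numElem) : Continuous (grad q i) :=
  (PiLp.continuous_toLp 2 _).comp (continuous_pi fun _ => continuous_eval _)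

@[fun_prop]
theorem continuous_flux (κ : T.Tensor) (q : T.BrokenPoly k) (i : Fin T.numElem) :
    Continuous (flux κ q i) :=
  (Matrix.toEuclideanCLM (𝕜 := ℝ) (κ i)).continuous.comp (continuous_grad q i)

theorem continuous_avg {W : Type} [NormedAddCommGroup W] [NormedSpace ℝ W]
    {w : Fin T.numElem → Pt (m + 1) → W} (hw : ∀ i, Continuous (w i)) (F : Fin T.numFace) :
    Continuous (T.avg w F) := by
  have h1 := hw (T.plus F)
  unfold avg
  rcases h : T.minus F with _ | j
  · simp only
    fun_prop
  · have h2 := hw j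
    simp only
    fun_prop

theorem continuous_jump {w : Fin T.numElem → Pt (m + 1) → ℝ} (hw : ∀ i, Continuous (w i))
    (F : Fin T.numFace) : Continuous (T.jump w F) := by
  have h1 := hw (T.plus F)
  unfold jump
  rcases h : T.minus F with _ | j
  · simp only
    fun_prop
  · have h2 := hw j
    simp only
    fun_prop

theorem isBounded_elem (hΩ : Bornology.IsBounded Ω) (i : Fin T.numElem) :
    Bornology.IsBounded (T.elem i) := hΩ.subset (T.elem_subset i)

theorem integrableOn_elem (hΩ : Bornology.IsBounded Ω) (i : Fin T.numElem) {g : Pt (m + 1) → ℝ}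
    (hg : Continuous g) : IntegrableOn g (T.elem i) :=
  integrableOn_of_continuous (T.elem_open i).measurableSet (isBounded_elem hΩ i)
    (isBounded_elem hΩ i).measure_lt_top hg

theorem diam_elem_pos (hΩ : Bornology.IsBounded Ω) (i : Fin T.numElem) :
    0 < Metric.diam (T.elem i) := by
  refine Metric.diam_pos ?_ (isBounded_elem hΩ i)
  obtain ⟨x, hx⟩ := (T.elem_connected i).nonempty
  exact (infinite_of_mem_nhds x ((T.elem_open i).mem_nhds hx)).nontrivial

theorem elemPenalty_pos (hΩ : Bornology.IsBounded Ω) {κ : T.Tensor} (hκ : ∀ i, (κ i).PosDef)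
    (i : Fin T.numElem) : 0 < T.elemPenalty κ k i := by
  have h1 := norm_tensor_pos (hκ i) m.succ_pos
  have h2 := diam_elem_pos hΩ i
  unfold elemPenalty
  positivity

theorem penalty_pos (hΩ : Bornology.IsBounded Ω) {κ : T.Tensor} (hκ : ∀ i, (κ i).PosDef)
    {σ₀ : ℝ} (hσ : 0 < σ₀) (F : Fin T.numFace) : 0 < T.penalty κ k σ₀ F := by
  refine mul_pos hσ ?_
  rcases T.minus F with _ | j
  · exact elemPenalty_pos hΩ hκ _
  · exact lt_max_of_lt_left (elemPenalty_pos hΩ hκ _)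

theorem elemPenalty_le_penalty {κ : T.Tensor} {σ₀ : ℝ} (hσ : 0 ≤ σ₀) {i : Fin T.numElem}
    {F : Fin T.numFace} (hiF : T.Adj i F) :
    σ₀ * T.elemPenalty κ k i ≤ T.penalty κ k σ₀ F := by
  refine mul_le_mul_of_nonneg_left ?_ hσ
  rcases hiF with rfl | h
  · rcases T.minus F with _ | j
    · exact le_rfl
    · exact le_max_left _ _
  · rw [h]
    exact le_max_right _ _

/-! ### The trace inequality for fluxes -/

/-- The tensor is constant on the element, so each component of the flux is itself a polynomial and
the scalar trace inequality applies to it. -/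
theorem exists_flux_poly (κ : T.Tensor) (q : T.BrokenPoly k) (i : Fin T.numElem)
    (b : Fin (m + 1)) : ∃ p : MvPolynomial (Fin (m + 1)) ℝ, p.totalDegree ≤ k i ∧
      ∀ x, flux κ q i x b = MvPolynomial.eval (fun a => x a) p := by
  refine ⟨∑ a, κ i b a • MvPolynomial.pderiv a (q i : MvPolynomial (Fin (m + 1)) ℝ), ?_, ?_⟩
  · refine MvPolynomial.totalDegree_finsetSum_le fun a _ => ?_
    refine (MvPolynomial.totalDegree_smul_le _ _).trans ((totalDegree_pderiv_le _ _).trans ?_)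
    exact (MvPolynomial.mem_restrictTotalDegree _ _ _).mp (q i).2
  · intro x
    simp [flux, grad, Matrix.mulVec, dotProduct, MvPolynomial.smul_eval]

/-- Componentwise trace inequality, then `norm_sq_tensor_le` to pass from |κ∇q|² to the energy
density, then regularity to replace |F|/(d|S|) by C/h. The resulting factors combine to C times the
element penalty. -/
theorem integral_flux_sq_le (hΩ : Bornology.IsBounded Ω) {κ : T.Tensor}
    (hκ : ∀ i, (κ i).PosDef) {C : ℝ} (q : T.BrokenPoly k) (i : Fin T.numElem) (F : Fin T.numFace)
    (S : Affine.Simplex ℝ (Pt (m + 1)) (m + 1))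
    (hFS : Set.range (T.face F).points ⊆ Set.range S.points)
    (hd : Metric.diam (T.elem i) ≤ C * (((m + 1 : ℕ) : ℝ) * volume.real (openCell S) /
        (μHE[m] : Measure (Pt (m + 1))).real (openCell (T.face F)))) :
    ∫ x in openCell (T.face F), ‖flux κ q i x‖ ^ 2 ∂μHE[m] ≤
      C * T.elemPenalty κ k i * ∫ x in openCell S, inner ℝ (flux κ q i x) (grad q i x) := by
  have hcell : ∀ {g : Pt (m + 1) → ℝ}, Continuous g → IntegrableOn g (openCell S) := fun hg =>
    integrableOn_of_continuous (measurableSet_openCell S) (isBounded_openCell S)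
      (isBounded_openCell S).measure_lt_top hg
  have hh := diam_elem_pos hΩ i
  set h := Metric.diam (T.elem i)
  set f := (μHE[m] : Measure (Pt (m + 1))).real (openCell (T.face F))
  set s := ((m + 1 : ℕ) : ℝ) * volume.real (openCell S)
  set Y := ∫ x in openCell (T.face F), ‖flux κ q i x‖ ^ 2 ∂μHE[m]
  set X := ∫ x in openCell S, inner ℝ (flux κ q i x) (grad q i x)
  set N := ‖Matrix.toEuclideanCLM (𝕜 := ℝ) (κ i)‖
  set A := ((k i : ℝ) + 1) * (k i + ((m + 1 : ℕ) : ℝ)) with hAdef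
  have hA : 0 ≤ A := by positivity
  have hf : 0 < f := ENNReal.toReal_pos (hausdorff_openCell_pos _).ne'
    (hausdorff_openCell_lt_top _).ne
  have hs : 0 < s := by
    refine mul_pos (by positivity) (ENNReal.toReal_pos ?_ (isBounded_openCell S).measure_lt_top.ne)
    exact ((isOpen_openCell S).measure_pos volume (openCell_nonempty S)).ne'
  -- C must be positive, since otherwise the regularity bound would force a nonpositive diameter.
  have hC : 0 < C := by
    by_contra hC
    have : C * (s / f) ≤ 0 := mul_nonpos_of_nonpos_of_nonneg (not_lt.mp hC) (by positivity)
    linarith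
  choose p hp hpe using exists_flux_poly κ q i
  have hnorm : ∀ x, ‖flux κ q i x‖ ^ 2 = ∑ b, MvPolynomial.eval (fun a => x a) (p b) ^ 2 := by
    intro x
    rw [EuclideanSpace.norm_sq_eq]
    exact Finset.sum_congr rfl fun b _ => by rw [Real.norm_eq_abs, sq_abs, hpe]
  have h1 : s * Y ≤ A * f * ∫ x in openCell S, ‖flux κ q i x‖ ^ 2 := by
    simp only [Y, hnorm]
    have hp2 : ∀ b, Continuous fun x : Pt (m + 1) => MvPolynomial.eval (fun a => x a) (p b) ^ 2 :=
      fun b => (continuous_eval (p b)).pow 2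
    rw [integral_finsetSum _ fun b _ => integrableOn_openCell _ (hp2 b),
      integral_finsetSum _ fun b _ => hcell (hp2 b), Finset.mul_sum, Finset.mul_sum]
    exact Finset.sum_le_sum fun b _ => trace_inequality S (T.face F) hFS (p b) (hp b)
  have h2 : ∫ x in openCell S, ‖flux κ q i x‖ ^ 2 ≤ N * X := by
    rw [← integral_const_mul]
    exact setIntegral_mono (hcell (by fun_prop)) (hcell (by fun_prop))
      fun x => norm_sq_tensor_le (hκ i) _
  have h3 : h * f ≤ C * s := by
    rw [mul_div_assoc', le_div_iff₀ hf] at hd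
    exact hd
  have hY : 0 ≤ Y := integral_nonneg fun x => sq_nonneg _
  have h4 : h * f * Y ≤ C * (A * f * (N * X)) := by
    calc h * f * Y ≤ C * s * Y := mul_le_mul_of_nonneg_right h3 hY
      _ = C * (s * Y) := by ring
      _ ≤ _ := mul_le_mul_of_nonneg_left (h1.trans (mul_le_mul_of_nonneg_left h2 (by positivity)))
        hC.le
  have h5 : h * Y ≤ C * (A * (N * X)) := by
    refine le_of_mul_le_mul_left ?_ hf
    calc f * (h * Y) = h * f * Y := by ring
      _ ≤ _ := h4
      _ = _ := by ring
  have h6 : T.elemPenalty κ k i = N * A / h := by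
    rw [elemPenalty, hAdef, mul_assoc]
  rw [h6]
  have h7 : C * (N * A / h) * X = C * (A * (N * X)) / h := by ring
  rw [h7, le_div_iff₀ hh]
  linarith

/-- On every element the squared fluxes over all its faces are controlled by its energy. -/
theorem exists_flux_bound (hΩ : Bornology.IsBounded Ω) {κ : T.Tensor}
    (hκ : ∀ i, (κ i).PosDef) {C : ℝ} (hT : T.PolytopicRegular C) (q : T.BrokenPoly k) :
    ∃ X : Fin T.numElem → Fin T.numFace → ℝ, (∀ i F, 0 ≤ X i F) ∧
      (∀ i F, T.Adj i F → ∫ x in openCell (T.face F), ‖flux κ q i x‖ ^ 2 ∂μHE[m] ≤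
        C * T.elemPenalty κ k i * X i F) ∧
      (∀ i, ∑ F, X i F ≤ ∫ x in T.elem i, inner ℝ (flux κ q i x) (grad q i x)) := by
  classical
  choose S hS hdisj using hT
  have hnn : ∀ i x, 0 ≤ inner ℝ (flux κ q i x) (grad q i x) := fun i x =>
    inner_tensor_nonneg (hκ i) _
  -- X i F is the energy in the simplex attached to the face F of the element i, and 0 for a face
  -- that does not belong to i, so that sums may run over all faces.
  refine ⟨fun i F => if T.Adj i F then
    ∫ x in openCell (S i F), inner ℝ (flux κ q i x) (grad q i x) else 0, ?_, ?_, ?_⟩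
  · intro i F
    dsimp only
    split_ifs
    · exact integral_nonneg fun x => hnn i x
    · exact le_rfl
  · intro i F h
    simp only [if_pos h]
    exact integral_flux_sq_le hΩ hκ q i F _ (hS i F h).2.1 (hS i F h).2.2.2
  · intro i
    rw [← Finset.sum_filter]
    have hint : IntegrableOn (fun x => inner ℝ (flux κ q i x) (grad q i x)) (T.elem i) :=
      integrableOn_elem hΩ i (by fun_prop)
    -- The simplices of one element are disjoint, so their energies sum to the energy over a subset
    -- of the element, however many faces there are.
    rw [← integral_biUnion_finset _ (fun F _ => measurableSet_openCell _)
      (fun F hF G hG hFG => hdisj i F G (by simpa using hF) (by simpa using hG) hFG)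
      (fun F hF => hint.mono_set (hS i F (by simpa using hF)).1)]
    refine setIntegral_mono_set hint (ae_of_all _ fun x => hnn i x)
      (LE.le.eventuallyLE ?_)
    refine Set.iUnion₂_subset fun F hF => (hS i F (by simpa using hF)).1

end PolyMesh

/-! ### Interior penalty forms on a single mesh -/

/-- Weighted Young inequality for real products. -/
theorem abs_mul_le_young {σ : ℝ} (hσ : 0 < σ) (a b : ℝ) :
    |a * b| ≤ 2 / σ * a ^ 2 + 1 / 8 * (σ * b ^ 2) := by
  -- Completing the square. The weight 1/8 is the share of the jump penalty that one consistency
  -- term may use; the weight 2/σ on the flux then leads to the threshold 16C.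
  have h : 2 / σ * a ^ 2 + 1 / 8 * (σ * b ^ 2) - |a| * |b| =
      2 / σ * (|a| - σ / 4 * |b|) ^ 2 := by
    rw [← sq_abs a, ← sq_abs b]
    field_simp
    ring
  rw [abs_mul]
  have : 0 ≤ 2 / σ * (|a| - σ / 4 * |b|) ^ 2 := by positivity
  linarith

namespace PolyMesh

variable {m : ℕ} {Ω : Set (Pt (m + 1))} (T : PolyMesh m Ω)

/-- The diffusive part of the interior penalty form. -/
def gradForm (κ : T.Tensor) (k : Fin T.numElem → ℕ) (p q : T.BrokenPoly k) : ℝ :=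
  ∑ i, ∫ x in T.elem i, inner ℝ (flux κ p i x) (grad q i x)

open Classical in
/-- The consistency part of the interior penalty form. -/
def crossForm (κ : T.Tensor) (k : Fin T.numElem → ℕ) (S : Set (Fin T.numFace))
    (p q : T.BrokenPoly k) : ℝ :=
  ∑ F with F ∈ S, ∫ x in openCell (T.face F),
    inner ℝ (T.avg (flux κ p) F x) (T.jump (val q) F x) ∂μHE[m]

open Classical in
/-- The stabilization part of the interior penalty form. -/
def jumpForm (κ : T.Tensor) (k : Fin T.numElem → ℕ) (σ₀ : ℝ) (S : Set (Fin T.numFace))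
    (p q : T.BrokenPoly k) : ℝ :=
  ∑ F with F ∈ S, ∫ x in openCell (T.face F),
    T.penalty κ k σ₀ F * inner ℝ (T.jump (val p) F x) (T.jump (val q) F x) ∂μHE[m]

variable {T} {κ : T.Tensor} {k : Fin T.numElem → ℕ} {σ₀ : ℝ} {S : Set (Fin T.numFace)}

theorem sip_eq (p q : T.BrokenPoly k) : T.sip κ k σ₀ S p q =
    T.gradForm κ k p q - T.crossForm κ k S p q - T.crossForm κ k S q p +
      T.jumpForm κ k σ₀ S p q := rfl

theorem dgSq_eq (q : T.BrokenPoly k) :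
    T.dgSq κ k σ₀ S q = T.gradForm κ k q q + T.jumpForm κ k σ₀ S q q := by
  simp only [dgSq, gradForm, jumpForm, real_inner_self_eq_norm_sq]

theorem isBilin_gradForm (hΩ : Bornology.IsBounded Ω) : IsBilin (T.gradForm κ k) :=
  IsBilin.sum _ fun i => IsBilin.integral
    (fun x => IsBilin.inner (isLinearMap_flux κ i x) (isLinearMap_grad i x))
    fun _ _ => integrableOn_elem hΩ i (by fun_prop)

theorem continuous_avg_flux (q : T.BrokenPoly k) (F : Fin T.numFace) :
    Continuous (T.avg (flux κ q) F) := continuous_avg (continuous_flux κ q) F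

theorem continuous_jump_val (q : T.BrokenPoly k) (F : Fin T.numFace) :
    Continuous (T.jump (val q) F) := continuous_jump (continuous_val q) F

theorem isBilin_crossForm : IsBilin (T.crossForm κ k S) :=
  IsBilin.sum _ fun F => IsBilin.integral
    (fun x => IsBilin.inner (isLinearMap_avg (isLinearMap_flux κ) F x)
      (isLinearMap_jump isLinearMap_val F x))
    fun p q => integrableOn_openCell _ ((continuous_avg_flux p F).inner (continuous_jump_val q F))

theorem isBilin_jumpForm : IsBilin (T.jumpForm κ k σ₀ S) :=
  IsBilin.sum _ fun F => IsBilin.integral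
    (fun x => IsBilin.const_mul _ (IsBilin.inner (isLinearMap_jump isLinearMap_val F x)
      (isLinearMap_jump isLinearMap_val F x)))
    fun p q => integrableOn_openCell _
      (continuous_const.mul ((continuous_jump_val p F).inner (continuous_jump_val q F)))

theorem gradForm_comm (hκ : ∀ i, (κ i).PosDef) (p q : T.BrokenPoly k) :
    T.gradForm κ k p q = T.gradForm κ k q p := by
  unfold gradForm flux
  exact Finset.sum_congr rfl fun i _ => integral_congr_ae
    (ae_of_all _ fun x => inner_tensor_comm (hκ i) _ _)

theorem jumpForm_comm (p q : T.BrokenPoly k) :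
    T.jumpForm κ k σ₀ S p q = T.jumpForm κ k σ₀ S q p := by
  unfold jumpForm
  simp only [real_inner_comm]

theorem gradForm_self_nonneg (hκ : ∀ i, (κ i).PosDef) (q : T.BrokenPoly k) :
    0 ≤ T.gradForm κ k q q :=
  Finset.sum_nonneg fun i _ => integral_nonneg fun _ => inner_tensor_nonneg (hκ i) _

theorem jumpForm_self_nonneg (hΩ : Bornology.IsBounded Ω) (hκ : ∀ i, (κ i).PosDef)
    (hσ : 0 < σ₀) (q : T.BrokenPoly k) : 0 ≤ T.jumpForm κ k σ₀ S q q :=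
  Finset.sum_nonneg fun F _ => integral_nonneg fun _ =>
    mul_nonneg (penalty_pos hΩ hκ hσ F).le real_inner_self_nonneg

/-- A penalized flux term is controlled by the energy in the adjacent simplices. -/
theorem mul_integral_flux_sq_le (hΩ : Bornology.IsBounded Ω) (hκ : ∀ i, (κ i).PosDef) {C : ℝ}
    (hσ : 0 < σ₀) (hC : 16 * C ≤ σ₀) {i : Fin T.numElem} {σ X Y : ℝ}
    (hX : 0 ≤ X) (hY : Y ≤ C * T.elemPenalty κ k i * X)
    (hσi : σ₀ * T.elemPenalty κ k i ≤ σ) : 2 / σ * Y ≤ 1 / 8 * X := by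
  have hπ : 0 < T.elemPenalty κ k i := elemPenalty_pos hΩ hκ i
  have hσ' : 0 < σ := lt_of_lt_of_le (mul_pos hσ hπ) hσi
  rw [div_mul_eq_mul_div, div_le_iff₀ hσ']
  have h1 : 16 * C * T.elemPenalty κ k i * X ≤ σ * X := by
    refine mul_le_mul_of_nonneg_right (le_trans ?_ hσi) hX
    exact mul_le_mul_of_nonneg_right hC hπ.le
  linarith

/-- The consistency term is dominated by the diffusive and the stabilization terms. -/
theorem abs_crossForm_le (hΩ : Bornology.IsBounded Ω) (hκ : ∀ i, (κ i).PosDef) {C : ℝ}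
    (hT : T.PolytopicRegular C) (hσ : 0 < σ₀) (hC : 16 * C ≤ σ₀) (p q : T.BrokenPoly k) :
    |T.crossForm κ k S p q| ≤ 1 / 8 * (T.gradForm κ k p p + T.jumpForm κ k σ₀ S q q) := by
  classical
  obtain ⟨X, hX0, hX, hXs⟩ := exists_flux_bound hΩ hκ hT p
  have hface : ∀ F, |∫ x in openCell (T.face F),
      inner ℝ (T.avg (flux κ p) F x) (T.jump (val q) F x) ∂μHE[m]| ≤
      1 / 8 * (∑ i, X i F) + 1 / 8 * ∫ x in openCell (T.face F),
        T.penalty κ k σ₀ F * inner ℝ (T.jump (val q) F x) (T.jump (val q) F x) ∂μHE[m] := by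
    intro F
    have hσF : 0 < T.penalty κ k σ₀ F := penalty_pos hΩ hκ hσ F
    have ha := continuous_avg_flux (κ := κ) p F
    have hb := continuous_jump_val q F
    have hi : ∀ {g : Pt (m + 1) → ℝ}, Continuous g → IntegrableOn g (openCell (T.face F)) μHE[m] :=
      fun hg => integrableOn_openCell _ hg
    have h1 : |∫ x in openCell (T.face F),
        inner ℝ (T.avg (flux κ p) F x) (T.jump (val q) F x) ∂μHE[m]| ≤
        ∫ x in openCell (T.face F), (2 / T.penalty κ k σ₀ F * ‖T.avg (flux κ p) F x‖ ^ 2 + 1 / 8 *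
          (T.penalty κ k σ₀ F * inner ℝ (T.jump (val q) F x) (T.jump (val q) F x))) ∂μHE[m] := by
      refine abs_integral_le_integral_abs.trans ?_
      refine setIntegral_mono (hi (ha.inner hb).abs) (hi (by fun_prop)) fun x => ?_
      refine (abs_real_inner_le_norm _ _).trans ?_
      rw [real_inner_self_eq_norm_sq]
      exact (le_abs_self _).trans (abs_mul_le_young hσF _ _)
    rw [integral_add (hi (by fun_prop)) (hi (by fun_prop)), integral_const_mul,
      integral_const_mul] at h1
    refine h1.trans (add_le_add_left ?_ _)
    have hself : ∀ i, ∑ i, X i F ≥ X i F := fun i =>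
      Finset.single_le_sum (fun j _ => hX0 j F) (Finset.mem_univ i)
    have hint : ∀ i, IntegrableOn (fun x => ‖flux κ p i x‖ ^ 2) (openCell (T.face F)) μHE[m] :=
      fun i => hi (by fun_prop)
    have hadj : ∀ i, T.Adj i F → 2 / T.penalty κ k σ₀ F *
        ∫ x in openCell (T.face F), ‖flux κ p i x‖ ^ 2 ∂μHE[m] ≤ 1 / 8 * X i F := fun i h =>
      mul_integral_flux_sq_le hΩ hκ hσ hC (hX0 i F) (hX i F h)
        (elemPenalty_le_penalty hσ.le h)
    rcases hm : T.minus F with _ | j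
    · have h2 : ∀ x, T.avg (flux κ p) F x = flux κ p (T.plus F) x := fun x => by
        simp only [avg, hm]
      simp only [h2]
      refine (hadj _ (Or.inl rfl)).trans ?_
      have := hself (T.plus F)
      linarith
    · have h2 : ∀ x, ‖T.avg (flux κ p) F x‖ ^ 2 ≤
          ‖flux κ p (T.plus F) x‖ ^ 2 + ‖flux κ p j x‖ ^ 2 := fun x => by
        simp only [avg, hm, norm_smul]
        have := norm_add_le (flux κ p (T.plus F) x) (flux κ p j x)
        have h0 := norm_nonneg (flux κ p (T.plus F) x + flux κ p j x)
        rw [Real.norm_of_nonneg (by norm_num)]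
        nlinarith [sq_nonneg (‖flux κ p (T.plus F) x‖ - ‖flux κ p j x‖)]
      have h3 := setIntegral_mono (hi (by fun_prop)) ((hint (T.plus F)).add (hint j)) h2
      simp only [Pi.add_apply] at h3
      rw [integral_add (hint _) (hint _)] at h3
      have h4 := mul_le_mul_of_nonneg_left h3 (by positivity : 0 ≤ 2 / T.penalty κ k σ₀ F)
      rw [mul_add] at h4
      -- The two sides of a face are different elements, so both contributions occur as separate
      -- summands of ∑ i, X i F.
      have hne : j ≠ T.plus F := (T.minus_side F j hm).1
      have h5 : X (T.plus F) F + X j F ≤ ∑ i, X i F := by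
        rw [← Finset.sum_pair hne.symm (f := fun i => X i F)]
        exact Finset.sum_le_univ_sum_of_nonneg fun i => hX0 i F
      have h6 := hadj _ (Or.inl rfl)
      have h7 := hadj j (Or.inr hm)
      linarith
  unfold crossForm
  refine (Finset.abs_sum_le_sum_abs _ _).trans ((Finset.sum_le_sum fun F _ => hface F).trans ?_)
  rw [Finset.sum_add_distrib, ← Finset.mul_sum, ← Finset.mul_sum, mul_add]
  refine add_le_add (mul_le_mul_of_nonneg_left ?_ (by norm_num)) le_rfl
  -- Exchanging the sums regroups the face contributions by element, where `exists_flux_bound`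
  -- bounds them by the element energies.
  calc ∑ F with F ∈ S, ∑ i, X i F ≤ ∑ F, ∑ i, X i F :=
        Finset.sum_le_univ_sum_of_nonneg fun F => Finset.sum_nonneg fun i _ => hX0 i F
    _ = ∑ i, ∑ F, X i F := Finset.sum_comm
    _ ≤ _ := Finset.sum_le_sum fun i _ => hXs i

end PolyMesh

/-! ### Jumps and averages at the intersection -/

/-- The sum of (aᵢ - aⱼ)² over all ordered pairs is 2N Σ aᵢ² - 2(Σ aᵢ)², so the normalization 1/N²
leaves at most (2/N) Σ aᵢ², and N ≥ 2. The bound does not grow with the number of fractures although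
the number of pairs does. -/
theorem sum_interAvg_sq_le {N : ℕ} (hN : 2 ≤ N) (a : Fin N → ℝ) :
    ∑ s, Discretization.interAvg a s ^ 2 ≤ ∑ i, a i ^ 2 := by
  have hN0 : (0 : ℝ) < N := by exact_mod_cast lt_of_lt_of_le two_pos hN
  have hN2 : (2 : ℝ) ≤ N := by exact_mod_cast hN
  have h1 : ∑ s : Discretization.Pairs N, (a s.1.1 - a s.1.2) ^ 2 ≤
      ∑ s : Fin N × Fin N, (a s.1 - a s.2) ^ 2 := by
    refine le_trans (le_of_eq ?_) (Finset.sum_le_univ_sum_of_nonneg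
      (s := Finset.univ.map (Function.Embedding.subtype fun s : Fin N × Fin N => s.1 < s.2))
      fun s => sq_nonneg (a s.1 - a s.2))
    rw [Finset.sum_map]
    rfl
  have h2 : ∑ s : Fin N × Fin N, (a s.1 - a s.2) ^ 2 =
      2 * N * ∑ i, a i ^ 2 - 2 * (∑ i, a i) ^ 2 := by
    rw [Fintype.sum_prod_type]
    have h3 : ∀ i j, (a i - a j) ^ 2 = a i ^ 2 - 2 * (a i * a j) + a j ^ 2 := fun i j => by ring
    simp only [h3, Finset.sum_add_distrib, Finset.sum_sub_distrib, Finset.sum_const,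
      Finset.card_univ, Fintype.card_fin, nsmul_eq_mul, ← Finset.mul_sum]
    rw [sq (∑ i, a i), Finset.sum_mul]
    ring
  have h4 : ∑ s, Discretization.interAvg a s ^ 2 = (1 / (N : ℝ)) ^ 2 *
      ∑ s : Discretization.Pairs N, (a s.1.1 - a s.1.2) ^ 2 := by
    rw [Finset.mul_sum]
    exact Finset.sum_congr rfl fun s _ => by rw [Discretization.interAvg, mul_pow]
  have hs : 0 ≤ ∑ i, a i ^ 2 := Finset.sum_nonneg fun i _ => sq_nonneg _
  have h5 : ∑ s : Discretization.Pairs N, (a s.1.1 - a s.1.2) ^ 2 ≤ 2 * N * ∑ i, a i ^ 2 := by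
    have := sq_nonneg (∑ i, a i)
    linarith
  rw [h4, one_div, inv_pow, inv_mul_le_iff₀ (by positivity)]
  nlinarith [mul_nonneg (mul_nonneg hN0.le (sub_nonneg.mpr hN2)) hs]

/-! ### Coefficients of the medium -/

namespace Medium

variable {n : ℕ} (P : Medium n)

/-- In terms of the data, β = νⁿ/(2ℓ) and α = 2νⁿ/(ℓ(2ξ-1)). Upper bounds serve integrability;
strict positivity serves definiteness. -/
theorem coeff_bounds (k : Fin P.N) : ∃ B : ℝ, ∀ y ∈ P.U k, |P.ℓ k y| ≤ B ∧
    (0 < P.β k y ∧ |P.β k y| ≤ B) ∧ (0 < P.α k y ∧ |P.α k y| ≤ B) := by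
  obtain ⟨a, b, ha, hℓ⟩ := P.ℓ_bounds
  obtain ⟨a', b', ha', hν⟩ := P.νn_bounds
  have hξ : 0 < 2 * P.ξ - 1 := by linarith [P.ξ_gt]
  refine ⟨max b (max (b' / (2 * a)) (2 * b' / (a * (2 * P.ξ - 1)))), fun y hy => ?_⟩
  obtain ⟨h1, h2⟩ := hℓ k y hy
  obtain ⟨h3, h4⟩ := hν k y hy
  have hl : 0 < P.ℓ k y := ha.trans h1
  have hn : 0 < P.νn k y := ha'.trans_le h3
  have hβ : P.β k y = P.νn k y / (2 * P.ℓ k y) := by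
    rw [β, η]; field_simp
  have hα : P.α k y = 2 * P.νn k y / (P.ℓ k y * (2 * P.ξ - 1)) := by
    rw [α, η]; field_simp
  have hβ0 : 0 < P.β k y := by rw [hβ]; positivity
  have hα0 : 0 < P.α k y := by rw [hα]; positivity
  refine ⟨?_, ⟨hβ0, ?_⟩, hα0, ?_⟩
  · rw [abs_of_pos hl]
    exact h2.trans (le_max_left _ _)
  · rw [abs_of_pos hβ0, hβ]
    refine le_trans ?_ ((le_max_left _ _).trans (le_max_right _ _))
    gcongr
    exact hn.le.trans h4
  · rw [abs_of_pos hα0, hα]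
    refine le_trans ?_ ((le_max_right _ _).trans (le_max_right _ _))
    gcongr
    linarith

theorem aestronglyMeasurable_ℓ (k : Fin P.N) :
    AEStronglyMeasurable (P.ℓ k) (volume.restrict (P.U k)) :=
  (P.ℓ_smooth k).continuousOn.aestronglyMeasurable (P.U_open k).measurableSet

theorem aestronglyMeasurable_η (k : Fin P.N) :
    AEStronglyMeasurable (P.η k) (volume.restrict (P.U k)) :=
  ((P.aestronglyMeasurable_ℓ k).aemeasurable.div (P.νn_meas k).aemeasurable).aestronglyMeasurable

theorem aestronglyMeasurable_β (k : Fin P.N) :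
    AEStronglyMeasurable (P.β k) (volume.restrict (P.U k)) :=
  (((P.aestronglyMeasurable_η k).aemeasurable.const_mul 2).const_div 1).aestronglyMeasurable

theorem aestronglyMeasurable_α (k : Fin P.N) :
    AEStronglyMeasurable (P.α k) (volume.restrict (P.U k)) :=
  (((P.aestronglyMeasurable_η k).aemeasurable.mul_const (2 * P.ξ - 1)).const_div
    2).aestronglyMeasurable

end Medium

theorem integrableOn_weight_mul {n : ℕ} {U s : Set (Pt n)} {w g : Pt n → ℝ} {B : ℝ}
    (hw : AEStronglyMeasurable w (volume.restrict U)) (hB : ∀ y ∈ U, |w y| ≤ B)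
    (hU : Bornology.IsBounded U) (hs : s ⊆ U) (hm : MeasurableSet s) (hg : Continuous g) :
    IntegrableOn (fun y => w y * g y) s := by
  have hsb := hU.subset hs
  have hgi : IntegrableOn g s := integrableOn_of_continuous hm hsb hsb.measure_lt_top hg
  refine (hgi.norm.const_mul B).mono'
    ((hw.mono_measure (Measure.restrict_mono hs le_rfl)).mul hg.aestronglyMeasurable)
    ((ae_restrict_iff' hm).mpr (ae_of_all _ fun y hy => ?_))
  rw [norm_mul]
  exact mul_le_mul_of_nonneg_right (hB y (hs hy)) (norm_nonneg _)

namespace Discretization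

open PolyMesh

variable {n : ℕ} {P : Medium n} (D : Discretization P)

theorem bulkTensor_posDef (i : Fin D.bulk.numElem) : (D.bulkTensor i).PosDef := by
  obtain ⟨x, hx⟩ := (D.bulk.elem_connected i).nonempty
  rw [← D.bulkTensor_spec i x hx]
  exact P.ν_posDef x (D.bulk.elem_subset i hx)

theorem fracTensor_posDef (k : Fin P.N) (j : Fin (D.frac k).numElem) :
    (D.fracTensor k j).PosDef := by
  obtain ⟨y, hy⟩ := ((D.frac k).elem_connected j).nonempty
  have hyU := (D.frac k).elem_subset j hy
  obtain ⟨a, b, ha, hℓ⟩ := P.ℓ_bounds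
  rw [← D.fracTensor_spec k j y hy]
  exact (P.νt_posDef k y hyU).smul (ha.trans (hℓ k y hyU).1)

/-! ### Intersection edges -/

theorem interEdge_eq (k : Fin P.N) (c : Fin D.numInter) :
    D.interEdge c = P.inPlane k ⁻¹' openCell ((D.frac k).face (D.edgeOf k c)) := by
  rw [D.edgeOf_spec, Set.preimage_image_eq _ (P.inPlane k).injective]

theorem measurableSet_interEdge (c : Fin D.numInter) : MeasurableSet (D.interEdge c) := by
  rw [D.interEdge_eq ⟨0, two_pos.trans_le P.two_le_N⟩]
  exact (P.inPlane _).continuous.measurable (measurableSet_openCell _)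

theorem isBounded_interEdge (c : Fin D.numInter) : Bornology.IsBounded (D.interEdge c) := by
  rw [D.interEdge_eq ⟨0, two_pos.trans_le P.two_le_N⟩]
  exact (P.inPlane _).isometry.antilipschitz.isBounded_preimage (isBounded_openCell _)

theorem integrableOn_interEdge (c : Fin D.numInter) {g : Pt n → ℝ} (hg : Continuous g) :
    IntegrableOn g (D.interEdge c) :=
  integrableOn_of_continuous (D.measurableSet_interEdge c) (D.isBounded_interEdge c)
    (D.isBounded_interEdge c).measure_lt_top hg

/-- Integrals at the intersection are written once, in coordinates of the line. This transports them
isometrically to the edge of each fracture mesh, where the flux bound of that mesh is available. -/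
theorem setIntegral_interEdge (k : Fin P.N) (c : Fin D.numInter) (g : Pt (n + 1) → ℝ) :
    ∫ z in D.interEdge c, g (P.inPlane k z) =
      ∫ x in openCell ((D.frac k).face (D.edgeOf k c)), g x ∂μHE[n] := by
  rw [D.edgeOf_spec, setIntegral_hausdorff_image]

@[fun_prop]
theorem continuous_interVal (q : D.FracSpace) (c : Fin D.numInter) (k : Fin P.N) :
    Continuous fun z => D.interVal q c z k :=
  (continuous_val _ _).comp (P.inPlane k).continuous

@[fun_prop]
theorem continuous_interFlux (q : D.FracSpace) (c : Fin D.numInter) (k : Fin P.N) :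
    Continuous fun z => D.interFlux q c z k :=
  ((continuous_flux _ _ _).comp (P.inPlane k).continuous).inner continuous_const

theorem isLinearMap_interVal (c : Fin D.numInter) (z : Pt n) (k : Fin P.N) :
    IsLinearMap ℝ fun q : D.FracSpace => D.interVal q c z k where
  map_add p q := (isLinearMap_val _ _).map_add (p k) (q k)
  map_smul a q := (isLinearMap_val _ _).map_smul a (q k)

theorem isLinearMap_interFlux (c : Fin D.numInter) (z : Pt n) (k : Fin P.N) :
    IsLinearMap ℝ fun q : D.FracSpace => D.interFlux q c z k where
  map_add p q := by
    rw [interFlux, Pi.add_apply, (isLinearMap_flux _ _ _).map_add, inner_add_left]; rfl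
  map_smul a q := by
    rw [interFlux, Pi.smul_apply, (isLinearMap_flux _ _ _).map_smul, real_inner_smul_left]; rfl

theorem isLinearMap_interJump (c : Fin D.numInter) (z : Pt n) (s : Pairs P.N) :
    IsLinearMap ℝ fun q : D.FracSpace => interJump (D.interVal q c z) s where
  map_add p q := by
    simp only [interJump, (D.isLinearMap_interVal c z _).map_add]; ring
  map_smul a q := by
    simp only [interJump, (D.isLinearMap_interVal c z _).map_smul, smul_eq_mul]; ring

theorem isLinearMap_interAvg (c : Fin D.numInter) (z : Pt n) (s : Pairs P.N) :
    IsLinearMap ℝ fun q : D.FracSpace => interAvg (D.interFlux q c z) s where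
  map_add p q := by
    simp only [interAvg, (D.isLinearMap_interFlux c z _).map_add]; ring
  map_smul a q := by
    simp only [interAvg, (D.isLinearMap_interFlux c z _).map_smul, smul_eq_mul]; ring

@[fun_prop]
theorem continuous_interJump (q : D.FracSpace) (c : Fin D.numInter) (s : Pairs P.N) :
    Continuous fun z => interJump (D.interVal q c z) s := by
  unfold interJump; fun_prop

@[fun_prop]
theorem continuous_interAvg (q : D.FracSpace) (c : Fin D.numInter) (s : Pairs P.N) :
    Continuous fun z => interAvg (D.interFlux q c z) s := by
  unfold interAvg; fun_prop

/-- The consistency part of the network form at the intersection. -/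
def interCross (p q : D.FracSpace) : ℝ :=
  ∑ c, ∫ z in D.interEdge c, interAvg (D.interFlux p c z) ⬝ᵥ interJump (D.interVal q c z)

/-- The stabilization part of the network form at the intersection. -/
def interStab (σ₀Γ : ℝ) (p q : D.FracSpace) : ℝ :=
  ∑ c, ∫ z in D.interEdge c,
    D.interPenalty σ₀Γ c * (interJump (D.interVal p c z) ⬝ᵥ interJump (D.interVal q c z))

theorem isBilin_interCross : IsBilin D.interCross := by
  unfold interCross dotProduct
  exact IsBilin.sum _ fun c => IsBilin.integral
    (fun z => IsBilin.sum _ fun s =>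
      IsBilin.mul (D.isLinearMap_interAvg c z s) (D.isLinearMap_interJump c z s))
    fun p q => D.integrableOn_interEdge c (by fun_prop)

theorem isBilin_interStab (σ₀Γ : ℝ) : IsBilin (D.interStab σ₀Γ) := by
  unfold interStab dotProduct
  exact IsBilin.sum _ fun c => IsBilin.integral
    (fun z => IsBilin.const_mul _ (IsBilin.sum _ fun s =>
      IsBilin.mul (D.isLinearMap_interJump c z s) (D.isLinearMap_interJump c z s)))
    fun p q => D.integrableOn_interEdge c (by fun_prop)

theorem elemPenalty_le_interPenalty {σ₀Γ : ℝ} (hσ : 0 ≤ σ₀Γ) (c : Fin D.numInter) (k : Fin P.N) :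
    σ₀Γ * (D.frac k).elemPenalty (D.fracTensor k) (D.fracDeg k) ((D.frac k).plus (D.edgeOf k c)) ≤
      D.interPenalty σ₀Γ c :=
  mul_le_mul_of_nonneg_left (le_ciSup (f := fun k : Fin P.N =>
    (D.frac k).elemPenalty (D.fracTensor k) (D.fracDeg k) ((D.frac k).plus (D.edgeOf k c)))
    (Set.finite_range _).bddAbove k) hσ

theorem interPenalty_pos {σ₀Γ : ℝ} (hσ : 0 < σ₀Γ) (c : Fin D.numInter) :
    0 < D.interPenalty σ₀Γ c :=
  lt_of_lt_of_le (mul_pos hσ (elemPenalty_pos (P.U_bounded _) (D.fracTensor_posDef _) _))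
    (D.elemPenalty_le_interPenalty hσ.le c ⟨0, two_pos.trans_le P.two_le_N⟩)

theorem interStab_self_nonneg {σ₀Γ : ℝ} (hσ : 0 < σ₀Γ) (q : D.FracSpace) :
    0 ≤ D.interStab σ₀Γ q q :=
  Finset.sum_nonneg fun c _ => integral_nonneg fun _ =>
    mul_nonneg (D.interPenalty_pos hσ c).le (Finset.sum_nonneg fun _ _ => mul_self_nonneg _)

theorem interStab_comm (σ₀Γ : ℝ) (p q : D.FracSpace) :
    D.interStab σ₀Γ p q = D.interStab σ₀Γ q p := by
  unfold interStab
  simp only [dotProduct_comm]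

/-- The diffusive part of the network form. -/
def fracGrad (p q : D.FracSpace) : ℝ :=
  ∑ k, (D.frac k).gradForm (D.fracTensor k) (D.fracDeg k) (p k) (q k)

/-- The consistency term at the intersection is dominated by the diffusive and the stabilization
terms. -/
theorem abs_interCross_le {C σ₀Γ : ℝ} (hD : D.PolytopicRegular C) (hσ : 0 < σ₀Γ)
    (hC : 16 * C ≤ σ₀Γ) (p q : D.FracSpace) :
    |D.interCross p q| ≤ 1 / 8 * (D.fracGrad p p + D.interStab σ₀Γ q q) := by
  choose X hX0 hX hXs using fun k =>
    exists_flux_bound (P.U_bounded k) (D.fracTensor_posDef k) (hD.2 k) (p k)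
  have hedge : ∀ c, |∫ z in D.interEdge c,
      interAvg (D.interFlux p c z) ⬝ᵥ interJump (D.interVal q c z)| ≤
      1 / 8 * (∑ k, X k ((D.frac k).plus (D.edgeOf k c)) (D.edgeOf k c)) +
      1 / 8 * ∫ z in D.interEdge c, D.interPenalty σ₀Γ c *
        (interJump (D.interVal q c z) ⬝ᵥ interJump (D.interVal q c z)) := by
    intro c
    have hσc := D.interPenalty_pos hσ c
    set σ := D.interPenalty σ₀Γ c with hσdef
    have hi : ∀ {g : Pt n → ℝ}, Continuous g → IntegrableOn g (D.interEdge c) :=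
      fun hg => D.integrableOn_interEdge c hg
    have hflux : ∀ k, Continuous fun z : Pt n => ‖flux (D.fracTensor k) (p k)
        ((D.frac k).plus (D.edgeOf k c)) (P.inPlane k z)‖ ^ 2 := fun k =>
      ((continuous_flux _ _ _).comp (P.inPlane k).continuous).norm.pow 2
    have h1 : |∫ z in D.interEdge c,
        interAvg (D.interFlux p c z) ⬝ᵥ interJump (D.interVal q c z)| ≤
        ∫ z in D.interEdge c, (2 / σ * (∑ k, ‖flux (D.fracTensor k) (p k)
          ((D.frac k).plus (D.edgeOf k c)) (P.inPlane k z)‖ ^ 2) + 1 / 8 * (σ *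
            (interJump (D.interVal q c z) ⬝ᵥ interJump (D.interVal q c z)))) := by
      unfold dotProduct
      refine abs_integral_le_integral_abs.trans ?_
      refine setIntegral_mono (hi (by fun_prop)) (hi (by fun_prop)) fun z => ?_
      refine (Finset.abs_sum_le_sum_abs _ _).trans
        ((Finset.sum_le_sum fun s _ => abs_mul_le_young hσc _ _).trans ?_)
      rw [Finset.sum_add_distrib, ← Finset.mul_sum, ← Finset.mul_sum, ← Finset.mul_sum]
      simp only [← sq]
      refine add_le_add (mul_le_mul_of_nonneg_left ?_ (by positivity)) le_rfl
      -- The pairwise averages are bounded by the outward fluxes, and those by the full flux vectors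
      -- because the conormals are unit vectors.
      refine (sum_interAvg_sq_le P.two_le_N _).trans (Finset.sum_le_sum fun k _ => ?_)
      have h2 := abs_real_inner_le_norm (flux (D.fracTensor k) (p k)
        ((D.frac k).plus (D.edgeOf k c)) (P.inPlane k z)) ((D.frac k).normal (D.edgeOf k c))
      rw [(D.frac k).normal_unit, mul_one] at h2
      exact sq_le_sq' (abs_le.mp h2).1 (abs_le.mp h2).2
    have hj : Continuous fun z => interJump (D.interVal q c z) ⬝ᵥ interJump (D.interVal q c z) := by
      unfold dotProduct; fun_prop
    rw [integral_add (hi (by fun_prop)) (hi (by fun_prop)), integral_const_mul,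
      integral_const_mul, integral_finsetSum _ fun k _ => hi (hflux k), Finset.mul_sum] at h1
    refine h1.trans (add_le_add_left ?_ _)
    rw [Finset.mul_sum]
    refine Finset.sum_le_sum fun k _ => ?_
    rw [D.setIntegral_interEdge k c fun x => ‖flux (D.fracTensor k) (p k)
          ((D.frac k).plus (D.edgeOf k c)) x‖ ^ 2]
    exact mul_integral_flux_sq_le (P.U_bounded k) (D.fracTensor_posDef k) hσ hC (hX0 k _ _)
      (hX k _ _ (Or.inl rfl)) (D.elemPenalty_le_interPenalty hσ.le c k)
  unfold interCross
  refine (Finset.abs_sum_le_sum_abs _ _).trans ((Finset.sum_le_sum fun c _ => hedge c).trans ?_)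
  rw [Finset.sum_add_distrib, ← Finset.mul_sum, ← Finset.mul_sum, mul_add, Finset.sum_comm]
  refine add_le_add (mul_le_mul_of_nonneg_left (Finset.sum_le_sum fun k _ => ?_) (by norm_num))
    le_rfl
  -- By injectivity of `edgeOf k` different intersection edges are different mesh edges, so each
  -- simplex energy of the fracture mesh is used at most once.
  calc ∑ c, X k ((D.frac k).plus (D.edgeOf k c)) (D.edgeOf k c)
      ≤ ∑ F, X k ((D.frac k).plus F) F := by
        refine (Finset.sum_map Finset.univ ⟨D.edgeOf k, D.edgeOf_injective k⟩
          (fun F => X k ((D.frac k).plus F) F)).symm.trans_le ?_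
        exact Finset.sum_le_univ_sum_of_nonneg fun F => hX0 k _ _
    _ ≤ ∑ F, ∑ i, X k i F := Finset.sum_le_sum fun F _ =>
        Finset.single_le_sum (fun i _ => hX0 k i F) (Finset.mem_univ _)
    _ = ∑ i, ∑ F, X k i F := Finset.sum_comm
    _ ≤ _ := Finset.sum_le_sum fun i _ => hXs k i

/-! ### The energy inner product -/

/-- The stabilization part of the network form inside the fractures. -/
def fracStab (σ₀Γ : ℝ) (p q : D.FracSpace) : ℝ :=
  ∑ k, (D.frac k).jumpForm (D.fracTensor k) (D.fracDeg k) σ₀Γ (D.edgesI k ∪ D.edgesD k)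
    (p k) (q k)

/-- The consistency part of the network form inside the fractures. -/
def fracCross (p q : D.FracSpace) : ℝ :=
  ∑ k, (D.frac k).crossForm (D.fracTensor k) (D.fracDeg k) (D.edgesI k ∪ D.edgesD k) (p k) (q k)

/-- The inner product inducing the energy norm. -/
def energyForm (σ₀ σ₀Γ : ℝ) (u v : D.Space) : ℝ :=
  D.bulk.gradForm D.bulkTensor D.bulkDeg u.1 v.1 +
    D.bulk.jumpForm D.bulkTensor D.bulkDeg σ₀ (D.facesI ∪ D.facesD) u.1 v.1 +
    (D.fracGrad u.2 v.2 + D.fracStab σ₀Γ u.2 v.2 + D.interStab σ₀Γ u.2 v.2) + D.couplingForm u v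

/-- All consistency terms. -/
def consistencyForm (u v : D.Space) : ℝ :=
  D.bulk.crossForm D.bulkTensor D.bulkDeg (D.facesI ∪ D.facesD) u.1 v.1 +
    (D.fracCross u.2 v.2 + D.interCross u.2 v.2)

/-- Symmetric interior penalty: the consistency terms occur twice, with the arguments exchanged.
Continuity and coercivity both reduce to the size of `consistencyForm` relative to `energyForm`. -/
theorem form_eq (σ₀ σ₀Γ : ℝ) (u v : D.Space) : D.form σ₀ σ₀Γ u v =
    D.energyForm σ₀ σ₀Γ u v - D.consistencyForm u v - D.consistencyForm v u := by
  simp only [form, bulkForm, fracForm, sip_eq, energyForm, consistencyForm, Finset.sum_add_distrib,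
    Finset.sum_sub_distrib, fracGrad, fracStab, fracCross, interCross, interStab]
  ring

theorem couplingSq_eq (u : D.Space) : D.couplingSq u = D.couplingForm u u := by
  simp only [couplingSq, couplingForm, real_inner_self_eq_norm_sq, ← sq]

theorem energyNorm_eq (σ₀ σ₀Γ : ℝ) (u : D.Space) :
    D.energyNorm σ₀ σ₀Γ u = √(D.energyForm σ₀ σ₀Γ u u) := by
  simp only [energyNorm, fracSq, dgSq_eq, couplingSq_eq, energyForm, fracGrad, fracStab,
    interStab, Finset.sum_add_distrib, dotProduct, ← sq]

theorem couplingForm_comm (u v : D.Space) : D.couplingForm u v = D.couplingForm v u := by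
  unfold couplingForm
  refine congrArg₂ _ ?_ ?_ <;>
    refine Finset.sum_congr rfl fun k _ => Finset.sum_congr rfl fun j _ => ?_
  · simp only [real_inner_comm]
  · exact integral_congr_ae (ae_of_all _ fun y => congrArg (P.α k y * ·) (mul_comm _ _))

theorem energyForm_comm (σ₀ σ₀Γ : ℝ) (u v : D.Space) :
    D.energyForm σ₀ σ₀Γ u v = D.energyForm σ₀ σ₀Γ v u := by
  unfold energyForm fracGrad fracStab
  rw [gradForm_comm D.bulkTensor_posDef, jumpForm_comm, interStab_comm, couplingForm_comm]
  simp only [gradForm_comm (D.fracTensor_posDef _) (u.2 _), jumpForm_comm (u.2 _)]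

/-- The jump part and the average part of the coupling seminorm. -/
theorem integral_coupling_nonneg (u : D.Space) (k : Fin P.N) (j : Fin (D.frac k).numElem) :
    0 ≤ ∫ y in (D.frac k).elem j, P.β k y *
      inner ℝ (D.bulk.jump (val u.1) (D.bulkFace k j) (P.chart k y))
        (D.bulk.jump (val u.1) (D.bulkFace k j) (P.chart k y)) ∧
    0 ≤ ∫ y in (D.frac k).elem j, P.α k y *
      ((D.bulk.avg (val u.1) (D.bulkFace k j) (P.chart k y) - val (u.2 k) j y) *
        (D.bulk.avg (val u.1) (D.bulkFace k j) (P.chart k y) - val (u.2 k) j y)) := by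
  obtain ⟨B, hB⟩ := P.coeff_bounds k
  have hm := ((D.frac k).elem_open j).measurableSet
  constructor
  · exact setIntegral_nonneg hm fun y hy =>
      mul_nonneg (hB y ((D.frac k).elem_subset j hy)).2.1.1.le real_inner_self_nonneg
  · exact setIntegral_nonneg hm fun y hy =>
      mul_nonneg (hB y ((D.frac k).elem_subset j hy)).2.2.1.le (mul_self_nonneg _)

theorem couplingForm_self_nonneg (u : D.Space) : 0 ≤ D.couplingForm u u :=
  add_nonneg
    (Finset.sum_nonneg fun k _ => Finset.sum_nonneg fun j _ => (D.integral_coupling_nonneg u k j).1)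
    (Finset.sum_nonneg fun k _ => Finset.sum_nonneg fun j _ => (D.integral_coupling_nonneg u k j).2)

theorem continuous_coupling_jump (u : D.Space) (k : Fin P.N) (j : Fin (D.frac k).numElem) :
    Continuous fun y => D.bulk.jump (val u.1) (D.bulkFace k j) (P.chart k y) :=
  (continuous_jump_val u.1 _).comp (P.chart k).continuous

theorem continuous_coupling_diff (u : D.Space) (k : Fin P.N) (j : Fin (D.frac k).numElem) :
    Continuous fun y =>
      D.bulk.avg (val u.1) (D.bulkFace k j) (P.chart k y) - val (u.2 k) j y :=
  ((continuous_avg (continuous_val u.1) _).comp (P.chart k).continuous).sub (continuous_val _ _)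

theorem isLinearMap_coupling_diff (k : Fin P.N) (j : Fin (D.frac k).numElem) (y : Pt (n + 1)) :
    IsLinearMap ℝ fun u : D.Space =>
      D.bulk.avg (val u.1) (D.bulkFace k j) (P.chart k y) - val (u.2 k) j y where
  map_add u v := by
    rw [Prod.fst_add, Prod.snd_add, Pi.add_apply,
      (isLinearMap_avg isLinearMap_val _ _).map_add, (isLinearMap_val _ _).map_add]
    ring
  map_smul a u := by
    rw [Prod.smul_fst, Prod.smul_snd, Pi.smul_apply,
      (isLinearMap_avg isLinearMap_val _ _).map_smul, (isLinearMap_val _ _).map_smul, smul_sub]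

theorem isLinearMap_coupling_jump (k : Fin P.N) (j : Fin (D.frac k).numElem) (y : Pt (n + 1)) :
    IsLinearMap ℝ fun u : D.Space => D.bulk.jump (val u.1) (D.bulkFace k j) (P.chart k y) where
  map_add u v := (isLinearMap_jump isLinearMap_val _ _).map_add u.1 v.1
  map_smul a u := (isLinearMap_jump isLinearMap_val _ _).map_smul a u.1

theorem integrableOn_coupling_jump (u v : D.Space) (k : Fin P.N) (j : Fin (D.frac k).numElem) :
    IntegrableOn (fun y => P.β k y *
      inner ℝ (D.bulk.jump (val u.1) (D.bulkFace k j) (P.chart k y))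
        (D.bulk.jump (val v.1) (D.bulkFace k j) (P.chart k y))) ((D.frac k).elem j) := by
  obtain ⟨B, hB⟩ := P.coeff_bounds k
  exact integrableOn_weight_mul (P.aestronglyMeasurable_β k) (fun y hy => (hB y hy).2.1.2)
    (P.U_bounded k) ((D.frac k).elem_subset j) ((D.frac k).elem_open j).measurableSet
    ((D.continuous_coupling_jump u k j).inner (D.continuous_coupling_jump v k j))

theorem integrableOn_coupling_diff (u v : D.Space) (k : Fin P.N) (j : Fin (D.frac k).numElem) :
    IntegrableOn (fun y => P.α k y *
      ((D.bulk.avg (val u.1) (D.bulkFace k j) (P.chart k y) - val (u.2 k) j y) *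
        (D.bulk.avg (val v.1) (D.bulkFace k j) (P.chart k y) - val (v.2 k) j y)))
      ((D.frac k).elem j) := by
  obtain ⟨B, hB⟩ := P.coeff_bounds k
  exact integrableOn_weight_mul (P.aestronglyMeasurable_α k) (fun y hy => (hB y hy).2.2.2)
    (P.U_bounded k) ((D.frac k).elem_subset j) ((D.frac k).elem_open j).measurableSet
    ((D.continuous_coupling_diff u k j).mul (D.continuous_coupling_diff v k j))

theorem isBilin_couplingForm : IsBilin D.couplingForm :=
  IsBilin.add
    (IsBilin.sum _ fun k => IsBilin.sum _ fun j => IsBilin.integral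
      (fun y => IsBilin.const_mul _ (IsBilin.inner (D.isLinearMap_coupling_jump k j y)
        (D.isLinearMap_coupling_jump k j y)))
      fun u v => D.integrableOn_coupling_jump u v k j)
    (IsBilin.sum _ fun k => IsBilin.sum _ fun j => IsBilin.integral
      (fun y => IsBilin.const_mul _ (IsBilin.mul (D.isLinearMap_coupling_diff k j y)
        (D.isLinearMap_coupling_diff k j y)))
      fun u v => D.integrableOn_coupling_diff u v k j)

theorem isLinearMap_fst : IsLinearMap ℝ fun u : D.Space => u.1 := ⟨fun _ _ => rfl, fun _ _ => rfl⟩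

theorem isLinearMap_snd : IsLinearMap ℝ fun u : D.Space => u.2 := ⟨fun _ _ => rfl, fun _ _ => rfl⟩

theorem isLinearMap_frac (k : Fin P.N) : IsLinearMap ℝ fun q : D.FracSpace => q k :=
  ⟨fun _ _ => rfl, fun _ _ => rfl⟩

theorem isBilin_energyForm (σ₀ σ₀Γ : ℝ) : IsBilin (D.energyForm σ₀ σ₀Γ) := by
  have h1 := (isBilin_gradForm (T := D.bulk) (κ := D.bulkTensor) (k := D.bulkDeg) P.Ω_bounded).comp
    D.isLinearMap_fst D.isLinearMap_fst
  have h2 := (isBilin_jumpForm (T := D.bulk) (κ := D.bulkTensor) (k := D.bulkDeg) (σ₀ := σ₀)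
    (S := D.facesI ∪ D.facesD)).comp D.isLinearMap_fst D.isLinearMap_fst
  have h3 : IsBilin D.fracGrad := IsBilin.sum _ fun k =>
    (isBilin_gradForm (P.U_bounded k)).comp (D.isLinearMap_frac k) (D.isLinearMap_frac k)
  have h4 : IsBilin (D.fracStab σ₀Γ) := IsBilin.sum _ fun k =>
    isBilin_jumpForm.comp (D.isLinearMap_frac k) (D.isLinearMap_frac k)
  exact ((h1.add h2).add (((h3.add h4).add (D.isBilin_interStab σ₀Γ)).comp D.isLinearMap_snd
    D.isLinearMap_snd)).add D.isBilin_couplingForm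

theorem isBilin_consistencyForm : IsBilin D.consistencyForm := by
  have h1 := (isBilin_crossForm (T := D.bulk) (κ := D.bulkTensor) (k := D.bulkDeg)
    (S := D.facesI ∪ D.facesD)).comp D.isLinearMap_fst D.isLinearMap_fst
  have h2 : IsBilin D.fracCross := IsBilin.sum _ fun k =>
    isBilin_crossForm.comp (D.isLinearMap_frac k) (D.isLinearMap_frac k)
  exact h1.add ((h2.add D.isBilin_interCross).comp D.isLinearMap_snd D.isLinearMap_snd)

theorem isBilin_form (σ₀ σ₀Γ : ℝ) : IsBilin (D.form σ₀ σ₀Γ) := by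
  have h := ((D.isBilin_energyForm σ₀ σ₀Γ).sub D.isBilin_consistencyForm).sub
    D.isBilin_consistencyForm.flip
  convert h using 3
  exact D.form_eq _ _ _ _

theorem fracGrad_self_nonneg (q : D.FracSpace) : 0 ≤ D.fracGrad q q :=
  Finset.sum_nonneg fun k _ => gradForm_self_nonneg (D.fracTensor_posDef k) _

theorem fracStab_self_nonneg {σ₀Γ : ℝ} (hσ : 0 < σ₀Γ) (q : D.FracSpace) :
    0 ≤ D.fracStab σ₀Γ q q :=
  Finset.sum_nonneg fun k _ => jumpForm_self_nonneg (P.U_bounded k) (D.fracTensor_posDef k) hσ _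

theorem energyForm_self_nonneg {σ₀ σ₀Γ : ℝ} (hσ : 0 < σ₀) (hσΓ : 0 < σ₀Γ) (u : D.Space) :
    0 ≤ D.energyForm σ₀ σ₀Γ u u := by
  have h1 := gradForm_self_nonneg D.bulkTensor_posDef u.1
  have h2 := jumpForm_self_nonneg (S := D.facesI ∪ D.facesD) P.Ω_bounded D.bulkTensor_posDef hσ u.1
  have h3 := D.fracGrad_self_nonneg u.2
  have h4 := D.fracStab_self_nonneg hσΓ u.2
  have h5 := D.interStab_self_nonneg hσΓ u.2
  have h6 := D.couplingForm_self_nonneg u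
  unfold energyForm
  positivity

/-- Fluxes of u are charged to its diffusive energy and jumps of v to its stabilization. The
diffusive energy of the network is charged twice, once for the edges inside the fractures and once
for the intersection edges. -/
theorem abs_consistencyForm_le_parts {C σ₀ σ₀Γ : ℝ} (hD : D.PolytopicRegular C) (hσ : 0 < σ₀)
    (hσΓ : 0 < σ₀Γ) (hC : 16 * C ≤ σ₀) (hCΓ : 16 * C ≤ σ₀Γ) (u v : D.Space) :
    |D.consistencyForm u v| ≤
      1 / 8 * (D.bulk.gradForm D.bulkTensor D.bulkDeg u.1 u.1 +
        D.bulk.jumpForm D.bulkTensor D.bulkDeg σ₀ (D.facesI ∪ D.facesD) v.1 v.1) +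
      (1 / 8 * (D.fracGrad u.2 u.2 + D.fracStab σ₀Γ v.2 v.2) +
        1 / 8 * (D.fracGrad u.2 u.2 + D.interStab σ₀Γ v.2 v.2)) := by
  have h1 := abs_crossForm_le (S := D.facesI ∪ D.facesD) P.Ω_bounded D.bulkTensor_posDef hD.1 hσ hC
    u.1 v.1
  have h2 : |D.fracCross u.2 v.2| ≤ 1 / 8 * (D.fracGrad u.2 u.2 + D.fracStab σ₀Γ v.2 v.2) := by
    unfold fracCross fracGrad fracStab
    rw [← Finset.sum_add_distrib, Finset.mul_sum]
    exact (Finset.abs_sum_le_sum_abs _ _).trans (Finset.sum_le_sum fun k _ =>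
      abs_crossForm_le (P.U_bounded k) (D.fracTensor_posDef k) (hD.2 k) hσΓ hCΓ _ _)
  have h3 := D.abs_interCross_le hD hσΓ hCΓ u.2 v.2
  exact (abs_add_le _ _).trans (add_le_add h1 ((abs_add_le _ _).trans (add_le_add h2 h3)))

theorem abs_consistencyForm_le {C σ₀ σ₀Γ : ℝ} (hD : D.PolytopicRegular C) (hσ : 0 < σ₀)
    (hσΓ : 0 < σ₀Γ) (hC : 16 * C ≤ σ₀) (hCΓ : 16 * C ≤ σ₀Γ) (u v : D.Space) :
    |D.consistencyForm u v| ≤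
      1 / 4 * (D.energyForm σ₀ σ₀Γ u u + D.energyForm σ₀ σ₀Γ v v) := by
  refine (D.abs_consistencyForm_le_parts hD hσ hσΓ hC hCΓ u v).trans ?_
  have e1 := gradForm_self_nonneg (k := D.bulkDeg) D.bulkTensor_posDef
  have e2 := jumpForm_self_nonneg (k := D.bulkDeg) (S := D.facesI ∪ D.facesD) P.Ω_bounded
    D.bulkTensor_posDef hσ
  have e3 := D.fracGrad_self_nonneg
  have e4 := D.fracStab_self_nonneg hσΓ
  have e5 := D.interStab_self_nonneg hσΓ
  have e6 := D.couplingForm_self_nonneg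
  unfold energyForm
  linarith [e1 u.1, e1 v.1, e2 u.1, e2 v.1, e3 u.2, e3 v.2, e4 u.2, e4 v.2, e5 u.2, e5 v.2,
    e6 u, e6 v]

/-- Setting v = u in `abs_consistencyForm_le` would only give 1/2, and since the consistency terms
are subtracted twice, coercivity would be lost. On the diagonal the flux and jump halves charge
different parts of the same energy, and no part is charged more than 1/4. -/
theorem abs_consistencyForm_self_le {C σ₀ σ₀Γ : ℝ} (hD : D.PolytopicRegular C) (hσ : 0 < σ₀)
    (hσΓ : 0 < σ₀Γ) (hC : 16 * C ≤ σ₀) (hCΓ : 16 * C ≤ σ₀Γ) (u : D.Space) :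
    |D.consistencyForm u u| ≤ 1 / 4 * D.energyForm σ₀ σ₀Γ u u := by
  refine (D.abs_consistencyForm_le_parts hD hσ hσΓ hC hCΓ u u).trans ?_
  have e1 := gradForm_self_nonneg D.bulkTensor_posDef u.1
  have e2 := jumpForm_self_nonneg (S := D.facesI ∪ D.facesD) P.Ω_bounded D.bulkTensor_posDef hσ u.1
  have e4 := D.fracStab_self_nonneg hσΓ u.2
  have e5 := D.interStab_self_nonneg hσΓ u.2
  have e6 := D.couplingForm_self_nonneg u
  unfold energyForm
  linarith

end Discretization

/-! ### Polynomials vanishing on open sets -/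

/-- An open set contains a box, that is, a product of infinite sets, and a polynomial vanishing on
such a product is zero. -/
theorem mvPolynomial_eq_zero_of_isOpen {n : ℕ} {U : Set (Pt n)} (hU : IsOpen U)
    (hne : U.Nonempty) {p : MvPolynomial (Fin n) ℝ}
    (hp : ∀ x ∈ U, MvPolynomial.eval (fun a => x a) p = 0) : p = 0 := by
  obtain ⟨x, hx⟩ := hne
  have hc : Continuous fun y : Fin n → ℝ => (WithLp.toLp 2 y : Pt n) := PiLp.continuous_toLp 2 _
  obtain ⟨r, hr, hball⟩ := Metric.isOpen_iff.mp (hU.preimage hc) x.ofLp hx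
  refine MvPolynomial.funext_set (fun i => Metric.ball (x i) r) (fun i => ?_) fun y hy => ?_
  · exact infinite_of_mem_nhds (x i) (Metric.ball_mem_nhds _ hr)
  · rw [map_zero]
    refine hp (WithLp.toLp 2 y) (hball ?_)
    rw [ball_pi _ hr]
    exact hy

/-- For an exponent s with s b > 0, the coefficient of ∂_b p at s - e_b is s b times the coefficient
of p at s; in characteristic zero the latter must vanish. -/
theorem mvPolynomial_eq_C_of_pderiv {n : ℕ} {p : MvPolynomial (Fin n) ℝ}
    (hp : ∀ b, MvPolynomial.pderiv b p = 0) : p = MvPolynomial.C (MvPolynomial.coeff 0 p) := by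
  ext s
  rw [MvPolynomial.coeff_C]
  split_ifs with h
  · rw [h]
  · obtain ⟨b, hb⟩ : ∃ b, s b ≠ 0 := by
      by_contra! h'
      exact h (Finsupp.ext fun b => (h' b).symm)
    have h1 := congrArg (MvPolynomial.coeff (s - Finsupp.single b 1)) (hp b)
    rw [MvPolynomial.coeff_pderiv, MvPolynomial.coeff_zero] at h1
    have h2 : s - Finsupp.single b 1 + Finsupp.single b 1 = s :=
      tsub_add_cancel_of_le (Finsupp.single_le_iff.mpr (Nat.one_le_iff_ne_zero.mpr hb))
    rw [h2] at h1
    exact (mul_eq_zero.mp h1).resolve_right (by positivity)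

/-- A nonnegative continuous function with vanishing integral over an open set vanishes there. -/
theorem eqOn_zero_of_setIntegral_eq_zero {n : ℕ} {U : Set (Pt n)} (hU : IsOpen U)
    {w g : Pt n → ℝ} (hw : ∀ x ∈ U, 0 < w x) (hg : Continuous g) (hg0 : ∀ x, 0 ≤ g x)
    (hi : IntegrableOn (fun x => w x * g x) U) (h : ∫ x in U, w x * g x = 0) :
    ∀ x ∈ U, g x = 0 := by
  have h1 := (setIntegral_eq_zero_iff_of_nonneg_ae ((ae_restrict_iff' hU.measurableSet).mpr
    (ae_of_all _ fun x hx => mul_nonneg (hw x hx).le (hg0 x))) hi).mp h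
  have h2 : g =ᵐ[volume.restrict U] 0 := by
    filter_upwards [h1, ae_restrict_mem hU.measurableSet] with x hx hxU
    exact (mul_eq_zero.mp hx).resolve_left (hw x hxU).ne'
  exact Measure.eqOn_open_of_ae_eq h2 hU hg.continuousOn continuousOn_const

/-! ### The skeleton of a mesh -/

/-- Such a point has a vanishing barycentric coordinate. For the faces of a mesh these flats,
spanned by all vertices but one, have codimension two, and they are the only part of the skeleton
that has to be avoided. -/
theorem closedInterior_subset_affineSpan_diff {n m : ℕ} (F : Affine.Simplex ℝ (Pt n) m) {x : Pt n}
    (hx : x ∈ F.closedInterior) (hx' : x ∉ openCell F) :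
    ∃ i, x ∈ affineSpan ℝ (F.points '' {i}ᶜ) := by
  obtain ⟨w, hw, hw01, rfl⟩ := hx
  have : ∃ i, w i ≤ 0 := by
    by_contra! h
    exact hx' ⟨w, hw, h, rfl⟩
  obtain ⟨i, hi⟩ := this
  have hi0 : w i = 0 := le_antisymm hi (hw01 i).1
  refine ⟨i, affineCombination_mem_affineSpan_image hw (fun j _ hj => ?_) _⟩
  have : j = i := by simpa using hj
  rw [this, hi0]

/-- At most m+1 points span a flat of dimension at most m in ℝ^(m+1). It contains the union of the
lines from x through the codimension-two flat, so a generic segment starting at x misses that flat.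
-/
theorem volume_affineSpan_insert_eq_zero {m : ℕ} (p : Fin (m + 1) → Pt (m + 1)) (i : Fin (m + 1))
    (x : Pt (m + 1)) :
    volume (affineSpan ℝ (insert x (p '' {i}ᶜ)) : Set (Pt (m + 1))) = 0 := by
  classical
  refine Measure.addHaar_affineSubspace _ _ fun h => ?_
  have hsub : insert x (p '' {i}ᶜ) ⊆ Set.range (Function.update p i x) := by
    rintro y (rfl | ⟨j, hj, rfl⟩)
    · exact ⟨i, by simp⟩
    · exact ⟨j, Function.update_of_ne hj _ _⟩
  have h1 : affineSpan ℝ (Set.range (Function.update p i x)) = ⊤ :=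
    top_le_iff.mp (h ▸ affineSpan_mono ℝ hsub)
  have h2 := finrank_vectorSpan_range_le ℝ (Function.update p i x) (n := m) (by simp)
  rw [← direction_affineSpan, h1, AffineSubspace.direction_top, finrank_top,
    finrank_euclideanSpace_fin] at h2
  omega

/-- A connected set cannot leave an open set without crossing its frontier. It places half-balls
inside single elements. -/
theorem IsPreconnected.subset_of_frontier {X : Type*} [TopologicalSpace X] {s u : Set X}
    (hs : IsPreconnected s) (hu : IsOpen u) (hsu : (s ∩ u).Nonempty)
    (hf : Disjoint s (frontier u)) : s ⊆ u := by
  refine hs.subset_left_of_subset_union hu isClosed_closure.isOpen_compl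
    (Set.disjoint_left.mpr fun x hx hx' => hx' (subset_closure hx)) (fun x hx => ?_) hsu
  by_cases hxu : x ∈ u
  · exact Or.inl hxu
  · refine Or.inr fun hxc => Set.disjoint_left.mp hf hx ?_
    rw [hu.frontier_eq]
    exact ⟨hxc, hxu⟩

/-- Passing from an open set to the interior of its closure fills in the open faces between elements
of equal value and keeps different level sets disjoint. -/
theorem interior_closure_disjoint {X : Type*} [TopologicalSpace X] {s t : Set X}
    (hs : IsOpen s) (hst : Disjoint s t) :
    Disjoint (interior (closure s)) (interior (closure t)) :=
  ((hst.closure_right hs).mono_right interior_subset |>.symm.closure_right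
    isOpen_interior |>.mono_right interior_subset).symm

namespace PolyMesh

variable {m : ℕ} {Ω : Set (Pt (m + 1))} {T : PolyMesh m Ω}

theorem exists_mem_closure_elem {x : Pt (m + 1)} (hx : x ∈ closure Ω) :
    ∃ i, x ∈ closure (T.elem i) := by
  rw [← T.closure_elem] at hx
  exact Set.mem_iUnion.mp hx

theorem exists_mem_face_of_mem_frontier {i : Fin T.numElem} {x : Pt (m + 1)}
    (hx : x ∈ frontier (T.elem i)) : ∃ F, x ∈ (T.face F).closedInterior := by
  rw [T.frontier_elem] at hx
  obtain ⟨F, -, hF⟩ := Set.mem_iUnion₂.mp hx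
  exact ⟨F, hF⟩

theorem minus_ne_none (hΩ : IsOpen Ω) {F : Fin T.numFace} {x : Pt (m + 1)}
    (hx : x ∈ openCell (T.face F)) (hxΩ : x ∈ Ω) : T.minus F ≠ none := by
  intro h
  have := T.boundary_face F h hx
  rw [hΩ.frontier_eq] at this
  exact this.2 hxΩ

theorem inner_normal_eq_zero {F : Fin T.numFace} {x z : Pt (m + 1)}
    (hx : x ∈ (T.face F).closedInterior) (hz : z ∈ (T.face F).closedInterior) :
    inner ℝ (T.normal F) (x - z) = 0 := by
  have key : ∀ y ∈ (T.face F).closedInterior,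
      inner ℝ (T.normal F) (y - (T.face F).points 0) = 0 := by
    rintro y ⟨w, hw, -, rfl⟩
    rw [Finset.affineCombination_eq_linear_combination _ _ _ hw]
    have h1 : ∑ i, w i • (T.face F).points i - (T.face F).points 0 =
        ∑ i, w i • ((T.face F).points i - (T.face F).points 0) := by
      simp only [smul_sub, Finset.sum_sub_distrib, ← Finset.sum_smul, hw, one_smul]
    rw [h1, inner_sum]
    refine Finset.sum_eq_zero fun i _ => ?_
    rw [inner_smul_right, T.normal_orthogonal, mul_zero]
  have h1 : x - z = (x - (T.face F).points 0) - (z - (T.face F).points 0) := by abel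
  rw [h1, inner_sub_right, key x hx, key z hz, sub_zero]

/-- The union of the elements on which an elementwise constant function has the value `c`. -/
def levelSet (T : PolyMesh m Ω) (f : Fin T.numElem → ℝ) (c : ℝ) : Set (Pt (m + 1)) :=
  ⋃ i ∈ {i | f i = c}, T.elem i

theorem isOpen_levelSet (f : Fin T.numElem → ℝ) (c : ℝ) : IsOpen (T.levelSet f c) :=
  isOpen_biUnion fun i _ => T.elem_open i

theorem elem_subset_levelSet {f : Fin T.numElem → ℝ} {c : ℝ} {i : Fin T.numElem} (h : f i = c) :
    T.elem i ⊆ T.levelSet f c := Set.subset_biUnion_of_mem (u := T.elem) h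

theorem elem_subset_interior {f : Fin T.numElem → ℝ} {c : ℝ} {i : Fin T.numElem} (h : f i = c) :
    T.elem i ⊆ interior (closure (T.levelSet f c)) :=
  (elem_subset_levelSet h).trans (interior_maximal subset_closure (isOpen_levelSet f c))

theorem disjoint_levelSet {f : Fin T.numElem → ℝ} {c c' : ℝ} (h : c ≠ c') :
    Disjoint (T.levelSet f c) (T.levelSet f c') := by
  refine Set.disjoint_iUnion₂_left.mpr fun i hi => Set.disjoint_iUnion₂_right.mpr fun j hj => ?_
  refine T.elem_disjoint i j ?_
  rintro rfl
  exact h (hi.symm.trans hj)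

/-- Away from the relative boundaries of the faces, an elementwise constant function without jumps
is locally constant. -/
theorem exists_mem_interior_levelSet (hΩ : IsOpen Ω) {f : Fin T.numElem → ℝ}
    (hf : ∀ F j, T.minus F = some j → f (T.plus F) = f j) {z : Pt (m + 1)} (hz : z ∈ Ω)
    (hzN : ∀ F i, z ∉ affineSpan ℝ ((T.face F).points '' {i}ᶜ)) :
    ∃ c, z ∈ interior (closure (T.levelSet f c)) := by
  have hopen : ∀ F, z ∈ (T.face F).closedInterior → z ∈ openCell (T.face F) := by
    intro F hF
    by_contra h
    obtain ⟨i, hi⟩ := closedInterior_subset_affineSpan_diff _ hF h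
    exact hzN F i hi
  by_cases hface : ∃ F, z ∈ (T.face F).closedInterior
  swap
  · obtain ⟨i, hi⟩ := exists_mem_closure_elem (T := T) (subset_closure hz)
    refine ⟨f i, elem_subset_interior rfl ?_⟩
    by_contra h
    refine hface (exists_mem_face_of_mem_frontier (i := i) ?_)
    rw [(T.elem_open i).frontier_eq]
    exact ⟨hi, h⟩
  obtain ⟨F, hF⟩ := hface
  have hFo := hopen F hF
  obtain ⟨j, hj⟩ := Option.ne_none_iff_exists'.mp (minus_ne_none hΩ hFo hz)
  refine ⟨f j, ?_⟩
  -- Since open faces are disjoint and z avoids the relative boundaries, F is the only closed face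
  -- through z. A small ball about z therefore meets no other face.
  set V : Set (Pt (m + 1)) := Ω ∩ ⋂ G ∈ {G | G ≠ F}, ((T.face G).closedInterior)ᶜ with hV
  have hVo : IsOpen V := hΩ.inter (Set.Finite.isOpen_biInter (Set.toFinite _) fun G _ =>
    (isCompact_closedInterior _).isClosed.isOpen_compl)
  have hzV : z ∈ V := ⟨hz, Set.mem_iInter₂.mpr fun G hG h =>
    Set.disjoint_left.mp (T.face_disjoint G F hG) (hopen G h) hFo⟩
  obtain ⟨r, hr, hball⟩ := Metric.isOpen_iff.mp hVo z hzV
  have hfr : ∀ x ∈ Metric.ball z r, inner ℝ (T.normal F) (x - z) ≠ 0 →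
      ∀ i, x ∉ frontier (T.elem i) := by
    intro x hx hne i hxi
    obtain ⟨G, hG⟩ := exists_mem_face_of_mem_frontier hxi
    rcases eq_or_ne G F with rfl | hGF
    · exact hne (inner_normal_eq_zero hG hF)
    · exact Set.mem_iInter₂.mp (hball hx).2 G hGF hG
  have hnn : inner ℝ (T.normal F) (T.normal F) = (1 : ℝ) := by
    rw [real_inner_self_eq_norm_sq, T.normal_unit, one_pow]
  have htend : ∀ (x : Pt (m + 1)) (s : ℝ), Tendsto (fun t : ℝ => x + (s * t) • T.normal F) (𝓝[>] 0)
      (𝓝 x) := by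
    intro x s
    have h1 : Continuous fun t : ℝ => x + (s * t) • T.normal F := by fun_prop
    have h2 := h1.tendsto 0
    simp only [mul_zero, zero_smul, add_zero] at h2
    exact h2.mono_left nhdsWithin_le_nhds
  have hlin : ∀ s : ℝ, IsLinearMap ℝ fun x : Pt (m + 1) => s * inner ℝ (T.normal F) x := fun s =>
    ⟨fun x y => by rw [inner_add_right, mul_add], fun a x => by
      rw [real_inner_smul_right, smul_eq_mul]; ring⟩
  -- The hyperplane of F cuts the ball into two open half-balls (s = 1 and s = -1). Each is convex,
  -- meets no element frontier, and touches the element on its side of F, so it lies entirely in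
  -- that element.
  have hhalf : ∀ (s : ℝ) (i : Fin T.numElem), s * s = 1 → f i = f j →
      (∀ᶠ t : ℝ in 𝓝[>] 0, z + (s * t) • T.normal F ∈ T.elem i) →
      ∀ x ∈ Metric.ball z r, 0 < s * inner ℝ (T.normal F) (x - z) → x ∈ T.levelSet f (f j) := by
    intro s i hs hi hev x hx hpos
    set H : Set (Pt (m + 1)) :=
      Metric.ball z r ∩ {x | s * inner ℝ (T.normal F) z < s * inner ℝ (T.normal F) x} with hH
    have hHmem : ∀ y, y ∈ H ↔ y ∈ Metric.ball z r ∧ 0 < s * inner ℝ (T.normal F) (y - z) := by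
      intro y
      rw [inner_sub_right, mul_sub, sub_pos]; rfl
    have hconv : Convex ℝ H := (convex_ball z r).inter (convex_halfSpace_gt (hlin s) _)
    refine elem_subset_levelSet hi (IsPreconnected.subset_of_frontier hconv.isPreconnected
      (T.elem_open i) ?_ ?_ ((hHmem x).mpr ⟨hx, hpos⟩))
    · obtain ⟨t, ht1, ht2, ht3⟩ := (hev.and (((htend z s).eventually
        (Metric.ball_mem_nhds z hr)).and self_mem_nhdsWithin)).exists
      refine ⟨_, (hHmem _).mpr ⟨ht2, ?_⟩, ht1⟩
      rw [add_sub_cancel_left, real_inner_smul_right, hnn, mul_one, ← mul_assoc, hs, one_mul]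
      exact ht3
    · refine Set.disjoint_left.mpr fun y hy => hfr y hy.1 ?_ i
      intro h0
      have := ((hHmem y).mp hy).2
      rw [h0, mul_zero] at this
      exact lt_irrefl _ this
  have hplus := hhalf (-1) (T.plus F) (by norm_num) (hf F j hj) (by
    filter_upwards [T.plus_side F z hFo] with t ht
    rwa [neg_one_mul, neg_smul, ← sub_eq_add_neg])
  have hminus := hhalf 1 j (by norm_num) rfl (by
    filter_upwards [(T.minus_side F j hj).2 z hFo] with t ht
    rwa [one_mul])
  refine interior_mono ?_ (mem_interior.mpr ⟨Metric.ball z r, Set.Subset.rfl, Metric.isOpen_ball,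
    Metric.mem_ball_self hr⟩)
  intro x hx
  rcases lt_trichotomy (inner ℝ (T.normal F) (x - z)) 0 with h | h | h
  · exact subset_closure (hplus x hx (by linarith))
  -- Points of the ball on the hyperplane are limits of points of the half-ball on the minus side.
  · refine mem_closure_of_tendsto (htend x 1) ?_
    filter_upwards [(htend x 1).eventually (Metric.isOpen_ball.mem_nhds hx), self_mem_nhdsWithin]
      with t ht ht0
    refine hminus _ ht ?_
    rw [add_sub_right_comm, inner_add_right, h, real_inner_smul_right, hnn]
    simpa using ht0
  · exact subset_closure (hminus x hx (by linarith))

/-- Two elements meeting the same ball inside `Ω` carry the same value. -/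
theorem eq_of_meets_ball (hΩ : IsOpen Ω) {f : Fin T.numElem → ℝ}
    (hf : ∀ F j, T.minus F = some j → f (T.plus F) = f j) {z : Pt (m + 1)} {r : ℝ}
    (hball : Metric.ball z r ⊆ Ω) {i j : Fin T.numElem} (hi : (T.elem i ∩ Metric.ball z r).Nonempty)
    (hj : (T.elem j ∩ Metric.ball z r).Nonempty) : f i = f j := by
  have havoid : ∀ (x₀ : Fin T.numFace → Fin (m + 1) → Pt (m + 1)) (l : Fin T.numElem),
      (T.elem l ∩ Metric.ball z r).Nonempty → ∃ y ∈ T.elem l ∩ Metric.ball z r,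
        ∀ F a, y ∉ affineSpan ℝ (insert (x₀ F a) ((T.face F).points '' {a}ᶜ)) := by
    intro x₀ l hl
    have hpos := ((T.elem_open l).inter Metric.isOpen_ball).measure_pos volume hl
    have hnull : volume (⋃ F, ⋃ a, (affineSpan ℝ
        (insert (x₀ F a) ((T.face F).points '' {a}ᶜ)) : Set (Pt (m + 1)))) = 0 :=
      measure_iUnion_null fun F => measure_iUnion_null fun a =>
        volume_affineSpan_insert_eq_zero _ _ _
    obtain ⟨y, hy, hy'⟩ := nonempty_of_measure_ne_zero
      ((measure_sdiff_null hnull).trans_ne hpos.ne')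
    exact ⟨y, hy, fun F a h => hy' (Set.mem_iUnion₂.mpr ⟨F, a, h⟩)⟩
  -- The auxiliary point 0 is arbitrary here: x only has to avoid the flats themselves. The second
  -- choice, y, must also avoid their joins with x.
  obtain ⟨x, hx, hxN⟩ := havoid (fun _ _ => 0) i hi
  obtain ⟨y, hy, hyN⟩ := havoid (fun _ _ => x) j hj
  have hseg : segment ℝ x y ⊆ Ω := ((convex_ball z r).segment_subset hx.2 hy.2).trans hball
  -- If a point other than x of the segment lay in one of the flats, then y would lie on the line
  -- through x and that point, hence in the span of x and the flat.
  have hsegN : ∀ p ∈ segment ℝ x y, ∀ F a, p ∉ affineSpan ℝ ((T.face F).points '' {a}ᶜ) := by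
    intro p hp F a hpa
    rw [segment_eq_image_lineMap] at hp
    obtain ⟨t, -, rfl⟩ := hp
    rcases eq_or_ne t 0 with rfl | ht
    · rw [AffineMap.lineMap_apply_zero] at hpa
      exact hxN F a (affineSpan_mono ℝ (Set.subset_insert _ _) hpa)
    · refine hyN F a ?_
      have h1 := AffineMap.lineMap_mem t⁻¹
        (subset_affineSpan ℝ _ (Set.mem_insert x ((T.face F).points '' {a}ᶜ)))
        (affineSpan_mono ℝ (Set.subset_insert x _) hpa)
      have h2 : AffineMap.lineMap x (AffineMap.lineMap x y t : Pt (m + 1)) t⁻¹ = y := by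
        simp only [AffineMap.lineMap_apply, vsub_eq_sub, vadd_eq_add, add_sub_cancel_right,
          smul_smul, inv_mul_cancel₀ ht, one_smul, sub_add_cancel]
      rwa [h2] at h1
  -- The segment is covered by disjoint open sets, one for each value of f; being connected, it
  -- stays in the one belonging to f i.
  have hcov : segment ℝ x y ⊆ interior (closure (T.levelSet f (f i))) ∪
      ⋃ c ∈ {c | c ≠ f i}, interior (closure (T.levelSet f c)) := by
    intro p hp
    obtain ⟨c, hc⟩ := exists_mem_interior_levelSet hΩ hf (hseg hp) (hsegN p hp)
    rcases eq_or_ne c (f i) with rfl | h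
    · exact Or.inl hc
    · exact Or.inr (Set.mem_iUnion₂.mpr ⟨c, h, hc⟩)
  have hsub := (convex_segment x y).isPreconnected.subset_left_of_subset_union isOpen_interior
    (isOpen_biUnion fun c _ => isOpen_interior)
    (Set.disjoint_iUnion₂_right.mpr fun c hc => interior_closure_disjoint (isOpen_levelSet _ _)
      (disjoint_levelSet (Ne.symm hc))) hcov
    ⟨x, left_mem_segment ℝ x y, elem_subset_interior rfl hx.1⟩
  by_contra hne
  exact Set.disjoint_left.mp (interior_closure_disjoint (isOpen_levelSet _ _)
    (disjoint_levelSet hne)) (hsub (right_mem_segment ℝ x y))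
    (elem_subset_interior rfl hy.1)

/-- On a mesh of a connected open set, an elementwise constant function without jumps across the
interior faces is constant. -/
theorem eq_of_forall_minus (hΩ : IsOpen Ω) (hΩc : IsConnected Ω) {f : Fin T.numElem → ℝ}
    (hf : ∀ F j, T.minus F = some j → f (T.plus F) = f j) (i j : Fin T.numElem) : f i = f j := by
  -- V s is the union of the balls in Ω that meet only elements with values in s. Since f has a
  -- single value on the elements meeting a ball in Ω, V {f i} and V {f i}ᶜ are disjoint open sets
  -- covering the connected set Ω.
  let V : Set ℝ → Set (Pt (m + 1)) := fun s => ⋃ z, ⋃ r ∈ {r : ℝ | Metric.ball z r ⊆ Ω ∧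
    ∀ l, (T.elem l ∩ Metric.ball z r).Nonempty → f l ∈ s}, Metric.ball z r
  have hVo : ∀ s, IsOpen (V s) := fun s =>
    isOpen_iUnion fun z => isOpen_biUnion fun r _ => Metric.isOpen_ball
  have hVmem : ∀ s x, x ∈ V s → x ∈ Ω ∧ ∀ l, x ∈ closure (T.elem l) → f l ∈ s := by
    intro s x hx
    obtain ⟨z, r, ⟨hr1, hr2⟩, hxz⟩ : ∃ z r, (Metric.ball z r ⊆ Ω ∧
        ∀ l, (T.elem l ∩ Metric.ball z r).Nonempty → f l ∈ s) ∧ x ∈ Metric.ball z r := by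
      simpa [V] using hx
    refine ⟨hr1 hxz, fun l hl => hr2 l ?_⟩
    rw [Set.inter_comm]
    exact mem_closure_iff.mp hl _ Metric.isOpen_ball hxz
  have hmemV : ∀ s x, x ∈ Ω → (∀ l, x ∈ closure (T.elem l) → f l ∈ s) → x ∈ V s := by
    intro s x hx hs
    obtain ⟨r, hr, hball⟩ := Metric.isOpen_iff.mp hΩ x hx
    obtain ⟨l, hl⟩ := exists_mem_closure_elem (T := T) (subset_closure hx)
    have hmeet : (T.elem l ∩ Metric.ball x r).Nonempty := by
      rw [Set.inter_comm]
      exact mem_closure_iff.mp hl _ Metric.isOpen_ball (Metric.mem_ball_self hr)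
    refine Set.mem_iUnion.mpr ⟨x, Set.mem_iUnion₂.mpr ⟨r, ⟨hball, fun l' hl' => ?_⟩,
      Metric.mem_ball_self hr⟩⟩
    rw [eq_of_meets_ball hΩ hf hball hl' hmeet]
    exact hs l hl
  have hdisj : Disjoint (V {f i}) (V {f i}ᶜ) := by
    refine Set.disjoint_left.mpr fun x h1 h2 => ?_
    obtain ⟨l, hl⟩ := exists_mem_closure_elem (T := T) (subset_closure (hVmem _ _ h1).1)
    exact (hVmem _ _ h2).2 l hl ((hVmem _ _ h1).2 l hl)
  have hsame : ∀ x ∈ Ω, ∀ l l', x ∈ closure (T.elem l) → x ∈ closure (T.elem l') →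
      f l = f l' := by
    intro x hx l l' hl hl'
    obtain ⟨r, hr, hball⟩ := Metric.isOpen_iff.mp hΩ x hx
    have hmeet : ∀ l, x ∈ closure (T.elem l) → (T.elem l ∩ Metric.ball x r).Nonempty := by
      intro l hl
      rw [Set.inter_comm]
      exact mem_closure_iff.mp hl _ Metric.isOpen_ball (Metric.mem_ball_self hr)
    exact eq_of_meets_ball hΩ hf hball (hmeet l hl) (hmeet l' hl')
  have hcov : Ω ⊆ V {f i} ∪ V {f i}ᶜ := by
    intro x hx
    obtain ⟨l, hl⟩ := exists_mem_closure_elem (T := T) (subset_closure hx)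
    by_cases h : f l = f i
    · exact Or.inl (hmemV _ x hx fun l' hl' => (hsame x hx l' l hl' hl).trans h)
    · refine Or.inr (hmemV _ x hx fun l' hl' h' => h ?_)
      exact (hsame x hx l l' hl hl').trans h'
  obtain ⟨x, hx⟩ := (T.elem_connected i).nonempty
  obtain ⟨y, hy⟩ := (T.elem_connected j).nonempty
  have hsub := hΩc.isPreconnected.subset_left_of_subset_union (hVo _) (hVo _) hdisj hcov
    ⟨x, T.elem_subset i hx, hmemV _ x (T.elem_subset i hx) fun l hl =>
      hsame x (T.elem_subset i hx) l i hl (subset_closure hx)⟩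
  exact ((hVmem _ _ (hsub (T.elem_subset j hy))).2 j (subset_closure hy)).symm

/-- A part of the boundary of positive measure meets an open face. -/
theorem exists_openCell_meets (hΩ : IsOpen Ω) {B : Set (Pt (m + 1))} (hB : B ⊆ frontier Ω)
    (hpos : 0 < (μHE[m] : Measure (Pt (m + 1))) B) : ∃ F, (openCell (T.face F) ∩ B).Nonempty := by
  by_contra! h
  have hnull : (μHE[m] : Measure (Pt (m + 1)))
      (⋃ F, (T.face F).closedInterior \ openCell (T.face F)) = 0 :=
    measure_iUnion_null fun F => hausdorff_closedInterior_diff _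
  -- The boundary of Ω is covered by closed faces, so a part of it that misses every open face lies
  -- in the null set of relative face boundaries.
  refine hpos.ne' (measure_mono_null (fun x hx => ?_) hnull)
  have hx' := hB hx
  obtain ⟨i, hi⟩ := exists_mem_closure_elem (T := T) (frontier_subset_closure hx')
  have hxi : x ∈ frontier (T.elem i) := by
    rw [(T.elem_open i).frontier_eq]
    refine ⟨hi, fun hxe => ?_⟩
    rw [hΩ.frontier_eq] at hx'
    exact hx'.2 (T.elem_subset i hxe)
  obtain ⟨F, hF⟩ := exists_mem_face_of_mem_frontier hxi
  refine Set.mem_iUnion.mpr ⟨F, hF, fun hxF => ?_⟩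
  have := h F
  exact (Set.eq_empty_iff_forall_notMem.mp this) x ⟨hxF, hx⟩

variable {κ : T.Tensor} {k : Fin T.numElem → ℕ} {σ₀ : ℝ} {S : Set (Fin T.numFace)}

/-- A broken polynomial without diffusive energy is elementwise constant. -/
theorem exists_eq_C_of_gradForm_eq_zero (hΩ : Bornology.IsBounded Ω) (hκ : ∀ i, (κ i).PosDef)
    {q : T.BrokenPoly k} (h : T.gradForm κ k q q = 0) (i : Fin T.numElem) :
    ∃ c, (q i : MvPolynomial (Fin (m + 1)) ℝ) = MvPolynomial.C c := by
  have h1 := (Finset.sum_eq_zero_iff_of_nonneg fun i _ =>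
    integral_nonneg fun x => inner_tensor_nonneg (hκ i) (grad q i x)).mp h i (Finset.mem_univ i)
  have hc : Continuous fun x => inner ℝ (flux κ q i x) (grad q i x) := by fun_prop
  have h2 := eqOn_zero_of_setIntegral_eq_zero (T.elem_open i) (w := fun _ => 1)
    (fun _ _ => one_pos) hc (fun x => inner_tensor_nonneg (hκ i) (grad q i x))
    (by simpa only [one_mul] using integrableOn_elem hΩ i hc) (by simpa only [one_mul] using h1)
  refine ⟨_, mvPolynomial_eq_C_of_pderiv fun b => mvPolynomial_eq_zero_of_isOpen (T.elem_open i)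
    (T.elem_connected i).nonempty fun x hx => ?_⟩
  have h3 : grad q i x = 0 := by
    by_contra hne
    exact (inner_tensor_pos (hκ i) hne).ne' (h2 x hx)
  exact congrArg (fun v : Pt (m + 1) => v b) h3

/-- Vanishing stabilization forces the jumps to vanish somewhere on each penalized face. -/
theorem exists_jump_eq_zero (hΩ : Bornology.IsBounded Ω) (hκ : ∀ i, (κ i).PosDef) (hσ : 0 < σ₀)
    {q : T.BrokenPoly k} (h : T.jumpForm κ k σ₀ S q q = 0) {F : Fin T.numFace} (hF : F ∈ S) :
    ∃ x ∈ openCell (T.face F), T.jump (val q) F x = 0 := by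
  have hpos := penalty_pos (k := k) hΩ hκ hσ
  have hnn : ∀ F x, 0 ≤ T.penalty κ k σ₀ F * inner ℝ (T.jump (val q) F x) (T.jump (val q) F x) :=
    fun F x => mul_nonneg (hpos F).le real_inner_self_nonneg
  have hi : IntegrableOn (fun x => T.penalty κ k σ₀ F *
      inner ℝ (T.jump (val q) F x) (T.jump (val q) F x)) (openCell (T.face F)) μHE[m] :=
    integrableOn_openCell _ (continuous_const.mul
      ((continuous_jump_val q F).inner (continuous_jump_val q F)))
  classical
  have h1 := (Finset.sum_eq_zero_iff_of_nonneg fun F _ =>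
    integral_nonneg (μ := μHE[m].restrict (openCell (T.face F))) (hnn F)).mp h F
      (by simpa using hF)
  rw [setIntegral_eq_zero_iff_of_nonneg_ae (ae_of_all _ (hnn F)) hi] at h1
  have hne : (μHE[m] : Measure (Pt (m + 1))).restrict (openCell (T.face F)) ≠ 0 := by
    rw [Ne, Measure.restrict_eq_zero]
    exact (hausdorff_openCell_pos _).ne'
  have : (ae ((μHE[m] : Measure (Pt (m + 1))).restrict (openCell (T.face F)))).NeBot :=
    ae_neBot.mpr hne
  obtain ⟨x, hx0, hx⟩ := (h1.and (ae_restrict_mem (measurableSet_openCell _))).exists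
  exact ⟨x, hx, inner_self_eq_zero.mp ((mul_eq_zero.mp hx0).resolve_left (hpos F).ne')⟩

theorem eq_of_jump_eq_zero {w : Fin T.numElem → Pt (m + 1) → ℝ} {F : Fin T.numFace}
    {j : Fin T.numElem} (hj : T.minus F = some j) {x : Pt (m + 1)} (h : T.jump w F x = 0) :
    w (T.plus F) x = w j x := by
  have hn : T.normal F ≠ 0 := fun h0 => by
    have := T.normal_unit F
    rw [h0, norm_zero] at this
    exact zero_ne_one this
  simp only [jump, hj, smul_neg, ← sub_eq_add_neg, ← sub_smul] at h
  exact sub_eq_zero.mp ((smul_eq_zero.mp h).resolve_right hn)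

theorem eq_zero_of_jump_eq_zero {w : Fin T.numElem → Pt (m + 1) → ℝ} {F : Fin T.numFace}
    (hj : T.minus F = none) {x : Pt (m + 1)} (h : T.jump w F x = 0) : w (T.plus F) x = 0 := by
  have hn : T.normal F ≠ 0 := fun h0 => by
    have := T.normal_unit F
    rw [h0, norm_zero] at this
    exact zero_ne_one this
  simp only [jump, hj] at h
  exact (smul_eq_zero.mp h).resolve_right hn

end PolyMesh

namespace Discretization

open PolyMesh

variable {n : ℕ} {P : Medium n} (D : Discretization P)

/-! ### Definiteness of the energy norm -/

theorem eqOn_zero_of_couplingForm_eq_zero {u : D.Space} (h : D.couplingForm u u = 0)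
    (k : Fin P.N) (j : Fin (D.frac k).numElem) {y : Pt (n + 1)} (hy : y ∈ (D.frac k).elem j) :
    D.bulk.jump (val u.1) (D.bulkFace k j) (P.chart k y) = 0 ∧
      D.bulk.avg (val u.1) (D.bulkFace k j) (P.chart k y) - val (u.2 k) j y = 0 := by
  have h0 := D.integral_coupling_nonneg u
  have h1 := fun k => Finset.sum_nonneg fun j (_ : j ∈ Finset.univ) => (h0 k j).1
  have h2 := fun k => Finset.sum_nonneg fun j (_ : j ∈ Finset.univ) => (h0 k j).2
  obtain ⟨hJ, hA⟩ := (add_eq_zero_iff_of_nonneg (Finset.sum_nonneg fun k _ => h1 k)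
    (Finset.sum_nonneg fun k _ => h2 k)).mp h
  have hJ' := (Finset.sum_eq_zero_iff_of_nonneg fun j _ => (h0 k j).1).mp
    ((Finset.sum_eq_zero_iff_of_nonneg fun k _ => h1 k).mp hJ k (Finset.mem_univ k)) j
    (Finset.mem_univ j)
  have hA' := (Finset.sum_eq_zero_iff_of_nonneg fun j _ => (h0 k j).2).mp
    ((Finset.sum_eq_zero_iff_of_nonneg fun k _ => h2 k).mp hA k (Finset.mem_univ k)) j
    (Finset.mem_univ j)
  obtain ⟨B, hB⟩ := P.coeff_bounds k
  have hc1 := D.continuous_coupling_jump u k j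
  have hc2 := D.continuous_coupling_diff u k j
  constructor
  · exact inner_self_eq_zero.mp (eqOn_zero_of_setIntegral_eq_zero ((D.frac k).elem_open j)
      (fun x hx => (hB x ((D.frac k).elem_subset j hx)).2.1.1) (hc1.inner hc1)
      (fun _ => real_inner_self_nonneg) (D.integrableOn_coupling_jump u u k j) hJ' y hy)
  · exact mul_self_eq_zero.mp (eqOn_zero_of_setIntegral_eq_zero ((D.frac k).elem_open j)
      (fun x hx => (hB x ((D.frac k).elem_subset j hx)).2.2.1) (hc2.mul hc2)
      (fun _ => mul_self_nonneg _) (D.integrableOn_coupling_diff u u k j) hA' y hy)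

/-- The Dirichlet part has positive measure, so some open face meets it. That face is not interior,
because interior faces lie in Ω, and the alignment with the boundary partition puts all of it in the
Dirichlet part. -/
theorem exists_mem_facesD : ∃ F, F ∈ D.facesD := by
  obtain ⟨F, x, hxF, hxB⟩ := exists_openCell_meets (T := D.bulk) P.Ω_open
    (P.bdry_union ▸ Set.subset_union_left) P.bdryD_pos
  have hm : D.bulk.minus F = none := by
    by_contra h
    obtain ⟨j, hj⟩ := Option.ne_none_iff_exists'.mp h
    have h1 : x ∈ frontier P.Ω := P.bdry_union ▸ Or.inl hxB
    rw [P.Ω_open.frontier_eq] at h1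
    exact h1.2 (D.bulk.interior_face F j hj hxF)
  refine ⟨F, hm, (D.bdry_match F hm).resolve_right fun h => ?_⟩
  exact Set.disjoint_left.mp P.bdry_disjoint hxB (h hxF)

theorem eq_zero_of_energyForm_eq_zero {σ₀ σ₀Γ : ℝ} (hσ : 0 < σ₀) (hσΓ : 0 < σ₀Γ) {u : D.Space}
    (h : D.energyForm σ₀ σ₀Γ u u = 0) : u = 0 := by
  have e1 := gradForm_self_nonneg D.bulkTensor_posDef u.1
  have e2 := jumpForm_self_nonneg (S := D.facesI ∪ D.facesD) P.Ω_bounded D.bulkTensor_posDef hσ u.1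
  have e3 := D.fracGrad_self_nonneg u.2
  have e4 := D.fracStab_self_nonneg hσΓ u.2
  have e5 := D.interStab_self_nonneg hσΓ u.2
  have e6 := D.couplingForm_self_nonneg u
  unfold energyForm at h
  have hg : D.bulk.gradForm D.bulkTensor D.bulkDeg u.1 u.1 = 0 := by linarith
  have hj : D.bulk.jumpForm D.bulkTensor D.bulkDeg σ₀ (D.facesI ∪ D.facesD) u.1 u.1 = 0 := by
    linarith
  have hc : D.couplingForm u u = 0 := by linarith
  choose f hf using exists_eq_C_of_gradForm_eq_zero P.Ω_bounded D.bulkTensor_posDef hg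
  have hval : ∀ i x, val u.1 i x = f i := fun i x => by rw [val, hf, MvPolynomial.eval_C]
  have hjump : ∀ F, F ∈ D.fracFaces ∨ F ∈ D.facesI ∪ D.facesD →
      ∃ x, D.bulk.jump (val u.1) F x = 0 := by
    rintro F (⟨k, j, rfl⟩ | hF)
    · obtain ⟨y, hy⟩ := ((D.frac k).elem_connected j).nonempty
      exact ⟨_, (D.eqOn_zero_of_couplingForm_eq_zero hc k j hy).1⟩
    · obtain ⟨x, -, hx⟩ := exists_jump_eq_zero P.Ω_bounded D.bulkTensor_posDef hσ hj hF
      exact ⟨x, hx⟩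
  -- Every interior face either is penalized or lies on a fracture, where β > 0 controls the jump.
  -- Vanishing at one point of a face suffices, as the traces are constants.
  have hconst : ∀ i j, f i = f j := by
    refine eq_of_forall_minus P.Ω_open P.Ω_connected fun F j hF => ?_
    have hmem : F ∈ D.fracFaces ∨ F ∈ D.facesI ∪ D.facesD := by
      by_cases hFf : F ∈ D.fracFaces
      · exact Or.inl hFf
      · exact Or.inr (Or.inl ⟨by rw [hF]; exact Option.some_ne_none j, hFf⟩)
    obtain ⟨x, hx⟩ := hjump F hmem
    have := eq_of_jump_eq_zero hF hx
    rwa [hval, hval] at this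
  obtain ⟨F, hF⟩ := D.exists_mem_facesD
  obtain ⟨x, hx⟩ := hjump F (Or.inr (Or.inr hF))
  have hzero := eq_zero_of_jump_eq_zero hF.1 hx
  rw [hval] at hzero
  have hf0 : ∀ i, f i = 0 := fun i => (hconst i _).trans hzero
  have hu1 : u.1 = 0 := by
    funext i
    refine Subtype.ext ?_
    rw [hf, hf0, MvPolynomial.C_0]
    rfl
  -- As α > 0, the fracture pressure equals the average of the bulk traces, which is already zero.
  -- No Dirichlet condition on the network is needed.
  have hu2 : u.2 = 0 := by
    funext k j
    refine Subtype.ext (mvPolynomial_eq_zero_of_isOpen ((D.frac k).elem_open j)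
      ((D.frac k).elem_connected j).nonempty fun y hy => ?_)
    have h1 := (D.eqOn_zero_of_couplingForm_eq_zero hc k j hy).2
    rw [hu1, (isLinearMap_avg (isLinearMap_val (T := D.bulk) (k := D.bulkDeg)) _ _).map_zero,
      zero_sub, neg_eq_zero] at h1
    exact h1
  exact Prod.ext hu1 hu2

end Discretization

/-! ### Load functionals -/

theorem exists_bound_integral_mul {X : Type*} [MeasurableSpace X] {μ : Measure X} {s B : Set X}
    (hs : MeasurableSet s) (hsB : s ⊆ B) (hμ : μ s < ⊤) {w : X → ℝ}
    (hw : AEStronglyMeasurable w (μ.restrict s)) {M : ℝ} (hM : ∀ x ∈ s, |w x| ≤ M) :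
    ∃ K : ℝ, 0 ≤ K ∧ ∀ f : X → ℝ, MemLp f 2 (μ.restrict B) →
      IntegrableOn (fun x => f x * w x) s μ ∧
        |∫ x in s, f x * w x ∂μ| ≤ K * (eLpNorm f 2 (μ.restrict B)).toReal := by
  have hfin : IsFiniteMeasure (μ.restrict s) := ⟨by simpa using hμ⟩
  have hle : μ.restrict s ≤ μ.restrict B := Measure.restrict_mono hsB le_rfl
  -- R is μ(s)^(1/2), the Cauchy–Schwarz constant between the L¹ and L² norms on s.
  set R := (μ.restrict s Set.univ ^ (1 / (1 : ENNReal).toReal - 1 / (2 : ENNReal).toReal)).toReal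
  refine ⟨|M| * R, by positivity, fun f hf => ?_⟩
  have hfs : MemLp f 2 (μ.restrict s) := hf.mono_measure hle
  have hf1 : MemLp f 1 (μ.restrict s) := hfs.mono_exponent one_le_two
  have hfi : Integrable f (μ.restrict s) := memLp_one_iff_integrable.mp hf1
  have hbd : ∀ᵐ x ∂μ.restrict s, ‖f x * w x‖ ≤ |M| * ‖f x‖ :=
    (ae_restrict_iff' hs).mpr (ae_of_all _ fun x hx => by
      rw [norm_mul, mul_comm]
      exact mul_le_mul_of_nonneg_right ((hM x hx).trans (le_abs_self _)) (norm_nonneg _))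
  refine ⟨(hfi.norm.const_mul |M|).mono' (hfi.aestronglyMeasurable.mul hw) hbd, ?_⟩
  have h1 := norm_integral_le_of_norm_le (hfi.norm.const_mul |M|) hbd
  rw [integral_const_mul, Real.norm_eq_abs] at h1
  refine h1.trans ?_
  rw [mul_assoc]
  refine mul_le_mul_of_nonneg_left ?_ (abs_nonneg _)
  rw [integral_norm_eq_lintegral_enorm hfi.aestronglyMeasurable, ← eLpNorm_one_eq_lintegral_enorm]
  have h2 := eLpNorm_le_eLpNorm_mul_rpow_measure_univ (μ := μ.restrict s) (f := f) one_le_two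
    hfs.aestronglyMeasurable
  have h3 : eLpNorm f 2 (μ.restrict s) ≤ eLpNorm f 2 (μ.restrict B) := eLpNorm_mono_measure f hle
  have hR : μ.restrict s Set.univ ^ (1 / (1 : ENNReal).toReal - 1 / (2 : ENNReal).toReal) ≠ ⊤ :=
    ENNReal.rpow_ne_top_of_nonneg (by norm_num) (measure_ne_top _ _)
  rw [mul_comm, ← ENNReal.toReal_mul]
  exact ENNReal.toReal_mono (ENNReal.mul_ne_top hf.2.ne hR) (h2.trans (mul_le_mul_left h3 _))

/-- A family of linear functionals depending on the data, each of whose values is bounded by the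
size of the data. -/
structure IsLoad {n : ℕ} {P : Medium n} {V : Type*} [AddCommGroup V] [Module ℝ V]
    (L : P.Data → V → ℝ) : Prop where
  linear : ∀ G, IsLinearMap ℝ (L G)
  bound : ∀ v, ∃ K : ℝ, 0 ≤ K ∧ ∀ G, |L G v| ≤ K * G.size

theorem Medium.Data.size_nonneg {n : ℕ} {P : Medium n} (G : P.Data) : 0 ≤ G.size := by
  unfold Medium.Data.size
  positivity

namespace IsLoad

variable {n : ℕ} {P : Medium n} {V W : Type*} [AddCommGroup V] [Module ℝ V] [AddCommGroup W]
  [Module ℝ W] {L L' : P.Data → V → ℝ}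

theorem add (h : IsLoad L) (h' : IsLoad L') : IsLoad fun G v => L G v + L' G v where
  linear G := ⟨fun u v => by rw [(h.linear G).map_add, (h'.linear G).map_add]; ring,
    fun a v => by rw [(h.linear G).map_smul, (h'.linear G).map_smul, smul_add]⟩
  bound v := by
    obtain ⟨K, hK, hb⟩ := h.bound v
    obtain ⟨K', hK', hb'⟩ := h'.bound v
    refine ⟨K + K', add_nonneg hK hK', fun G => (abs_add_le _ _).trans ?_⟩
    rw [add_mul]
    exact add_le_add (hb G) (hb' G)

theorem neg (h : IsLoad L) : IsLoad fun G v => -L G v where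
  linear G := ⟨fun u v => by rw [(h.linear G).map_add]; ring,
    fun a v => by rw [(h.linear G).map_smul, smul_neg]⟩
  bound v := by
    obtain ⟨K, hK, hb⟩ := h.bound v
    exact ⟨K, hK, fun G => by rw [abs_neg]; exact hb G⟩

theorem sub (h : IsLoad L) (h' : IsLoad L') : IsLoad fun G v => L G v - L' G v := by
  simpa only [sub_eq_add_neg] using h.add h'.neg

theorem sum {ι : Type*} (s : Finset ι) {L : ι → P.Data → V → ℝ} (h : ∀ i ∈ s, IsLoad (L i)) :
    IsLoad fun G v => ∑ i ∈ s, L i G v where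
  linear G := ⟨fun u v => by
      rw [← Finset.sum_add_distrib]
      exact Finset.sum_congr rfl fun i hi => ((h i hi).linear G).map_add u v,
    fun a v => by
      rw [Finset.smul_sum]
      exact Finset.sum_congr rfl fun i hi => ((h i hi).linear G).map_smul a v⟩
  bound v := by
    choose! K hK hb using fun i (hi : i ∈ s) => (h i hi).bound v
    refine ⟨∑ i ∈ s, K i, Finset.sum_nonneg hK, fun G => ?_⟩
    rw [Finset.sum_mul]
    exact (Finset.abs_sum_le_sum_abs _ _).trans (Finset.sum_le_sum fun i hi => hb i hi G)

theorem comp (h : IsLoad L) {A : W → V} (hA : IsLinearMap ℝ A) : IsLoad fun G w => L G (A w) where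
  linear G := ⟨fun u v => by rw [hA.map_add, (h.linear G).map_add],
    fun a v => by rw [hA.map_smul, (h.linear G).map_smul]⟩
  bound v := h.bound (A v)

theorem integral {X : Type*} [MeasurableSpace X] {μ : Measure X} {s B : Set X}
    {g : P.Data → X → ℝ} {w : V → X → ℝ} (hs : MeasurableSet s) (hsB : s ⊆ B) (hμ : μ s < ⊤)
    (hg : ∀ G, MemLp (g G) 2 (μ.restrict B))
    (hgs : ∀ G : P.Data, (eLpNorm (g G) 2 (μ.restrict B)).toReal ≤ G.size)
    (hw : ∀ x, IsLinearMap ℝ fun v => w v x)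
    (hwm : ∀ v, AEStronglyMeasurable (w v) (μ.restrict s))
    (hwb : ∀ v, ∃ M, ∀ x ∈ s, |w v x| ≤ M) :
    IsLoad fun G v => ∫ x in s, g G x * w v x ∂μ := by
  have key : ∀ v, ∃ K : ℝ, 0 ≤ K ∧ ∀ f : X → ℝ, MemLp f 2 (μ.restrict B) →
      IntegrableOn (fun x => f x * w v x) s μ ∧
        |∫ x in s, f x * w v x ∂μ| ≤ K * (eLpNorm f 2 (μ.restrict B)).toReal := fun v => by
    obtain ⟨M, hM⟩ := hwb v
    exact exists_bound_integral_mul hs hsB hμ (hwm v) hM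
  have hint : ∀ G v, IntegrableOn (fun x => g G x * w v x) s μ := fun G v => by
    obtain ⟨K, -, hK⟩ := key v
    exact (hK _ (hg G)).1
  refine ⟨fun G => ⟨fun u v => ?_, fun a v => ?_⟩, fun v => ?_⟩
  · rw [← integral_add (hint G u) (hint G v)]
    exact integral_congr_ae (ae_of_all _ fun x => by
      simp only [(hw x).map_add]; ring)
  · rw [smul_eq_mul, ← integral_const_mul]
    exact integral_congr_ae (ae_of_all _ fun x => by
      simp only [(hw x).map_smul, smul_eq_mul]; ring)
  · obtain ⟨K, hK0, hK⟩ := key v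
    exact ⟨K, hK0, fun G => (hK _ (hg G)).2.trans (mul_le_mul_of_nonneg_left (hgs G) hK0)⟩

end IsLoad

theorem exists_bound_of_isBounded {n : ℕ} {s : Set (Pt n)} (hs : Bornology.IsBounded s)
    {g : Pt n → ℝ} (hg : Continuous g) : ∃ M, ∀ x ∈ s, |g x| ≤ M := by
  obtain ⟨M, hM⟩ := hs.isCompact_closure.exists_bound_of_continuousOn hg.continuousOn
  exact ⟨M, fun x hx => hM x (subset_closure hx)⟩

theorem PolyMesh.isLoad_dirichletTerm {n m : ℕ} {P : Medium n} {Ω : Set (Pt (m + 1))}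
    {T : PolyMesh m Ω} {κ : T.Tensor} {k : Fin T.numElem → ℕ} {σ₀ : ℝ} {S : Set (Fin T.numFace)}
    {B : Set (Pt (m + 1))} (hS : ∀ F ∈ S, openCell (T.face F) ⊆ B)
    {g : P.Data → Pt (m + 1) → ℝ}
    (hg : ∀ G, MemLp (g G) 2 ((μHE[m] : Measure (Pt (m + 1))).restrict B))
    (hgs : ∀ G : P.Data,
      (eLpNorm (g G) 2 ((μHE[m] : Measure (Pt (m + 1))).restrict B)).toReal ≤ G.size) :
    IsLoad fun (G : P.Data) (q : T.BrokenPoly k) => T.dirichletTerm κ k σ₀ S (g G) q := by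
  classical
  unfold dirichletTerm
  refine IsLoad.sum _ fun F hF => ?_
  have hc : ∀ q : T.BrokenPoly k, Continuous fun x =>
      inner ℝ (flux κ q (T.plus F) x) (T.normal F) - T.penalty κ k σ₀ F * val q (T.plus F) x :=
    fun q => by fun_prop
  simp only [mul_comm _ (g _ _)]
  refine IsLoad.integral (measurableSet_openCell _) (hS F (by simpa using hF))
    (hausdorff_openCell_lt_top _) hg hgs (fun x => ⟨fun p q => ?_, fun a q => ?_⟩)
    (fun q => (hc q).aestronglyMeasurable)
    fun q => exists_bound_of_isBounded (isBounded_openCell _) (hc q)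
  · rw [(isLinearMap_flux κ _ x).map_add, (isLinearMap_val _ x).map_add, inner_add_left]
    ring
  · rw [(isLinearMap_flux κ _ x).map_smul, (isLinearMap_val _ x).map_smul, real_inner_smul_left,
      smul_eq_mul, smul_eq_mul]
    ring

namespace Discretization

open PolyMesh

variable {n : ℕ} {P : Medium n} (D : Discretization P)

theorem isLoad_load (σ₀ σ₀Γ : ℝ) : IsLoad (D.load σ₀ σ₀Γ) := by
  have hsize : ∀ G : P.Data, (eLpNorm G.f 2 (volume.restrict P.Ω)).toReal ≤ G.size ∧
      (∀ k, (eLpNorm (G.fΓ k) 2 (volume.restrict (P.U k))).toReal ≤ G.size) ∧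
      (eLpNorm G.gD 2 ((μHE[n + 1] : Measure (Pt (n + 2))).restrict P.bdryD)).toReal ≤ G.size ∧
      ∀ k, (eLpNorm (G.gΓ k) 2
        ((μHE[n] : Measure (Pt (n + 1))).restrict (P.fracBdryD k))).toReal ≤ G.size := by
    intro G
    have h2 : 0 ≤ ∑ k, (eLpNorm (G.fΓ k) 2 (volume.restrict (P.U k))).toReal := by positivity
    have h4 : 0 ≤ ∑ k, (eLpNorm (G.gΓ k) 2
        ((μHE[n] : Measure (Pt (n + 1))).restrict (P.fracBdryD k))).toReal := by positivity
    have h1 : 0 ≤ (eLpNorm G.f 2 (volume.restrict P.Ω)).toReal := ENNReal.toReal_nonneg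
    have h3 : 0 ≤ (eLpNorm G.gD 2 ((μHE[n + 1] : Measure (Pt (n + 2))).restrict
        P.bdryD)).toReal := ENNReal.toReal_nonneg
    have h2' := fun k => Finset.single_le_sum (f := fun k =>
      (eLpNorm (G.fΓ k) 2 (volume.restrict (P.U k))).toReal)
      (fun k _ => ENNReal.toReal_nonneg) (Finset.mem_univ k)
    have h4' := fun k => Finset.single_le_sum (f := fun k => (eLpNorm (G.gΓ k) 2
        ((μHE[n] : Measure (Pt (n + 1))).restrict (P.fracBdryD k))).toReal)
      (fun k _ => ENNReal.toReal_nonneg) (Finset.mem_univ k)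
    unfold Medium.Data.size
    exact ⟨by linarith, fun k => by linarith [h2' k], by linarith, fun k => by linarith [h4' k]⟩
  have h1 : IsLoad fun (G : P.Data) (v : D.BulkSpace) =>
      ∑ i, ∫ x in D.bulk.elem i, G.f x * val v i x :=
    IsLoad.sum _ fun i _ => IsLoad.integral (g := fun G => G.f) (w := fun v x => val v i x)
      (D.bulk.elem_open i).measurableSet
      (D.bulk.elem_subset i) (isBounded_elem P.Ω_bounded i).measure_lt_top (fun G => G.f_mem)
      (fun G => (hsize G).1) (isLinearMap_val i)
      (fun v => (continuous_val v i).aestronglyMeasurable)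
      fun v => exists_bound_of_isBounded (isBounded_elem P.Ω_bounded i) (continuous_val v i)
  have h2 : IsLoad fun (G : P.Data) (v : D.BulkSpace) =>
      D.bulk.dirichletTerm D.bulkTensor D.bulkDeg σ₀ D.facesD G.gD v :=
    isLoad_dirichletTerm (fun F hF => hF.2) (fun G => G.gD_mem) fun G => (hsize G).2.2.1
  have h3 : ∀ k, IsLoad fun (G : P.Data) (q : (D.frac k).BrokenPoly (D.fracDeg k)) =>
      ∑ j, ∫ y in (D.frac k).elem j, P.ℓ k y * G.fΓ k y * val q j y := by
    intro k
    refine IsLoad.sum _ fun j _ => ?_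
    obtain ⟨B, hB⟩ := P.coeff_bounds k
    have hcomm : ∀ (G : P.Data) (q : (D.frac k).BrokenPoly (D.fracDeg k)) y,
        P.ℓ k y * G.fΓ k y * val q j y = G.fΓ k y * (P.ℓ k y * val q j y) := fun G q y => by ring
    simp only [hcomm]
    have hsub := (D.frac k).elem_subset j
    refine IsLoad.integral (g := fun G => G.fΓ k) (w := fun q y => P.ℓ k y * val q j y)
      ((D.frac k).elem_open j).measurableSet hsub
      (isBounded_elem (P.U_bounded k) j).measure_lt_top (fun G => G.fΓ_mem k)
      (fun G => (hsize G).2.1 k) (fun y => ⟨fun p q => ?_, fun a q => ?_⟩)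
      (fun q => ((P.aestronglyMeasurable_ℓ k).mono_measure (Measure.restrict_mono hsub le_rfl)).mul
        (continuous_val q j).aestronglyMeasurable) fun q => ?_
    · rw [(isLinearMap_val j y).map_add]; ring
    · rw [(isLinearMap_val j y).map_smul, smul_eq_mul, smul_eq_mul]; ring
    · obtain ⟨M, hM⟩ := exists_bound_of_isBounded (isBounded_elem (P.U_bounded k) j)
        (continuous_val q j)
      refine ⟨B * M, fun y hy => ?_⟩
      rw [abs_mul]
      exact mul_le_mul (hB y (hsub hy)).1 (hM y hy) (abs_nonneg _)
        ((abs_nonneg _).trans (hB y (hsub hy)).1)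
  have h4 : ∀ k, IsLoad fun (G : P.Data) (q : (D.frac k).BrokenPoly (D.fracDeg k)) =>
      (D.frac k).dirichletTerm (D.fracTensor k) (D.fracDeg k) σ₀Γ (D.edgesD k) (G.gΓ k) q :=
    fun k => isLoad_dirichletTerm
      (fun e he => Set.subset_inter ((D.frac k).boundary_face e he.1)
        (Set.image_subset_iff.mp he.2))
      (fun G => G.gΓ_mem k) fun G => (hsize G).2.2.2 k
  have h5 : IsLoad fun (G : P.Data) (q : D.FracSpace) =>
      (∑ k, ∑ j, ∫ y in (D.frac k).elem j, P.ℓ k y * G.fΓ k y * val (q k) j y) -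
      ∑ k, (D.frac k).dirichletTerm (D.fracTensor k) (D.fracDeg k) σ₀Γ (D.edgesD k) (G.gΓ k)
        (q k) :=
    (IsLoad.sum _ fun k _ => (h3 k).comp (D.isLinearMap_frac k)).sub
      (IsLoad.sum _ fun k _ => (h4 k).comp (D.isLinearMap_frac k))
  exact ((h1.sub h2).comp D.isLinearMap_fst).add (h5.comp D.isLinearMap_snd)

end Discretization

/-! ### Abstract well-posedness -/

section Abstract

variable {V : Type*} [AddCommGroup V] [Module ℝ V] {E X : V → V → ℝ}

/-- A homogenization of a bound by sums of squares. -/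
theorem IsBilin.abs_le_of_abs_le_add (hE : IsBilin E) (hX : IsBilin X) (hE0 : ∀ u, 0 ≤ E u u)
    (hdef : ∀ u, E u u = 0 → u = 0) {δ : ℝ} (h : ∀ u v, |X u v| ≤ δ * (E u u + E v v)) (u v : V) :
    |X u v| ≤ 2 * δ * (√(E u u) * √(E v v)) := by
  have hzero : ∀ u v, u = 0 ∨ v = 0 → X u v = 0 := by
    rintro u v (rfl | rfl)
    · simpa using hX.smul_left 0 0 v
    · simpa using hX.smul_right 0 u 0
  have hδ : ∀ w, E w w = 0 → √(E w w) = 0 := fun w hw => by rw [hw, Real.sqrt_zero]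
  rcases eq_or_lt_of_le (hE0 u) with hu | hu
  · rw [hzero u v (Or.inl (hdef u hu.symm)), hδ u hu.symm]; simp
  rcases eq_or_lt_of_le (hE0 v) with hv | hv
  · rw [hzero u v (Or.inr (hdef v hv.symm)), hδ v hv.symm]; simp
  have ha := Real.sqrt_pos.mpr hu
  have hb := Real.sqrt_pos.mpr hv
  have hnorm : ∀ w, 0 < E w w → E ((√(E w w))⁻¹ • w) ((√(E w w))⁻¹ • w) = 1 := by
    intro w hw
    rw [hE.smul_left, hE.smul_right, ← mul_assoc, ← mul_inv, Real.mul_self_sqrt hw.le,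
      inv_mul_cancel₀ hw.ne']
  -- Both vectors are scaled to energy 1, so the bound becomes 2δ; bilinearity restores the norms.
  -- Vectors of zero energy cannot be scaled and are handled by definiteness.
  have h1 := h ((√(E u u))⁻¹ • u) ((√(E v v))⁻¹ • v)
  rw [hnorm u hu, hnorm v hv, hX.smul_left, hX.smul_right, abs_mul, abs_mul,
    abs_of_pos (inv_pos.mpr ha), abs_of_pos (inv_pos.mpr hb), ← mul_assoc, ← mul_inv,
    inv_mul_le_iff₀ (mul_pos ha hb)] at h1
  linarith

/-- Finite-dimensional Lax–Milgram: a definite form represents every linear functional. -/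
theorem IsBilin.existsUnique_representation [FiniteDimensional ℝ V] {a : V → V → ℝ}
    (ha : IsBilin a) (hdef : ∀ u, a u u = 0 → u = 0) {L : V → ℝ} (hL : IsLinearMap ℝ L) :
    ∃! u, ∀ v, a u v = L v := by
  have hinj : Function.Injective ha.toLin := by
    rw [← LinearMap.ker_eq_bot, LinearMap.ker_eq_bot']
    exact fun u hu => hdef u (by simpa using congrArg (fun φ : V →ₗ[ℝ] ℝ => φ u) hu)
  have hsurj : Function.Surjective ha.toLin :=
    (LinearMap.injective_iff_surjective_of_finrank_eq_finrank
      (Subspace.dual_finrank_eq (K := ℝ) (V := V)).symm).mp hinj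
  obtain ⟨u, hu⟩ := hsurj hL.mk'
  refine ⟨u, fun v => congrArg (fun φ : V →ₗ[ℝ] ℝ => φ v) hu, fun w hw => hinj ?_⟩
  rw [hu]
  exact LinearMap.ext hw

end Abstract

end PolyDG

end

/-! ### Assembly of the main theorem -/

open PolyDG in
theorem mainTheorem5 (n : ℕ) (hn : n ≤ 1) (C : ℝ) :
    ∃ σmin c M : ℝ, 0 < σmin ∧ 0 < c ∧ 0 < M ∧
      ∀ (P : PolyDG.Medium n) (D : PolyDG.Discretization P), D.PolytopicRegular C →
      ∀ σ₀ σ₀Γ : ℝ, σmin ≤ σ₀ → σmin ≤ σ₀Γ →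
        (∀ u v : D.Space,
          |D.form σ₀ σ₀Γ u v| ≤ M * D.energyNorm σ₀ σ₀Γ u * D.energyNorm σ₀ σ₀Γ v) ∧
        (∀ u : D.Space, c * D.energyNorm σ₀ σ₀Γ u ^ 2 ≤ D.form σ₀ σ₀Γ u u) ∧
        (∀ u : D.Space, D.energyNorm σ₀ σ₀Γ u = 0 → u = 0) ∧
        (∀ G : P.Data, ∃! u : D.Space, D.IsSolution σ₀ σ₀Γ G u) ∧
        (∃ K : ℝ, ∀ G : P.Data,
          (∀ v : D.Space, |D.load σ₀ σ₀Γ G v| ≤ K * G.size * D.energyNorm σ₀ σ₀Γ v) ∧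
          (∀ u : D.Space, D.IsSolution σ₀ σ₀Γ G u →
            D.energyNorm σ₀ σ₀Γ u ≤ K / c * G.size)) := by
  -- The maximum with 1 keeps the threshold positive whatever the sign of C. The constants are 1/2 =
  -- 1 - 2 · 1/4 and 2 = 1 + 2 · 1/2.
  refine ⟨16 * max C 1, 1 / 2, 2, by positivity, by norm_num, by norm_num, ?_⟩
  intro P D hD σ₀ σ₀Γ hσ₀ hσ₀Γ
  have hmin : 0 < 16 * max C 1 := by positivity
  have hCmin : 16 * C ≤ 16 * max C 1 := by linarith [le_max_left C 1]
  have hσ : 0 < σ₀ := hmin.trans_le hσ₀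
  have hσΓ : 0 < σ₀Γ := hmin.trans_le hσ₀Γ
  have hE := D.isBilin_energyForm σ₀ σ₀Γ
  have hE0 := D.energyForm_self_nonneg hσ hσΓ
  have hdef : ∀ u, D.energyForm σ₀ σ₀Γ u u = 0 → u = 0 := fun u =>
    D.eq_zero_of_energyForm_eq_zero hσ hσΓ
  have hX4 := D.abs_consistencyForm_le hD hσ hσΓ (hCmin.trans hσ₀) (hCmin.trans hσ₀Γ)
  have hX := hE.abs_le_of_abs_le_add D.isBilin_consistencyForm hE0 hdef hX4
  have hEc := hE.abs_le_sqrt_mul_sqrt (D.energyForm_comm σ₀ σ₀Γ) hE0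
  have hsq : ∀ u, D.energyNorm σ₀ σ₀Γ u ^ 2 = D.energyForm σ₀ σ₀Γ u u := fun u => by
    rw [D.energyNorm_eq, Real.sq_sqrt (hE0 u)]
  have hN0 : ∀ u, 0 ≤ D.energyNorm σ₀ σ₀Γ u := fun u => Real.sqrt_nonneg _
  simp only [← D.energyNorm_eq] at hX hEc
  have hcont : ∀ u v : D.Space,
      |D.form σ₀ σ₀Γ u v| ≤ 2 * D.energyNorm σ₀ σ₀Γ u * D.energyNorm σ₀ σ₀Γ v := by
    intro u v
    rw [D.form_eq]
    have h1 := abs_sub (D.energyForm σ₀ σ₀Γ u v - D.consistencyForm u v) (D.consistencyForm v u)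
    have h2 := abs_sub (D.energyForm σ₀ σ₀Γ u v) (D.consistencyForm u v)
    have h3 := hEc u v
    have h4 := hX u v
    have h5 := hX v u
    rw [mul_comm (D.energyNorm σ₀ σ₀Γ v)] at h5
    linarith
  have hcoer : ∀ u : D.Space, 1 / 2 * D.energyNorm σ₀ σ₀Γ u ^ 2 ≤ D.form σ₀ σ₀Γ u u := by
    intro u
    rw [hsq, D.form_eq]
    have h1 := (le_abs_self _).trans
      (D.abs_consistencyForm_self_le hD hσ hσΓ (hCmin.trans hσ₀) (hCmin.trans hσ₀Γ) u)
    linarith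
  have hnorm : ∀ u : D.Space, D.energyNorm σ₀ σ₀Γ u = 0 → u = 0 := fun u hu =>
    hdef u (by rw [← hsq, hu]; norm_num)
  have hform := D.isBilin_form σ₀ σ₀Γ
  have hfdef : ∀ u, D.form σ₀ σ₀Γ u u = 0 → u = 0 := fun u hu => by
    have h1 := hcoer u
    rw [hu] at h1
    exact hnorm u (pow_eq_zero_iff two_ne_zero |>.mp (le_antisymm (by linarith) (sq_nonneg _)))
  have hload := D.isLoad_load σ₀ σ₀Γ
  refine ⟨hcont, hcoer, hnorm, fun G => hform.existsUnique_representation hfdef (hload.linear G),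
    ?_⟩
  -- The coordinate functionals of a basis are represented as form(w i, ·). Continuity of the form
  -- bounds them by 2‖w i‖ in the energy norm, so no equivalence of norms has to be invoked.
  let b := Module.finBasis ℝ D.Space
  choose w hw _ using fun i => hform.existsUnique_representation hfdef (b.coord i).isLinear
  choose K hK0 hK using fun i => hload.bound (b i)
  have hbound : ∀ (G : P.Data) (v : D.Space), |D.load σ₀ σ₀Γ G v| ≤
      (∑ i, 2 * D.energyNorm σ₀ σ₀Γ (w i) * K i) * G.size * D.energyNorm σ₀ σ₀Γ v := by
    intro G v
    have hsum : D.load σ₀ σ₀Γ G v = ∑ i, D.form σ₀ σ₀Γ (w i) v * D.load σ₀ σ₀Γ G (b i) := by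
      have h1 : ((hload.linear G).mk') v = _ := congrArg ((hload.linear G).mk') (b.sum_repr v).symm
      rw [map_sum] at h1
      refine h1.trans (Finset.sum_congr rfl fun i _ => ?_)
      rw [map_smul, hw]
      rfl
    rw [hsum, Finset.sum_mul, Finset.sum_mul]
    refine (Finset.abs_sum_le_sum_abs _ _).trans (Finset.sum_le_sum fun i _ => ?_)
    rw [abs_mul]
    refine (mul_le_mul (hcont (w i) v) (hK i G) (abs_nonneg _)
      (mul_nonneg (mul_nonneg two_pos.le (hN0 _)) (hN0 _))).trans_eq ?_
    ring
  refine ⟨_, fun G => ⟨hbound G, fun u hu => ?_⟩⟩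
  have hK' : 0 ≤ ∑ i, 2 * D.energyNorm σ₀ σ₀Γ (w i) * K i :=
    Finset.sum_nonneg fun i _ => mul_nonneg (mul_nonneg two_pos.le (hN0 _)) (hK0 i)
  -- Testing with v = u: c‖u‖² ≤ A(u,u) = L(u) ≤ K G ‖u‖, and one factor ‖u‖ is cancelled unless it
  -- is zero.
  have h1 := (hcoer u).trans (((hu u).le.trans (le_abs_self _)).trans (hbound G u))
  rcases eq_or_lt_of_le (hN0 u) with h0 | h0
  · rw [← h0]
    exact mul_nonneg (div_nonneg hK' (by norm_num)) G.size_nonneg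
  · refine le_of_mul_le_mul_right ?_ h0
    rw [div_mul_eq_mul_div, div_mul_eq_mul_div, le_div_iff₀ (by norm_num)]
    linarith [sq (D.energyNorm σ₀ σ₀Γ u)]
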